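/- Let $\mathcal H_A,\mathcal H_B$ be finite-dimensional complex Hilbert spaces with computational bases, and let $U$ be a unitary on $\mathcal H_A\otimes\mathcal H_B$ of Schmidt rank $3$, i.e. $U=\sum_{j=1}^3 A_j\otimes B_j$ with $A_1,A_2,A_3$ linearly independent and $B_1,B_2,B_3$ linearly independent. A permutation unitary is a unitary matrix with entries $0,1$; a complex permutation unitary is a unitary matrix with exactly one nonzero entry in each row and column. Two operators $U,U'$ are equivalent under local permutation unitaries if $U'=(P\otimes Q)\,U\,(P'\otimes Q')$ for permutation unitaries $P,P',Q,Q'$. A $k$-term controlled-permutation unitary (controlled from $A$) is $\sum_{j=1}^k P_j\otimes V_j$, where the $P_j$ are nonzero mutually orthogonal projectors, diagonal in the computational basis, with $\sum_j P_j=I$, and the $V_j$ are permutation unitaries; control from $B$ is defined with the two parties exchanged. A direct sum from the $A$ side is a direct sum along a splitting of the computational basis of $\mathcal H_A$ into two parts (each summand acting on the span of one part tensored with $\mathcal H_B$), and similarly from the $B$ side. "$U$ can be implemented using $e$ ebits (and $c$ c-bits)" means that some finite-round LOCC protocol, using local ancillas and one maximally entangled state of Schmidt rank $N$ with $\log_2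 N\le e$, implements $U$ exactly, deterministically and on a single copy (and in every run the total classical communication, a message with $M$ possible values counting as $\log_2 M$ bits, is at most $c$). (i) If $U$ is a permutation unitary, then under local permutation unitaries it is equivalent to a three-term or a four-term controlled-permutation unitary (controlled from $A$ or from $B$), or to the direct sum, from the $A$ or from the $B$ side, of a product permutation unitary and a two-term controlled-permutation unitary (controlled from either side). Moreover, $U$ can be implemented using $2$ ebits and $4$ c-bits. (ii) If $U$ is a complex permutation unitary that is not equivalent to a diagonal unitary under local permutation unitaries, then $U$ can be implemented using $3$ ebits and LOCC. (iii) If $U$ is a diagonal complex permutation unitary, and among its diagonal blocks $\langle j|_A U|j\rangle_A$ there are the identity $I_B$ and a diagonal matrix with exactly two distinct diagonal elements, then $U$ can be implemented using $2$ ebits and LOCC. -/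

import Mathlib

open scoped Kronecker Matrix

section MatrixNotions

/-- A permutation unitary (real permutation matrix): a unitary matrix with entries `0` and `1`. -/
def IsPermUnitary {n : Type*} [Fintype n] [DecidableEq n] (M : Matrix n n ℂ) : Prop :=
  M ∈ Matrix.unitaryGroup n ℂ ∧ ∀ i j, M i j = 0 ∨ M i j = 1

/-- A complex permutation unitary: a unitary matrix with exactly one nonzero entry in each row
and in each column. -/
def IsComplexPermUnitary {n : Type*} [Fintype n] [DecidableEq n] (M : Matrix n n ℂ) : Prop :=
  M ∈ Matrix.unitaryGroup n ℂ ∧ (∀ i, ∃! j, M i j ≠ 0) ∧ (∀ j, ∃! i, M i j ≠ 0)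

/-- The bipartite operator `U` on `ℂ^A ⊗ ℂ^B` has Schmidt rank `r`: `U = ∑ j, P j ⊗ Q j` with `r`
terms, where the `P j` are linearly independent and the `Q j` are linearly independent. -/
def HasSchmidtRank {A B : Type*} (U : Matrix (A × B) (A × B) ℂ) (r : ℕ) : Prop :=
  ∃ (P : Fin r → Matrix A A ℂ) (Q : Fin r → Matrix B B ℂ),
    LinearIndependent ℂ P ∧ LinearIndependent ℂ Q ∧ U = ∑ j, P j ⊗ₖ Q j

/-- Equivalence under local permutation unitaries (acting before and after, on both sides). -/
def LocalPermEquiv {A B : Type*} [Fintype A] [DecidableEq A] [Fintype B] [DecidableEq B]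
    (U V : Matrix (A × B) (A × B) ℂ) : Prop :=
  ∃ (P P' : Matrix A A ℂ) (Q Q' : Matrix B B ℂ),
    IsPermUnitary P ∧ IsPermUnitary P' ∧ IsPermUnitary Q ∧ IsPermUnitary Q' ∧
      V = (P ⊗ₖ Q) * U * (P' ⊗ₖ Q')

/-- The same bipartite operator with the roles of the two parties exchanged. -/
def swapParties {A B : Type*} (U : Matrix (A × B) (A × B) ℂ) : Matrix (B × A) (B × A) ℂ :=
  U.submatrix Prod.swap Prod.swap

/-- `U` is a `k`-term controlled-permutation unitary, controlled from the first party in the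
computational basis: `U = ∑ j, P j ⊗ V j` with `k` nonzero mutually orthogonal projectors `P j`
that are diagonal in the computational basis and sum to the identity, and permutation unitaries
`V j`. (A diagonal idempotent matrix is automatically Hermitian.) -/
def IsControlledPermFromFirst {A B : Type*} [Fintype A] [DecidableEq A] [Fintype B] [DecidableEq B]
    (k : ℕ) (U : Matrix (A × B) (A × B) ℂ) : Prop :=
  ∃ (P : Fin k → Matrix A A ℂ) (V : Fin k → Matrix B B ℂ),
    (∀ j, P j ≠ 0) ∧ (∀ j, (P j).IsDiag) ∧
    (∀ i j, P i * P j = if i = j then P i else 0) ∧ (∑ j, P j = 1) ∧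
    (∀ j, IsPermUnitary (V j)) ∧ U = ∑ j, P j ⊗ₖ V j

/-- `U` is a `k`-term controlled-permutation unitary, controlled from one of the two sides. -/
def IsControlledPerm {A B : Type*} [Fintype A] [DecidableEq A] [Fintype B] [DecidableEq B]
    (k : ℕ) (U : Matrix (A × B) (A × B) ℂ) : Prop :=
  IsControlledPermFromFirst k U ∨ IsControlledPermFromFirst k (swapParties U)

/-- `U` is a product permutation unitary. -/
def IsProductPerm {A B : Type*} [Fintype A] [DecidableEq A] [Fintype B] [DecidableEq B]
    (U : Matrix (A × B) (A × B) ℂ) : Prop :=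
  ∃ (P : Matrix A A ℂ) (Q : Matrix B B ℂ), IsPermUnitary P ∧ IsPermUnitary Q ∧ U = P ⊗ₖ Q

/-- The direct sum, from the side of the first party, of `V` acting on `ℂ^S ⊗ ℂ^B` and `W` acting
on `ℂ^(A ∖ S) ⊗ ℂ^B`, for a set `S` of computational basis states of the first party. -/
def directSumFirst {A B : Type*} [DecidableEq A] (S : Finset A)
    (V : Matrix ({a // a ∈ S} × B) ({a // a ∈ S} × B) ℂ)
    (W : Matrix ({a // a ∉ S} × B) ({a // a ∉ S} × B) ℂ) : Matrix (A × B) (A × B) ℂ :=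
  fun x y =>
    if hx : x.1 ∈ S then
      if hy : y.1 ∈ S then V (⟨x.1, hx⟩, x.2) (⟨y.1, hy⟩, y.2) else 0
    else
      if hy : y.1 ∈ S then 0 else W (⟨x.1, hx⟩, x.2) (⟨y.1, hy⟩, y.2)

/-- `U` is the direct sum, from the side of the first party, of a product permutation unitary and a
two-term controlled-permutation unitary. -/
def IsProductPlusControlledFirst {A B : Type*} [Fintype A] [DecidableEq A] [Fintype B]
    [DecidableEq B] (U : Matrix (A × B) (A × B) ℂ) : Prop :=
  ∃ (S : Finset A) (V : Matrix ({a // a ∈ S} × B) ({a // a ∈ S} × B) ℂ)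
    (W : Matrix ({a // a ∉ S} × B) ({a // a ∉ S} × B) ℂ),
    IsProductPerm V ∧ IsControlledPerm 2 W ∧ U = directSumFirst S V W

/-- `U` is the direct sum (from one of the two sides) of a product permutation unitary and a
two-term controlled-permutation unitary. -/
def IsProductPlusControlled {A B : Type*} [Fintype A] [DecidableEq A] [Fintype B]
    [DecidableEq B] (U : Matrix (A × B) (A × B) ℂ) : Prop :=
  IsProductPlusControlledFirst U ∨ IsProductPlusControlledFirst (swapParties U)

/-- The diagonal block of `U` belonging to the computational basis state `a` of the first party. -/
def diagBlock {A B : Type*} (U : Matrix (A × B) (A × B) ℂ) (a : A) : Matrix B B ℂ :=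
  fun b b' => U (a, b) (a, b')

end MatrixNotions

section LOCC

/-- Finite-round LOCC protocols on workspaces `ℂ^α` (Alice, data and ancillas) and `ℂ^β` (Bob).
A protocol is either finished, or one of the parties applies a quantum instrument to their own workspace,
sends the outcome `m : Fin M` to the other party, and the protocol continues depending on `m`.
The instrument is given by Kraus operators `K m k`; outcome `m` happens through the
completely positive map `ρ ↦ ∑ k, K m k * ρ * (K m k)ᴴ`. -/
inductive LOCCProtocol (α β : Type*) [Fintype α] [DecidableEq α] [Fintype β] [DecidableEq β]
  | done : LOCCProtocol α β
  | alice (M κ : ℕ) (K : Fin M → Fin κ → Matrix α α ℂ)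
      (hK : ∑ m, ∑ k, (K m k)ᴴ * K m k = 1)
      (next : Fin M → LOCCProtocol α β) : LOCCProtocol α β
  | bob (M κ : ℕ) (K : Fin M → Fin κ → Matrix β β ℂ)
      (hK : ∑ m, ∑ k, (K m k)ᴴ * K m k = 1)
      (next : Fin M → LOCCProtocol α β) : LOCCProtocol α β

/-- The action of a protocol on a (not necessarily normalized) joint state, summed over all
measurement outcomes. -/
def LOCCProtocol.run {α β : Type*} [Fintype α] [DecidableEq α] [Fintype β] [DecidableEq β] :
    LOCCProtocol α β → Matrix (α × β) (α × β) ℂ → Matrix (α × β) (α × β) ℂ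
  | .done, ρ => ρ
  | .alice _ _ K _ next, ρ => ∑ m, ∑ k, (next m).run
      ((K m k ⊗ₖ (1 : Matrix β β ℂ)) * ρ * (K m k ⊗ₖ (1 : Matrix β β ℂ))ᴴ)
  | .bob _ _ K _ next, ρ => ∑ m, ∑ k, (next m).run
      (((1 : Matrix α α ℂ) ⊗ₖ K m k) * ρ * ((1 : Matrix α α ℂ) ⊗ₖ K m k)ᴴ)

/-- The classical communication cost in c-bits: a message from an alphabet of `M` signals costs
`log₂ M`; the total (over both directions) is taken in the worst case over all branches. -/
noncomputable def LOCCProtocol.cbits {α β : Type*} [Fintype α] [DecidableEq α] [Fintype β]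
    [DecidableEq β] : LOCCProtocol α β → ℝ
  | .done => 0
  | .alice M _ _ _ next => Real.logb 2 M + ⨆ m, (next m).cbits
  | .bob M _ _ _ next => Real.logb 2 M + ⨆ m, (next m).cbits

/-- The initial ancilla vector: a maximally entangled state of Schmidt rank `N` shared by the two
parties, together with a further local ancilla of each party in the state `|0⟩`. -/
noncomputable def resourceState (N s t : ℕ) :
    (Fin N × Fin (s + 1)) × (Fin N × Fin (t + 1)) → ℂ :=
  fun x => if x.1.1 = x.2.1 ∧ x.1.2 = 0 ∧ x.2.2 = 0 then ((1 / Real.sqrt N : ℝ) : ℂ) else 0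

/-- The joint initial state: `ρ` on the data systems, and the resource state on the ancillas. -/
noncomputable def initialState {A B : Type*} (N s t : ℕ) (ρ : Matrix (A × B) (A × B) ℂ) :
    Matrix ((A × Fin N × Fin (s + 1)) × (B × Fin N × Fin (t + 1)))
      ((A × Fin N × Fin (s + 1)) × (B × Fin N × Fin (t + 1))) ℂ :=
  fun x y => ρ (x.1.1, x.2.1) (y.1.1, y.2.1) *
    (resourceState N s t (x.1.2, x.2.2) * star (resourceState N s t (y.1.2, y.2.2)))

/-- Discarding (tracing out) the ancillas of both parties. -/
def discardAncillas {A B X Y : Type*} [Fintype X] [Fintype Y]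
    (σ : Matrix ((A × X) × (B × Y)) ((A × X) × (B × Y)) ℂ) : Matrix (A × B) (A × B) ℂ :=
  fun i j => ∑ x, ∑ y, σ ((i.1, x), (i.2, y)) ((j.1, x), (j.2, y))

/-- `U` can be implemented exactly, deterministically and in one shot by LOCC with `e` ebits of
entanglement and `c` c-bits of classical communication (at most): there is a protocol starting from
a maximally entangled state of Schmidt rank `N`, `log₂ N ≤ e`, that sends every input `ρ` to
`U ρ Uᴴ`. (As both sides are linear in `ρ`, this is the same for all density matrices and for all
matrices `ρ`.) -/
def ImplementableWith {A B : Type*} [Fintype A] [DecidableEq A] [Fintype B] [DecidableEq B]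
    (U : Matrix (A × B) (A × B) ℂ) (e c : ℝ) : Prop :=
  ∃ (N s t : ℕ) (p : LOCCProtocol (A × Fin N × Fin (s + 1)) (B × Fin N × Fin (t + 1))),
    0 < N ∧ Real.logb 2 N ≤ e ∧ p.cbits ≤ c ∧
      ∀ ρ : Matrix (A × B) (A × B) ℂ,
        discardAncillas (p.run (initialState N s t ρ)) = U * ρ * Uᴴ

/-- `U` can be implemented with `e` ebits and LOCC (any finite amount of communication). -/
def ImplementableWithLOCC {A B : Type*} [Fintype A] [DecidableEq A] [Fintype B] [DecidableEq B]
    (U : Matrix (A × B) (A × B) ℂ) (e : ℝ) : Prop :=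
  ∃ c : ℝ, ImplementableWith U e c

end LOCC

/-! A complex permutation unitary is a permutation `π` of pairs of basis states with unimodular
weights. Its blocks on the second party lie in the span of the three second Schmidt factors, so any
four of them are linearly dependent. Sparse blocks with disjoint supports are independent, and this
conflict forces the structure.

Normal form. The entry in row `(i, b)` lies in some block column and some inner column `τ i b`. If
`τ` does not depend on `i`, the second party undergoes a fixed permutation and `U` is controlled
from that party, up to a local permutation. Otherwise each row of blocks meets at most two blocks,
and all rows meeting two split `B` in the same way (`pattern_const_or_common_partition`). The same
holds for columns, and counting matches the two partitions (`types_consistent`). So `U` is a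
permutation of `A` controlled by one bit of `B`, followed by monomial matrices on `B` controlled
from `A`, all of them in a space of dimension at most three (`IsNormalForm`).

Permutations. If the two permutations of `A` coincide, the permutation matrices on `B` number at
least three by the Schmidt rank, and at most four because two entries distinguish them
(`exists_two_bits`). If they differ, some row splits and both column parts of its matrix lie in the
space, so only one further matrix is possible (`IsNormalForm.eq_of_ne`). Then `U` is a direct sum of
the required kind, and one control bit in each direction suffices.

Complex permutations. The unimodular monomial matrices on `B` fall into at most four classes, up to
phases that depend on one bit of `B`. This rests on the fact that three points determine a circle
(`exists_two_classes`). Two bits of control from `A` and one from `B` cost three ebits.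

Diagonal unitaries. The identity and the two-valued block yield the indicators of two classes of
`B`. Modulo these, all diagonals are multiples of a single function, and the circle argument shows
that each class is controlled by one bit of one party (`exists_form_of_affine`). An adaptive
protocol spends one ebit on the class and one on that bit. -/

namespace LOCCProtocol

/-! ### Linearity, composition, extension and reversal of protocols. -/

variable {α β α' β' γ δ : Type*} [Fintype α] [DecidableEq α] [Fintype β] [DecidableEq β]
  [Fintype α'] [DecidableEq α'] [Fintype β'] [DecidableEq β']
  [Fintype γ] [DecidableEq γ] [Fintype δ] [DecidableEq δ]

theorem run_add (p : LOCCProtocol α β) (ρ σ : Matrix (α × β) (α × β) ℂ) :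
    p.run (ρ + σ) = p.run ρ + p.run σ := by
  induction p generalizing ρ σ with
  | done => rfl
  | alice M κ K hK next ih =>
    simp only [run, Matrix.mul_add, Matrix.add_mul, ih, Finset.sum_add_distrib]
  | bob M κ K hK next ih =>
    simp only [run, Matrix.mul_add, Matrix.add_mul, ih, Finset.sum_add_distrib]

theorem run_smul (p : LOCCProtocol α β) (c : ℂ) (ρ : Matrix (α × β) (α × β) ℂ) :
    p.run (c • ρ) = c • p.run ρ := by
  induction p generalizing ρ with
  | done => rfl
  | alice M κ K hK next ih =>
    simp only [run, Matrix.mul_smul, Matrix.smul_mul, ih, Finset.smul_sum]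
  | bob M κ K hK next ih =>
    simp only [run, Matrix.mul_smul, Matrix.smul_mul, ih, Finset.smul_sum]

theorem run_sum {ι : Type*} (p : LOCCProtocol α β) (s : Finset ι)
    (ρ : ι → Matrix (α × β) (α × β) ℂ) : p.run (∑ i ∈ s, ρ i) = ∑ i ∈ s, p.run (ρ i) :=
  map_sum (AddMonoidHom.mk' p.run p.run_add) ρ s

/-- Run the second protocol after the first one has finished. -/
def append : LOCCProtocol α β → LOCCProtocol α β → LOCCProtocol α β
  | .done, q => q
  | .alice M κ K hK next, q => .alice M κ K hK fun m => (next m).append q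
  | .bob M κ K hK next, q => .bob M κ K hK fun m => (next m).append q

theorem run_append (p q : LOCCProtocol α β) (ρ : Matrix (α × β) (α × β) ℂ) :
    (p.append q).run ρ = q.run (p.run ρ) := by
  induction p generalizing ρ with
  | done => rfl
  | alice M κ K hK next ih => simp only [append, run, ih, run_sum]
  | bob M κ K hK next ih => simp only [append, run, ih, run_sum]

theorem cbits_nonneg (p : LOCCProtocol α β) : 0 ≤ p.cbits := by
  have hlog : ∀ M : ℕ, 0 ≤ Real.logb 2 M := by
    intro M
    rcases Nat.eq_zero_or_pos M with rfl | h
    · simp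
    · exact Real.logb_nonneg (by norm_num) (by exact_mod_cast h)
  induction p with
  | done => exact le_refl _
  | alice M κ K hK next ih => exact add_nonneg (hlog M) (Real.iSup_nonneg ih)
  | bob M κ K hK next ih => exact add_nonneg (hlog M) (Real.iSup_nonneg ih)

/-- The supremum over an empty alphabet is `0` by convention, hence the need for `0 ≤ c`. -/
theorem iSup_le_iSup_add {M : ℕ} {f g : Fin M → ℝ} {c : ℝ} (hc : 0 ≤ c)
    (h : ∀ m, f m ≤ g m + c) : ⨆ m, f m ≤ (⨆ m, g m) + c := by
  rcases isEmpty_or_nonempty (Fin M) with hM | hM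
  · simpa using hc
  · exact ciSup_le fun m =>
      (h m).trans (by have := le_ciSup (Set.finite_range g).bddAbove m; linarith)

theorem cbits_append_le (p q : LOCCProtocol α β) :
    (p.append q).cbits ≤ p.cbits + q.cbits := by
  induction p with
  | done => simp [append, cbits]
  | alice M κ K hK next ih =>
    have := iSup_le_iSup_add q.cbits_nonneg ih
    simp only [append, cbits]; linarith
  | bob M κ K hK next ih =>
    have := iSup_le_iSup_add q.cbits_nonneg ih
    simp only [append, cbits]; linarith

theorem sum_conjTranspose_mul_extend {M κ : ℕ} (e : α' ≃ α × γ) {K : Fin M → Fin κ → Matrix α α ℂ}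
    (hK : ∑ m, ∑ k, (K m k)ᴴ * K m k = 1) :
    ∑ m, ∑ k, ((K m k ⊗ₖ (1 : Matrix γ γ ℂ)).submatrix e e)ᴴ *
      (K m k ⊗ₖ (1 : Matrix γ γ ℂ)).submatrix e e = 1 := by
  have h : ∀ m k, ((K m k ⊗ₖ (1 : Matrix γ γ ℂ)).submatrix e e)ᴴ *
      (K m k ⊗ₖ (1 : Matrix γ γ ℂ)).submatrix e e
      = (((K m k)ᴴ * K m k) ⊗ₖ (1 : Matrix γ γ ℂ)).submatrix e e := by
    intro m k
    rw [Matrix.conjTranspose_submatrix, Matrix.submatrix_mul_equiv, Matrix.conjTranspose_kronecker,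
      ← Matrix.mul_kronecker_mul, Matrix.conjTranspose_one, Matrix.one_mul]
  simp only [h]
  ext x y
  have := congrFun (congrFun hK (e x).1) (e y).1
  simp only [Matrix.sum_apply] at this
  simp only [Matrix.sum_apply, Matrix.submatrix_apply, Matrix.kroneckerMap_apply,
    ← Finset.sum_mul, this]
  have h2 := congrFun (congrFun (Matrix.one_kronecker_one (α := ℂ) (m := α) (n := γ)) (e x)) (e y)
  rw [Matrix.kroneckerMap_apply] at h2
  rw [h2]
  simp [Matrix.one_apply]

/-- A protocol on larger workspaces, leaving the additional systems alone. -/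
noncomputable def extend (e : α' ≃ α × γ) (f : β' ≃ β × δ) :
    LOCCProtocol α β → LOCCProtocol α' β'
  | .done => .done
  | .alice M κ K hK next => .alice M κ
      (fun m k => (K m k ⊗ₖ (1 : Matrix γ γ ℂ)).submatrix e e)
      (sum_conjTranspose_mul_extend e hK) fun m => (next m).extend e f
  | .bob M κ K hK next => .bob M κ
      (fun m k => (K m k ⊗ₖ (1 : Matrix δ δ ℂ)).submatrix f f)
      (sum_conjTranspose_mul_extend f hK) fun m => (next m).extend e f

theorem cbits_extend (e : α' ≃ α × γ) (f : β' ≃ β × δ) (p : LOCCProtocol α β) :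
    (p.extend e f).cbits = p.cbits := by
  induction p with
  | done => rfl
  | alice M κ K hK next ih => simp only [extend, cbits, ih]
  | bob M κ K hK next ih => simp only [extend, cbits, ih]

theorem kronecker_one_mul_apply {ι : Type*} (K : Matrix α α ℂ) (G : Matrix (α × β) ι ℂ)
    (a : α) (b : β) (i : ι) :
    ((K ⊗ₖ (1 : Matrix β β ℂ)) * G) (a, b) i = ∑ a', K a a' * G (a', b) i := by
  simp [Matrix.mul_apply, Fintype.sum_prod_type, Matrix.kroneckerMap_apply, Matrix.one_apply]

theorem one_kronecker_mul_apply {ι : Type*} (K : Matrix β β ℂ) (G : Matrix (α × β) ι ℂ)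
    (a : α) (b : β) (i : ι) :
    (((1 : Matrix α α ℂ) ⊗ₖ K) * G) (a, b) i = ∑ b', K b b' * G (a, b') i := by
  simp only [Matrix.mul_apply, Fintype.sum_prod_type_right, Matrix.kroneckerMap_apply,
    Matrix.one_apply]
  simp

theorem mul_kronecker_one_conjTranspose_apply {ι : Type*} (K : Matrix α α ℂ)
    (G : Matrix ι (α × β) ℂ) (a : α) (b : β) (i : ι) :
    (G * (K ⊗ₖ (1 : Matrix β β ℂ))ᴴ) i (a, b) = ∑ a', G i (a', b) * star (K a a') := by
  simp [Matrix.mul_apply, Fintype.sum_prod_type, Matrix.kroneckerMap_apply, Matrix.one_apply,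
    apply_ite]

theorem mul_one_kronecker_conjTranspose_apply {ι : Type*} (K : Matrix β β ℂ)
    (G : Matrix ι (α × β) ℂ) (a : α) (b : β) (i : ι) :
    (G * ((1 : Matrix α α ℂ) ⊗ₖ K)ᴴ) i (a, b) = ∑ b', G i (a, b') * star (K b b') := by
  simp only [Matrix.mul_apply, Fintype.sum_prod_type_right, Matrix.conjTranspose_apply,
    Matrix.kroneckerMap_apply, Matrix.one_apply]
  simp [apply_ite]

/-- The block of an operator on extended workspaces that belongs to fixed basis states of the
additional systems. -/
def extBlock (e : α' ≃ α × γ) (f : β' ≃ β × δ) (g g' : γ × δ)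
    (ρ : Matrix (α' × β') (α' × β') ℂ) : Matrix (α × β) (α × β) ℂ :=
  ρ.submatrix (fun x => (e.symm (x.1, g.1), f.symm (x.2, g.2)))
    (fun x => (e.symm (x.1, g'.1), f.symm (x.2, g'.2)))

theorem extBlock_sum {ι : Type*} (e : α' ≃ α × γ) (f : β' ≃ β × δ) (g g' : γ × δ) (s : Finset ι)
    (ρ : ι → Matrix (α' × β') (α' × β') ℂ) :
    extBlock e f g g' (∑ i ∈ s, ρ i) = ∑ i ∈ s, extBlock e f g g' (ρ i) := by
  ext x y
  simp [extBlock, Matrix.sum_apply]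

theorem extBlock_alice (e : α' ≃ α × γ) (f : β' ≃ β × δ) (g g' : γ × δ) (K : Matrix α α ℂ)
    (ρ : Matrix (α' × β') (α' × β') ℂ) :
    extBlock e f g g' (((K ⊗ₖ (1 : Matrix γ γ ℂ)).submatrix e e ⊗ₖ (1 : Matrix β' β' ℂ)) * ρ *
      ((K ⊗ₖ (1 : Matrix γ γ ℂ)).submatrix e e ⊗ₖ (1 : Matrix β' β' ℂ))ᴴ) =
    (K ⊗ₖ (1 : Matrix β β ℂ)) * extBlock e f g g' ρ * (K ⊗ₖ (1 : Matrix β β ℂ))ᴴ := by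
  ext ⟨a, b⟩ ⟨a', b'⟩
  simp only [extBlock, Matrix.submatrix_apply, mul_kronecker_one_conjTranspose_apply,
    kronecker_one_mul_apply]
  rw [← e.symm.sum_comp]
  simp only [← e.symm.sum_comp (fun z => _ * ρ (z, _) _)]
  simp [Fintype.sum_prod_type, Matrix.kroneckerMap_apply, Matrix.one_apply, apply_ite]

theorem extBlock_bob (e : α' ≃ α × γ) (f : β' ≃ β × δ) (g g' : γ × δ) (K : Matrix β β ℂ)
    (ρ : Matrix (α' × β') (α' × β') ℂ) :
    extBlock e f g g' (((1 : Matrix α' α' ℂ) ⊗ₖ (K ⊗ₖ (1 : Matrix δ δ ℂ)).submatrix f f) * ρ *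
      ((1 : Matrix α' α' ℂ) ⊗ₖ (K ⊗ₖ (1 : Matrix δ δ ℂ)).submatrix f f)ᴴ) =
    ((1 : Matrix α α ℂ) ⊗ₖ K) * extBlock e f g g' ρ * ((1 : Matrix α α ℂ) ⊗ₖ K)ᴴ := by
  ext ⟨a, b⟩ ⟨a', b'⟩
  simp only [extBlock, Matrix.submatrix_apply, mul_one_kronecker_conjTranspose_apply,
    one_kronecker_mul_apply]
  rw [← f.symm.sum_comp]
  simp only [← f.symm.sum_comp (fun z => _ * ρ (_, z) _)]
  simp [Fintype.sum_prod_type, Matrix.kroneckerMap_apply, Matrix.one_apply, apply_ite]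

/-- The extended Kraus operators are the identity on the added systems, so they never mix basis
labels of these systems and each block evolves on its own. No product structure is assumed: the
added systems may be entangled with the rest. -/
theorem extBlock_run_extend (e : α' ≃ α × γ) (f : β' ≃ β × δ) (g g' : γ × δ)
    (p : LOCCProtocol α β) (ρ : Matrix (α' × β') (α' × β') ℂ) :
    extBlock e f g g' ((p.extend e f).run ρ) = p.run (extBlock e f g g' ρ) := by
  induction p generalizing ρ with
  | done => rfl
  | alice M κ K hK next ih => simp only [extend, run, extBlock_sum, ih, extBlock_alice]
  | bob M κ K hK next ih => simp only [extend, run, extBlock_sum, ih, extBlock_bob]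

/-- The same protocol with the roles of the two parties exchanged. -/
def swap : LOCCProtocol α β → LOCCProtocol β α
  | .done => .done
  | .alice M κ K hK next => .bob M κ K hK fun m => (next m).swap
  | .bob M κ K hK next => .alice M κ K hK fun m => (next m).swap

theorem cbits_swap (p : LOCCProtocol α β) : p.swap.cbits = p.cbits := by
  induction p with
  | done => rfl
  | alice M κ K hK next ih => simp only [swap, cbits, ih]
  | bob M κ K hK next ih => simp only [swap, cbits, ih]

theorem run_swap (p : LOCCProtocol α β) (ρ : Matrix (α × β) (α × β) ℂ) :
    p.swap.run (ρ.submatrix Prod.swap Prod.swap) = (p.run ρ).submatrix Prod.swap Prod.swap := by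
  have hsum : ∀ {M κ : ℕ} (F : Fin M → Fin κ → Matrix (α × β) (α × β) ℂ),
      (∑ m, ∑ k, F m k).submatrix Prod.swap Prod.swap
        = ∑ m, ∑ k, (F m k).submatrix Prod.swap Prod.swap := by
    intro M κ F; ext x y; simp [Matrix.sum_apply]
  induction p generalizing ρ with
  | done => rfl
  | alice M κ K hK next ih =>
    simp only [swap, run, hsum, ← ih]
    refine Finset.sum_congr rfl fun m _ => Finset.sum_congr rfl fun k _ => ?_
    congr 1
    ext ⟨b, a⟩ ⟨b', a'⟩
    simp only [Matrix.submatrix_apply, mul_one_kronecker_conjTranspose_apply,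
      one_kronecker_mul_apply, mul_kronecker_one_conjTranspose_apply, kronecker_one_mul_apply,
      Prod.swap_prod_mk]
  | bob M κ K hK next ih =>
    simp only [swap, run, hsum, ← ih]
    refine Finset.sum_congr rfl fun m _ => Finset.sum_congr rfl fun k _ => ?_
    congr 1
    ext ⟨b, a⟩ ⟨b', a'⟩
    simp only [Matrix.submatrix_apply, mul_one_kronecker_conjTranspose_apply,
      one_kronecker_mul_apply, mul_kronecker_one_conjTranspose_apply, kronecker_one_mul_apply,
      Prod.swap_prod_mk]

end LOCCProtocol

/-! ### Implementations with a maximally entangled pair indexed by any finite type. -/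

section HasProtocol

variable {A B : Type*} [Fintype A] [DecidableEq A] [Fintype B] [DecidableEq B]

/-- The input `ρ` together with a maximally entangled state on two copies of `ℂ^ν`. -/
noncomputable def entangledInput (ν : Type*) [Fintype ν] [DecidableEq ν]
    (ρ : Matrix (A × B) (A × B) ℂ) : Matrix ((A × ν) × (B × ν)) ((A × ν) × (B × ν)) ℂ :=
  fun x y => if x.1.2 = x.2.2 ∧ y.1.2 = y.2.2 then
    (Fintype.card ν : ℂ)⁻¹ * ρ (x.1.1, x.2.1) (y.1.1, y.2.1) else 0

/-- `U` is implemented by a protocol that uses a maximally entangled state on two copies of `ℂ^ν`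
and at most `c` c-bits. -/
def HasProtocol (ν : Type*) [Fintype ν] [DecidableEq ν] (U : Matrix (A × B) (A × B) ℂ)
    (c : ℝ) : Prop :=
  ∃ p : LOCCProtocol (A × ν) (B × ν), p.cbits ≤ c ∧
    ∀ ρ, discardAncillas (p.run (entangledInput ν ρ)) = U * ρ * Uᴴ

variable {ν ν' : Type*} [Fintype ν] [DecidableEq ν] [Fintype ν'] [DecidableEq ν']

open LOCCProtocol

theorem discardAncillas_sum {X Y ι : Type*} [Fintype X] [Fintype Y] (s : Finset ι)
    (ρ : ι → Matrix ((A × X) × (B × Y)) ((A × X) × (B × Y)) ℂ) :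
    discardAncillas (∑ i ∈ s, ρ i) = ∑ i ∈ s, discardAncillas (ρ i) := by
  ext x y
  simp only [discardAncillas, Matrix.sum_apply]
  rw [Finset.sum_comm]
  refine (Finset.sum_congr rfl fun _ _ => Finset.sum_comm).trans ?_
  rw [Finset.sum_comm]
  exact Finset.sum_congr rfl fun _ _ => Finset.sum_comm

theorem discardAncillas_smul {X Y : Type*} [Fintype X] [Fintype Y] (c : ℂ)
    (ρ : Matrix ((A × X) × (B × Y)) ((A × X) × (B × Y)) ℂ) :
    discardAncillas (c • ρ) = c • discardAncillas ρ := by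
  ext x y
  simp [discardAncillas, Finset.mul_sum]

/-- A maximally entangled pair on a product index is a product of two such pairs. The protocol for
the right factor consumes one pair and leaves the other untouched for the left factor. -/
theorem HasProtocol.mul {U V : Matrix (A × B) (A × B) ℂ} {c c' : ℝ} (hU : HasProtocol ν U c)
    (hV : HasProtocol ν' V c') : HasProtocol (ν × ν') (U * V) (c + c') := by
  obtain ⟨p, hpc, hp⟩ := hU
  obtain ⟨q, hqc, hq⟩ := hV
  let e₁ : ∀ C : Type _, C × (ν × ν') ≃ (C × ν) × ν' := fun C => (Equiv.prodAssoc C ν ν').symm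
  let e₂ : ∀ C : Type _, C × (ν × ν') ≃ (C × ν') × ν := fun C =>
    ((Equiv.refl C).prodCongr (Equiv.prodComm ν ν')).trans (Equiv.prodAssoc C ν' ν).symm
  let f₁ : B × (ν × ν') ≃ (B × ν) × ν' := (Equiv.prodAssoc B ν ν').symm
  let f₂ : B × (ν × ν') ≃ (B × ν') × ν :=
    ((Equiv.refl B).prodCongr (Equiv.prodComm ν ν')).trans (Equiv.prodAssoc B ν' ν).symm
  refine ⟨(q.extend (e₂ A) f₂).append (p.extend (e₁ A) f₁), ?_, fun ρ => ?_⟩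
  · refine (cbits_append_le _ _).trans ?_
    rw [cbits_extend, cbits_extend]; linarith
  rw [run_append]
  set τ := (q.extend (e₂ A) f₂).run (entangledInput (ν × ν') ρ) with hτ
  -- For fixed labels of the unused pair the input is a scalar multiple of the input of `q`, so the
  -- first stage gives the same scalar times its output.
  have hτb : ∀ g g' : ν × ν, discardAncillas (extBlock (e₂ A) f₂ g g' τ)
      = (if g.1 = g.2 ∧ g'.1 = g'.2 then (Fintype.card ν : ℂ)⁻¹ else 0) • (V * ρ * Vᴴ) := by
    intro g g'
    rw [hτ, extBlock_run_extend]
    have : extBlock (e₂ A) f₂ g g' (entangledInput (ν × ν') ρ)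
        = (if g.1 = g.2 ∧ g'.1 = g'.2 then (Fintype.card ν : ℂ)⁻¹ else 0) •
          entangledInput ν' ρ := by
      ext ⟨⟨a, n⟩, b, m⟩ ⟨⟨a', n'⟩, b', m'⟩
      simp only [extBlock, e₂, f₂, Matrix.submatrix_apply, Equiv.symm_trans_apply,
        Equiv.symm_symm, Equiv.prodAssoc_apply, Equiv.prodCongr_symm, Equiv.prodCongr_apply,
        Equiv.refl_symm, Equiv.prodComm_symm, Prod.map_apply, Equiv.refl_apply,
        Equiv.prodComm_apply, Prod.swap_prod_mk, entangledInput, Prod.mk.injEq,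
        Matrix.smul_apply, smul_eq_mul, Fintype.card_prod, Nat.cast_mul]
      split_ifs <;> first | (exfalso; tauto) | ring
    rw [this, run_smul, discardAncillas_smul, hq]
  -- Discarding everything amounts to summing the diagonal blocks of the used pair and then
  -- discarding the other pair. By linearity the first of these can be done before `p` runs.
  have h1 : discardAncillas ((p.extend (e₁ A) f₁).run τ)
      = ∑ g : ν' × ν', discardAncillas (extBlock (e₁ A) f₁ g g ((p.extend (e₁ A) f₁).run τ)) := by
    ext x y
    simp only [discardAncillas, Matrix.sum_apply, Fintype.sum_prod_type, extBlock, e₁, f₁,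
      Matrix.submatrix_apply, Equiv.symm_symm, Equiv.prodAssoc_apply]
    rw [Finset.sum_comm]
    refine Finset.sum_congr rfl fun k _ => ?_
    rw [Finset.sum_comm]
    simp_rw [Finset.sum_comm (s := (Finset.univ : Finset ν)) (t := (Finset.univ : Finset ν'))]
    rw [Finset.sum_comm]
    rw [Finset.sum_comm]
    refine Finset.sum_congr rfl fun k _ => ?_
    rw [Finset.sum_comm]
  rw [h1, ← discardAncillas_sum]
  simp only [extBlock_run_extend]
  rw [← run_sum]
  have h2 : ∑ g : ν' × ν', extBlock (e₁ A) f₁ g g τ = entangledInput ν (V * ρ * Vᴴ) := by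
    ext ⟨⟨a, n⟩, b, m⟩ ⟨⟨a', n'⟩, b', m'⟩
    have := congrFun (congrFun (hτb (n, m) (n', m')) (a, b)) (a', b')
    simp only [discardAncillas, extBlock, e₂, f₂, Matrix.submatrix_apply, Equiv.symm_trans_apply,
        Equiv.symm_symm, Equiv.prodAssoc_apply, Equiv.prodCongr_symm, Equiv.prodCongr_apply,
        Equiv.refl_symm, Equiv.prodComm_symm, Prod.map_apply, Equiv.refl_apply,
        Equiv.prodComm_apply, Prod.swap_prod_mk, Matrix.smul_apply, smul_eq_mul, ite_mul,
        zero_mul] at this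
    simp only [Matrix.sum_apply, Fintype.sum_prod_type, extBlock, e₁, f₁,
      Matrix.submatrix_apply, Equiv.symm_symm, Equiv.prodAssoc_apply, this, entangledInput]
  rw [h2, hp, Matrix.conjTranspose_mul]
  simp only [Matrix.mul_assoc]

theorem HasProtocol.swapParties {U : Matrix (A × B) (A × B) ℂ} {c : ℝ}
    (hU : HasProtocol ν U c) : HasProtocol ν (swapParties U) c := by
  obtain ⟨p, hpc, hp⟩ := hU
  refine ⟨p.swap, by rwa [cbits_swap], fun ρ => ?_⟩
  have h1 : entangledInput ν ρ = (entangledInput ν (ρ.submatrix Prod.swap Prod.swap)).submatrix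
      Prod.swap Prod.swap := by
    ext ⟨⟨a, n⟩, b, m⟩ ⟨⟨a', n'⟩, b', m'⟩
    simp [entangledInput, eq_comm]
  rw [h1, run_swap]
  have h2 := congrArg (fun M => M.submatrix Prod.swap Prod.swap)
    (hp (ρ.submatrix Prod.swap Prod.swap))
  have h3 : (U * ρ.submatrix Prod.swap Prod.swap * Uᴴ).submatrix Prod.swap Prod.swap
      = _root_.swapParties U * ρ * (_root_.swapParties U)ᴴ := by
    have := Matrix.submatrix_mul_equiv (U * ρ.submatrix Prod.swap Prod.swap) Uᴴ
      (Prod.swap : B × A → A × B) (Equiv.prodComm B A) (Prod.swap : B × A → A × B)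
    have h' := Matrix.submatrix_mul_equiv U (ρ.submatrix Prod.swap Prod.swap)
      (Prod.swap : B × A → A × B) (Equiv.prodComm B A) (Prod.swap : B × A → A × B)
    simp only [Equiv.coe_prodComm] at this h'
    rw [← this, ← h']
    simp [_root_.swapParties, Matrix.submatrix_submatrix, Matrix.conjTranspose_submatrix]
  rw [← h3, ← h2]
  ext ⟨b, a⟩ ⟨b', a'⟩
  simp only [discardAncillas, Matrix.submatrix_apply, Prod.swap_prod_mk]
  rw [Finset.sum_comm]

/-- The pair is relabelled by `Fin (card ν)`; the extra local ancillas are one-dimensional. -/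
theorem HasProtocol.implementableWith [Nonempty ν] {U : Matrix (A × B) (A × B) ℂ} {c : ℝ}
    (hU : HasProtocol ν U c) : ImplementableWith U (Real.logb 2 (Fintype.card ν)) c := by
  obtain ⟨p, hpc, hp⟩ := hU
  let w : Fin (Fintype.card ν) × Fin (0 + 1) ≃ ν × Unit :=
    (Fintype.equivFin ν).symm.prodCongr (Equiv.ofUnique (Fin 1) Unit)
  let e : ∀ C : Type _, C × Fin (Fintype.card ν) × Fin (0 + 1) ≃ (C × ν) × Unit := fun C =>
    ((Equiv.refl C).prodCongr w).trans (Equiv.prodAssoc C ν Unit).symm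
  let f : B × Fin (Fintype.card ν) × Fin (0 + 1) ≃ (B × ν) × Unit :=
    ((Equiv.refl B).prodCongr w).trans (Equiv.prodAssoc B ν Unit).symm
  refine ⟨Fintype.card ν, 0, 0, p.extend (e A) f, Fintype.card_pos, le_refl _,
    by rwa [cbits_extend], fun ρ => ?_⟩
  rw [← hp ρ]
  have h1 : extBlock (e A) f ((), ()) ((), ()) (initialState (Fintype.card ν) 0 0 ρ)
      = entangledInput ν ρ := by
    ext ⟨⟨a, n⟩, b, m⟩ ⟨⟨a', n'⟩, b', m'⟩
    have hN : (((1 / Real.sqrt (Fintype.card ν) : ℝ) : ℂ)) *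
        star (((1 / Real.sqrt (Fintype.card ν) : ℝ) : ℂ)) = (Fintype.card ν : ℂ)⁻¹ := by
      rw [Complex.star_def, Complex.conj_ofReal, ← Complex.ofReal_mul]
      rw [div_mul_div_comm, Real.mul_self_sqrt (Nat.cast_nonneg _)]
      simp
    simp only [extBlock, e, f, w, Matrix.submatrix_apply, Equiv.symm_trans_apply,
        Equiv.symm_symm, Equiv.prodAssoc_apply, Equiv.prodCongr_symm, Equiv.prodCongr_apply,
        Equiv.refl_symm, Prod.map_apply, Equiv.refl_apply, initialState, resourceState,
        entangledInput, EmbeddingLike.apply_eq_iff_eq, Subsingleton.elim _ (0 : Fin 1)]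
    by_cases h : n = m <;> by_cases h' : n' = m' <;> simp only [h, h', and_true, and_false,
      true_and, false_and, if_true, if_false, mul_zero, zero_mul, star_zero, Fin.isValue]
    rw [hN, mul_comm]
  rw [← h1, ← extBlock_run_extend]
  ext ⟨a, b⟩ ⟨a', b'⟩
  simp only [discardAncillas]
  rw [← w.symm.sum_comp]
  simp only [← w.symm.sum_comp (fun y => (p.extend (e A) f).run _ (_, _, y) (_, _, y)),
    Fintype.sum_prod_type, Finset.univ_unique, Finset.sum_singleton]
  rfl

end HasProtocol

/-! ### Measurements with one Kraus operator for each message of a finite type. -/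

namespace LOCCProtocol

theorem sum_conjTranspose_mul_eq_one_iff {ι μ : Type*} [Fintype ι] [DecidableEq ι] [Fintype μ]
    {K : μ → Matrix ι ι ℂ} : ∑ m, (K m)ᴴ * K m = 1 ↔
      ∀ x y, ∑ m, ∑ z, star (K m z x) * K m z y = if x = y then 1 else 0 := by
  rw [← Matrix.ext_iff]
  simp only [Matrix.sum_apply, Matrix.mul_apply, Matrix.conjTranspose_apply, Matrix.one_apply]

section MessageTypes

variable {α β : Type*} [Fintype α] [DecidableEq α] [Fintype β] [DecidableEq β]
  {μ : Type*} [Fintype μ]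

/-- Alice measures with one Kraus operator for each message in a finite type. -/
noncomputable def aliceWith (K : μ → Matrix α α ℂ) (hK : ∑ m, (K m)ᴴ * K m = 1)
    (next : μ → LOCCProtocol α β) : LOCCProtocol α β :=
  .alice (Fintype.card μ) 1 (fun m _ => K ((Fintype.equivFin μ).symm m))
    (by
      simp only [Finset.univ_unique, Finset.sum_singleton]
      exact ((Fintype.equivFin μ).symm.sum_comp fun m => (K m)ᴴ * K m).trans hK)
    fun m => next ((Fintype.equivFin μ).symm m)

/-- Bob measures with one Kraus operator for each message in a finite type. -/
noncomputable def bobWith (K : μ → Matrix β β ℂ) (hK : ∑ m, (K m)ᴴ * K m = 1)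
    (next : μ → LOCCProtocol α β) : LOCCProtocol α β :=
  .bob (Fintype.card μ) 1 (fun m _ => K ((Fintype.equivFin μ).symm m))
    (by
      simp only [Finset.univ_unique, Finset.sum_singleton]
      exact ((Fintype.equivFin μ).symm.sum_comp fun m => (K m)ᴴ * K m).trans hK)
    fun m => next ((Fintype.equivFin μ).symm m)

theorem run_aliceWith (K : μ → Matrix α α ℂ) (hK : ∑ m, (K m)ᴴ * K m = 1)
    (next : μ → LOCCProtocol α β) (ρ : Matrix (α × β) (α × β) ℂ) :
    (aliceWith K hK next).run ρ = ∑ m, (next m).run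
      ((K m ⊗ₖ (1 : Matrix β β ℂ)) * ρ * (K m ⊗ₖ (1 : Matrix β β ℂ))ᴴ) := by
  simp only [aliceWith, run, Finset.univ_unique, Finset.sum_singleton]
  exact (Fintype.equivFin μ).symm.sum_comp fun m => (next m).run
      ((K m ⊗ₖ (1 : Matrix β β ℂ)) * ρ * (K m ⊗ₖ (1 : Matrix β β ℂ))ᴴ)

theorem run_bobWith (K : μ → Matrix β β ℂ) (hK : ∑ m, (K m)ᴴ * K m = 1)
    (next : μ → LOCCProtocol α β) (ρ : Matrix (α × β) (α × β) ℂ) :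
    (bobWith K hK next).run ρ = ∑ m, (next m).run
      (((1 : Matrix α α ℂ) ⊗ₖ K m) * ρ * ((1 : Matrix α α ℂ) ⊗ₖ K m)ᴴ) := by
  simp only [bobWith, run, Finset.univ_unique, Finset.sum_singleton]
  exact (Fintype.equivFin μ).symm.sum_comp fun m => (next m).run
      (((1 : Matrix α α ℂ) ⊗ₖ K m) * ρ * ((1 : Matrix α α ℂ) ⊗ₖ K m)ᴴ)

theorem cbits_aliceWith_le (K : μ → Matrix α α ℂ) (hK : ∑ m, (K m)ᴴ * K m = 1)
    (next : μ → LOCCProtocol α β) {c : ℝ} (hc : 0 ≤ c) (h : ∀ m, (next m).cbits ≤ c) :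
    (aliceWith K hK next).cbits ≤ Real.logb 2 (Fintype.card μ) + c := by
  simp only [aliceWith, cbits]
  gcongr
  exact Real.iSup_le (fun m => h _) hc

theorem cbits_bobWith_le (K : μ → Matrix β β ℂ) (hK : ∑ m, (K m)ᴴ * K m = 1)
    (next : μ → LOCCProtocol α β) {c : ℝ} (hc : 0 ≤ c) (h : ∀ m, (next m).cbits ≤ c) :
    (bobWith K hK next).cbits ≤ Real.logb 2 (Fintype.card μ) + c := by
  simp only [bobWith, cbits]
  gcongr
  exact Real.iSup_le (fun m => h _) hc

end MessageTypes

/-! ### Branchwise verification of protocols by tracking amplitudes. -/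

section Realizes

variable {A B X Y : Type*} [Fintype A] [DecidableEq A] [Fintype B] [DecidableEq B]
  [Fintype X] [DecidableEq X] [Fintype Y] [DecidableEq Y] {μ : Type*} [Fintype μ]

/-- Started in the states `G ρ Gᴴ`, the protocol produces `U ρ Uᴴ` with weight `w`. -/
def Realizes (p : LOCCProtocol (A × X) (B × Y)) (G : Matrix ((A × X) × (B × Y)) (A × B) ℂ)
    (U : Matrix (A × B) (A × B) ℂ) (w : ℂ) : Prop :=
  ∀ ρ : Matrix (A × B) (A × B) ℂ, discardAncillas (p.run (G * ρ * Gᴴ)) = w • (U * ρ * Uᴴ)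

/-- With the ancillas in fixed basis states, discarding them loses no coherence and leaves `U ρ Uᴴ`
up to the squared modulus of the amplitude. -/
theorem realizes_done {G : Matrix ((A × X) × (B × Y)) (A × B) ℂ} {U : Matrix (A × B) (A × B) ℂ}
    {r : ℂ} (x₀ : X) (y₀ : Y)
    (h : ∀ a x b y i, G ((a, x), (b, y)) i = if x = x₀ ∧ y = y₀ then r * U (a, b) i else 0) :
    (done : LOCCProtocol (A × X) (B × Y)).Realizes G U (r * star r) := by
  intro ρ
  ext ⟨a, b⟩ ⟨a', b'⟩
  have hz : ∀ x y, (G * ρ * Gᴴ) ((a, x), (b, y)) ((a', x), (b', y))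
      = if x = x₀ then if y = y₀ then r * star r * (U * ρ * Uᴴ) (a, b) (a', b') else 0 else 0 := by
    intro x y
    simp only [Matrix.mul_apply, Matrix.conjTranspose_apply, h]
    by_cases hx : x = x₀ <;> by_cases hy : y = y₀ <;>
      simp only [hx, hy, and_self, and_true, and_false, true_and, false_and, if_true, if_false,
        zero_mul, Finset.sum_const_zero, Finset.mul_sum, star_mul]
    refine Finset.sum_congr rfl fun i _ => ?_
    simp only [Finset.sum_mul, Finset.mul_sum]
    exact Finset.sum_congr rfl fun j _ => by ring
  simp only [discardAncillas, run, hz, Matrix.smul_apply, smul_eq_mul]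
  simp

theorem conj_mul_assoc {ι κ : Type*} [Fintype ι] [Fintype κ] (K : Matrix ι ι ℂ)
    (G : Matrix ι κ ℂ) (ρ : Matrix κ κ ℂ) : K * (G * ρ * Gᴴ) * Kᴴ = (K * G) * ρ * (K * G)ᴴ := by
  simp only [Matrix.conjTranspose_mul, Matrix.mul_assoc]

theorem realizes_aliceWith {K : μ → Matrix (A × X) (A × X) ℂ} {hK : ∑ m, (K m)ᴴ * K m = 1}
    {next : μ → LOCCProtocol (A × X) (B × Y)} {G : Matrix ((A × X) × (B × Y)) (A × B) ℂ}
    {U : Matrix (A × B) (A × B) ℂ} {w : μ → ℂ} (G' : μ → Matrix ((A × X) × (B × Y)) (A × B) ℂ)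
    (hG : ∀ m x y i, ∑ x', K m x x' * G (x', y) i = G' m (x, y) i)
    (h : ∀ m, (next m).Realizes (G' m) U (w m)) :
    (aliceWith K hK next).Realizes G U (∑ m, w m) := by
  intro ρ
  rw [run_aliceWith, discardAncillas_sum, Finset.sum_smul]
  refine Finset.sum_congr rfl fun m _ => ?_
  rw [conj_mul_assoc, ← h m ρ]
  have : (K m ⊗ₖ (1 : Matrix (B × Y) (B × Y) ℂ)) * G = G' m := by
    ext ⟨x, y⟩ i
    rw [kronecker_one_mul_apply, hG]
  rw [this]

theorem realizes_bobWith {K : μ → Matrix (B × Y) (B × Y) ℂ} {hK : ∑ m, (K m)ᴴ * K m = 1}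
    {next : μ → LOCCProtocol (A × X) (B × Y)} {G : Matrix ((A × X) × (B × Y)) (A × B) ℂ}
    {U : Matrix (A × B) (A × B) ℂ} {w : μ → ℂ} (G' : μ → Matrix ((A × X) × (B × Y)) (A × B) ℂ)
    (hG : ∀ m x y i, ∑ y', K m y y' * G (x, y') i = G' m (x, y) i)
    (h : ∀ m, (next m).Realizes (G' m) U (w m)) :
    (bobWith K hK next).Realizes G U (∑ m, w m) := by
  intro ρ
  rw [run_bobWith, discardAncillas_sum, Finset.sum_smul]
  refine Finset.sum_congr rfl fun m _ => ?_
  rw [conj_mul_assoc, ← h m ρ]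
  have : ((1 : Matrix (A × X) (A × X) ℂ) ⊗ₖ K m) * G = G' m := by
    ext ⟨x, y⟩ i
    rw [one_kronecker_mul_apply, hG]
  rw [this]

/-- The isometry (up to normalization) adding a maximally entangled state to the data. -/
def unnormalizedStart (ν : Type*) [DecidableEq ν] : Matrix ((A × ν) × (B × ν)) (A × B) ℂ :=
  fun x i => if x.1.2 = x.2.2 ∧ x.1.1 = i.1 ∧ x.2.1 = i.2 then 1 else 0

/-- Dropping the factor `1 / √(card ν)` avoids square roots, and so the weights of all branches must
add up to `card ν` instead of `1`. -/
theorem Realizes.hasProtocol {ν : Type*} [Fintype ν] [DecidableEq ν] [Nonempty ν]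
    {p : LOCCProtocol (A × ν) (B × ν)} {U : Matrix (A × B) (A × B) ℂ} {c : ℝ}
    (hp : p.Realizes (unnormalizedStart ν) U
      (Fintype.card ν)) (hc : p.cbits ≤ c) : HasProtocol ν U c := by
  refine ⟨p, hc, fun ρ => ?_⟩
  set G : Matrix ((A × ν) × (B × ν)) (A × B) ℂ := unnormalizedStart ν with hG
  have h1 : entangledInput ν ρ = (Fintype.card ν : ℂ)⁻¹ • (G * ρ * Gᴴ) := by
    ext ⟨⟨a, n⟩, b, m⟩ ⟨⟨a', n'⟩, b', m'⟩
    simp only [entangledInput, Matrix.smul_apply, Matrix.mul_apply, Matrix.conjTranspose_apply,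
      smul_eq_mul, Fintype.sum_prod_type, hG, unnormalizedStart]
    by_cases h : n = m <;> by_cases h' : n' = m' <;> simp [h, h', ite_and, apply_ite]
  rw [h1, run_smul, discardAncillas_smul, hp ρ, smul_smul, inv_mul_cancel₀, one_smul]
  exact_mod_cast Fintype.card_ne_zero

end Realizes

end LOCCProtocol

/-! ### Controlled unitaries cost `log N` ebits and `2 log N` c-bits. -/

section ControlledUnitary

variable {A B : Type*} [Fintype A] [DecidableEq A] [Fintype B] [DecidableEq B]

open LOCCProtocol

theorem sum_star_mul_of_mem_unitaryGroup {V : Matrix B B ℂ} (hV : V ∈ Matrix.unitaryGroup B ℂ)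
    (b b' : B) : ∑ c, star (V c b) * V c b' = if b = b' then 1 else 0 := by
  have := congrFun (congrFun (Matrix.mem_unitaryGroup_iff'.mp hV) b) b'
  simpa [Matrix.mul_apply, Matrix.one_apply] using this

/-- Alice shares a coherent copy of her control value `t a` with Bob through the entangled pair; he
applies `V` and erases the copy by a Fourier measurement. The resulting phase depends only on her
control value and the messages, so she can remove it. -/
theorem hasProtocol_controlled (N : ℕ) [NeZero N] (t : A → ZMod N) (V : ZMod N → Matrix B B ℂ)
    (hV : ∀ n, V n ∈ Matrix.unitaryGroup B ℂ) {U : Matrix (A × B) (A × B) ℂ}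
    (hU : ∀ a b a' b', U (a, b) (a', b') = if a = a' then V (t a) b b' else 0) :
    HasProtocol (ZMod N) U (2 * Real.logb 2 N) := by
  set ψ : AddChar (ZMod N) ℂ := ZMod.stdAddChar with hψ
  obtain ⟨r, hr, hrr⟩ : ∃ r : ℂ, star r = r ∧ r * r = (N : ℂ)⁻¹ := by
    refine ⟨((Real.sqrt N)⁻¹ : ℝ), by simp, ?_⟩
    rw [← Complex.ofReal_mul, ← mul_inv, Real.mul_self_sqrt (Nat.cast_nonneg _)]
    simp
  have hstar : ∀ x, star (ψ x) = ψ (-x) := fun x => (AddChar.map_neg_eq_conj ψ x).symm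
  have hψ1 : ∀ x, ψ (-x) * ψ x = 1 := fun x => by rw [← AddChar.map_add_eq_mul]; simp
  have hN : (N : ℂ) ≠ 0 := NeZero.ne _
  -- Outcome `m` is the difference between Alice's half of the pair and `t a`, so Bob's half becomes
  -- `t a + m`.
  let K₁ : ZMod N → Matrix (A × ZMod N) (A × ZMod N) ℂ := fun m x y =>
    if x.1 = y.1 ∧ x.2 = 0 ∧ y.2 = t x.1 + m then 1 else 0
  -- Bob recovers `t a` as `y.2 - m`, applies the matching unitary and measures his half in the
  -- Fourier basis.
  let K₂ : ZMod N → ZMod N → Matrix (B × ZMod N) (B × ZMod N) ℂ := fun m m' x y =>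
    if x.2 = 0 then r * ψ (m' * y.2) * V (y.2 - m) x.1 y.1 else 0
  -- The phase correction has a single outcome, hence the message type `Unit`, which costs no bits.
  let K₃ : ZMod N → ZMod N → Unit → Matrix (A × ZMod N) (A × ZMod N) ℂ := fun m m' _ x y =>
    if x.1 = y.1 ∧ x.2 = y.2 then ψ (-(m' * (t x.1 + m))) else 0
  have hK₁ : ∑ m, (K₁ m)ᴴ * K₁ m = 1 := by
    rw [sum_conjTranspose_mul_eq_one_iff]
    rintro ⟨a, n⟩ ⟨a', n'⟩
    simp only [K₁, Fintype.sum_prod_type, Prod.mk.injEq, ite_and, apply_ite star, star_one,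
      star_zero, ite_mul, one_mul, zero_mul]
    by_cases ha : a = a'
    · subst ha
      by_cases hn : n = n'
      · subst hn
        simp [← sub_eq_iff_eq_add', eq_comm]
      · simp [hn]
        refine Finset.sum_eq_zero fun x _ => ?_
        split_ifs with h1 h2
        · exact absurd (h1.trans h2.symm) hn
        all_goals rfl
    · simp [ha]
  have hK₂ : ∀ m, ∑ m', (K₂ m m')ᴴ * K₂ m m' = 1 := by
    intro m
    rw [sum_conjTranspose_mul_eq_one_iff]
    rintro ⟨b, n⟩ ⟨b', n'⟩
    simp only [K₂, Fintype.sum_prod_type, Prod.mk.injEq, apply_ite star,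
      star_zero, ite_mul, mul_ite, mul_zero, zero_mul, Finset.sum_ite_eq', Finset.mem_univ, if_true,
      star_mul, hstar, hr]
    have h1 : ∀ m' c, star (V (n - m) c b) * (ψ (-(m' * n)) * r) *
        (r * ψ (m' * n') * V (n' - m) c b')
        = (r * r) * ψ (m' * (n' - n)) * (star (V (n - m) c b) * V (n' - m) c b') := by
      intro m' c
      rw [mul_sub, sub_eq_neg_add (m' * n'), AddChar.map_add_eq_mul]; ring
    have h2 := AddChar.sum_mulShift (n' - n) (ZMod.isPrimitive_stdAddChar N)
    rw [← hψ] at h2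
    rw [Finset.sum_congr rfl fun m' _ => Finset.sum_congr rfl fun c _ => h1 m' c]
    simp only [← Finset.mul_sum, ← Finset.sum_mul, h2, hrr]
    by_cases hn : n = n'
    · subst hn
      rw [sum_star_mul_of_mem_unitaryGroup (hV _)]
      simp [hN]
    · simp [hn, sub_eq_zero, eq_comm]
  have hK₃ : ∀ m m', ∑ u, (K₃ m m' u)ᴴ * K₃ m m' u = 1 := by
    intro m m'
    rw [sum_conjTranspose_mul_eq_one_iff]
    rintro ⟨a, n⟩ ⟨a', n'⟩
    simp only [K₃, Fintype.sum_prod_type, Prod.mk.injEq, ite_and, apply_ite star,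
      star_zero, ite_mul, zero_mul, hstar, neg_neg]
    by_cases ha : a = a'
    · subst ha
      by_cases hn : n = n'
      · subst hn
        simp [mul_comm]
        rw [mul_comm, hψ1]
      · simp [hn]
    · simp [ha]
  have hlog : 0 ≤ Real.logb 2 N :=
    Real.logb_nonneg (by norm_num) (by exact_mod_cast NeZero.one_le)
  refine Realizes.hasProtocol (p := aliceWith K₁ hK₁ fun m => bobWith (K₂ m) (hK₂ m) fun m' =>
    aliceWith (K₃ m m') (hK₃ m m') fun _ => done) ?_ ?_
  -- There are `N * N` branches of weight `1 / N` each.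
  · have hw : (Fintype.card (ZMod N) : ℂ) = ∑ _m : ZMod N, ∑ _m' : ZMod N, ∑ _u : Unit,
        r * star r := by
      simp [hr, hrr, ZMod.card, hN]
    rw [hw]
    refine realizes_aliceWith (fun m x i => if x.1.1 = i.1 ∧ x.2.1 = i.2 ∧ x.1.2 = 0 ∧
      x.2.2 = t x.1.1 + m then 1 else 0) ?_ fun m => realizes_bobWith (fun m' x i =>
      if x.1.1 = i.1 ∧ x.1.2 = 0 ∧ x.2.2 = 0 then
        r * ψ (m' * (t x.1.1 + m)) * V (t x.1.1) x.2.1 i.2 else 0) ?_ fun m' =>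
      realizes_aliceWith (fun _ x i => if x.1.1 = i.1 ∧ x.1.2 = 0 ∧ x.2.2 = 0 then
        r * V (t x.1.1) x.2.1 i.2 else 0) ?_ fun _ => realizes_done 0 0 ?_
    · rintro m ⟨a, n⟩ ⟨b, n'⟩ ⟨a', b'⟩
      simp only [K₁, unnormalizedStart, Fintype.sum_prod_type, ite_and]
      by_cases ha : a = a' <;> by_cases hb : b = b' <;> by_cases hn : n = 0 <;>
        simp [ha, hb, hn, eq_comm]
    · rintro m' ⟨a, n⟩ ⟨b, n'⟩ ⟨a', b'⟩
      simp only [K₂, Fintype.sum_prod_type, ite_and]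
      by_cases ha : a = a' <;> by_cases hn : n = 0 <;> by_cases hn' : n' = 0 <;>
        simp [ha, hn, hn']
    · rintro ⟨⟩ ⟨a, n⟩ ⟨b, n'⟩ ⟨a', b'⟩
      simp only [K₃, Fintype.sum_prod_type, ite_and]
      have h1 : ψ (-(m' * (t a' + m))) * (r * ψ (m' * (t a' + m)) * V (t a') b b')
          = r * V (t a') b b' := by
        linear_combination (r * V (t a') b b') * hψ1 (m' * (t a' + m))
      by_cases ha : a = a' <;> by_cases hn : n = 0 <;> by_cases hn' : n' = 0 <;>
        simp [ha, hn, hn', h1]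
    · rintro a n b n' ⟨a', b'⟩
      rw [hU]
      by_cases ha : a = a' <;> by_cases hn : n = 0 <;> by_cases hn' : n' = 0 <;>
        simp [ha, hn, hn']
  · refine (cbits_aliceWith_le (c := Real.logb 2 N) _ _ _ hlog fun m => ?_).trans
      (by rw [ZMod.card]; linarith)
    refine (cbits_bobWith_le (c := 0) _ _ _ le_rfl fun m' => ?_).trans (by rw [ZMod.card]; simp)
    exact (cbits_aliceWith_le (c := 0) _ _ _ le_rfl fun _ => le_rfl).trans (by simp)

/-- A unitary controlled from the second party followed by one controlled from the first. -/
theorem hasProtocol_controlled_mul_controlled (N M : ℕ) [NeZero N] [NeZero M] (t : A → ZMod N)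
    (e : B → ZMod M) (V : ZMod N → Matrix B B ℂ) (W : ZMod M → Matrix A A ℂ)
    (hV : ∀ n, V n ∈ Matrix.unitaryGroup B ℂ) (hW : ∀ n, W n ∈ Matrix.unitaryGroup A ℂ)
    {U : Matrix (A × B) (A × B) ℂ}
    (hU : ∀ a b a' b', U (a, b) (a', b') = V (t a) b b' * W (e b') a a') :
    HasProtocol (ZMod N × ZMod M) U (2 * Real.logb 2 N + 2 * Real.logb 2 M) := by
  -- In `hU` the bit of `B` is read from the input `b'` and that of `A` from the output `a`: the
  -- control from the second party acts first.
  have h1 := hasProtocol_controlled N t V hV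
    (U := Matrix.of fun x y => if x.1 = y.1 then V (t x.1) x.2 y.2 else 0) (fun _ _ _ _ => rfl)
  have h2 := (hasProtocol_controlled M e W hW
    (U := Matrix.of fun x y => if x.1 = y.1 then W (e x.1) x.2 y.2 else 0) (fun _ _ _ _ => rfl)).swapParties
  have := h1.mul h2
  convert this using 1
  ext ⟨a, b⟩ ⟨a', b'⟩
  rw [hU, Matrix.mul_apply, Fintype.sum_prod_type]
  simp [swapParties]

end ControlledUnitary

/-! ### A two-ebit protocol in which the direction of the second control is itself controlled. -/

section AdaptiveDiagonal

variable {A B : Type*} [Fintype A] [DecidableEq A] [Fintype B] [DecidableEq B]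

open LOCCProtocol

/-- The character table of the group with two elements. -/
def signChar (x y : Bool) : ℂ := if x && y then -1 else 1

theorem signChar_mul_self (x y : Bool) : signChar x y * signChar x y = 1 := by
  cases x <;> cases y <;> simp [signChar]

theorem star_signChar (x y : Bool) : star (signChar x y) = signChar x y := by
  cases x <;> cases y <;> simp [signChar]

/-- An operator on an ancilla, controlled by the data. -/
def controlledOn {C ν : Type*} [DecidableEq C] (k : C → Matrix ν ν ℂ) :
    Matrix (C × ν) (C × ν) ℂ :=
  fun x y => if x.1 = y.1 then k x.1 x.2 y.2 else 0

theorem sum_conjTranspose_mul_controlledOn {C ν μ : Type*} [Fintype C] [DecidableEq C] [Fintype ν]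
    [DecidableEq ν] [Fintype μ] {k : μ → C → Matrix ν ν ℂ}
    (hk : ∀ c x y, ∑ m, ∑ z, star (k m c z x) * k m c z y = if x = y then 1 else 0) :
    ∑ m, (controlledOn (k m))ᴴ * controlledOn (k m) = 1 := by
  rw [sum_conjTranspose_mul_eq_one_iff]
  rintro ⟨c, x⟩ ⟨c', y⟩
  simp only [controlledOn, Fintype.sum_prod_type]
  by_cases hc : c = c'
  · subst hc
    have : ∀ m, ∑ c', ∑ z, star (if c' = c then k m c' z x else 0) *
        (if c' = c then k m c' z y else 0) = ∑ z, star (k m c z x) * k m c z y := fun m => by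
      rw [Finset.sum_eq_single c (fun c' _ h => by simp [h]) (by simp)]
      simp
    simp only [this, hk, Prod.mk.injEq, true_and]
  · refine (Finset.sum_eq_zero fun m _ => Finset.sum_eq_zero fun c'' _ =>
      Finset.sum_eq_zero fun z _ => ?_).trans (by simp [hc])
    by_cases h : c'' = c
    · simp [h, hc]
    · simp [h]

/-- The state in which the data are untouched and the ancillas have the amplitudes `Ψ`. -/
def ancillaState {ν : Type*} (Ψ : A → B → ν → ν → ℂ) : Matrix ((A × ν) × (B × ν)) (A × B) ℂ :=
  fun x i => if x.1.1 = i.1 ∧ x.2.1 = i.2 then Ψ i.1 i.2 x.1.2 x.2.2 else 0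

variable {ν μ : Type*} [Fintype ν] [DecidableEq ν] [Fintype μ]

theorem realizes_alice_controlledOn {k : μ → A → Matrix ν ν ℂ} (hk) {next : μ →
    LOCCProtocol (A × ν) (B × ν)} {Ψ : A → B → ν → ν → ℂ} {U : Matrix (A × B) (A × B) ℂ}
    {w : μ → ℂ} (Ψ' : μ → A → B → ν → ν → ℂ)
    (hΨ : ∀ m a b x y, ∑ x', k m a x x' * Ψ a b x' y = Ψ' m a b x y)
    (h : ∀ m, (next m).Realizes (ancillaState (Ψ' m)) U (w m)) :
    (aliceWith (fun m => controlledOn (k m)) hk next).Realizes (ancillaState Ψ) U (∑ m, w m) := by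
  refine realizes_aliceWith _ ?_ h
  rintro m ⟨a, x⟩ ⟨b, y⟩ ⟨a', b'⟩
  simp only [controlledOn, ancillaState, Fintype.sum_prod_type, ite_and]
  by_cases ha : a = a' <;> by_cases hb : b = b' <;> simp [ha, hb, hΨ]

theorem realizes_bob_controlledOn {k : μ → B → Matrix ν ν ℂ} (hk) {next : μ →
    LOCCProtocol (A × ν) (B × ν)} {Ψ : A → B → ν → ν → ℂ} {U : Matrix (A × B) (A × B) ℂ}
    {w : μ → ℂ} (Ψ' : μ → A → B → ν → ν → ℂ)
    (hΨ : ∀ m a b x y, ∑ y', k m b y y' * Ψ a b x y' = Ψ' m a b x y)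
    (h : ∀ m, (next m).Realizes (ancillaState (Ψ' m)) U (w m)) :
    (bobWith (fun m => controlledOn (k m)) hk next).Realizes (ancillaState Ψ) U (∑ m, w m) := by
  refine realizes_bobWith _ ?_ h
  rintro m ⟨a, x⟩ ⟨b, y⟩ ⟨a', b'⟩
  simp only [controlledOn, ancillaState, Fintype.sum_prod_type, ite_and]
  by_cases ha : a = a' <;> by_cases hb : b = b' <;> simp [ha, hb, hΨ]

/-- A diagonal unitary such that, after Bob's basis states are split into two classes, the part
belonging to each class is controlled by one bit of one of the parties (`μ` tells which one). -/
theorem hasProtocol_adaptive_diagonal (e : B → Bool) (μ : Bool → Bool) (φ : Bool → A → ℂ)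
    (s : Bool → A → Bool) (ψ : Bool → B → ℂ) (χ : Bool → Bool → A → ℂ) (v : B → Bool)
    (hφ : ∀ i a, star (φ i a) * φ i a = 1) (hψ : ∀ i b, star (ψ i b) * ψ i b = 1)
    (hχ : ∀ i j a, star (χ i j a) * χ i j a = 1) {U : Matrix (A × B) (A × B) ℂ}
    (hU : ∀ a b a' b', U (a, b) (a', b') = if a = a' ∧ b = b' then
      (if μ (e b) then φ (e b) a * ψ (s (e b) a) b else χ (e b) (v b) a) else 0) :
    ∃ c, HasProtocol (Bool × Bool) U c := by
  obtain ⟨r, hr, hrr⟩ : ∃ r : ℂ, star r = r ∧ r * r = 2⁻¹ := by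
    refine ⟨((Real.sqrt 2)⁻¹ : ℝ), by simp, ?_⟩
    rw [← Complex.ofReal_mul, ← mul_inv, Real.mul_self_sqrt (by norm_num)]
    simp
  have hr' : (starRingEnd ℂ) r = r := hr
  have star_signChar' : ∀ x y, (starRingEnd ℂ) (signChar x y) = signChar x y := star_signChar
  have hxx : ∀ x y, xor (xor x y) y = x := by decide
  have hem : ∀ x y : Bool, (¬x = y ∨ x = y) = True := by decide
  -- The first pair carries the class `e b` to Alice. If `μ` assigns the control to Bob, the second
  -- pair carries `v b` as well; otherwise Bob sends a uniformly random bit `m.2` in its place. The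
  -- messages must have the same distribution in both cases, or the superposition of classes would
  -- collapse.
  let k₁ : Bool × Bool → B → Matrix (Bool × Bool) (Bool × Bool) ℂ := fun m b o i =>
    if o.1 = false ∧ i.1 = xor (e b) m.1 then
      (if μ (e b) then (if o.2 = i.2 then r else 0)
        else if o.2 = false ∧ i.2 = xor (v b) m.2 then 1 else 0) else 0
  -- Alice reads the class as `i.1 xor m.1`. When the control is hers, she copies `s` into the
  -- second pair and applies `φ`; otherwise she applies `χ` and erases the copy of `v b` by a
  -- Hadamard measurement.
  let k₂ : Bool × Bool → Bool → A → Matrix (Bool × Bool) (Bool × Bool) ℂ := fun m m' a o i =>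
    if o.1 = i.1 ∧ o.2 = false then
      (if μ (xor i.1 m.1) then
        (if i.2 = xor (s (xor i.1 m.1) a) m' then φ (xor i.1 m.1) a else 0)
        else r * signChar m' i.2 * χ (xor i.1 m.1) (xor i.2 m.2) a) else 0
  -- Bob either applies `ψ` and erases the copy of `s`, or corrects the sign left by `m'` and sends
  -- a random bit.
  let k₃ : Bool × Bool → Bool → Bool → B → Matrix (Bool × Bool) (Bool × Bool) ℂ :=
    fun m m' m'' b o i => if o.1 = i.1 then
      (if μ (e b) then (if o.2 = false then r * signChar m'' i.2 * ψ (xor i.2 m') b else 0)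
        else if o.2 = i.2 then r * signChar m' (xor (v b) m.2) else 0) else 0
  -- Alice corrects the sign left by `m''` where needed and erases the copy of the class; Bob then
  -- removes the last sign with `k₅`.
  let k₄ : Bool × Bool → Bool → Bool → Bool → A → Matrix (Bool × Bool) (Bool × Bool) ℂ :=
    fun m m' m'' m₄ a o i => if o.1 = false ∧ o.2 = i.2 then
      r * signChar m₄ i.1 * (if μ (xor i.1 m.1) then
        signChar m'' (xor (s (xor i.1 m.1) a) m') else 1) else 0
  let k₅ : Bool × Bool → Bool → Unit → B → Matrix (Bool × Bool) (Bool × Bool) ℂ :=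
    fun m m₄ _ b o i => if o = i then signChar m₄ (xor (e b) m.1) else 0
  have hk₁ := sum_conjTranspose_mul_controlledOn (k := k₁) (by
    rintro b ⟨x, y⟩ ⟨x', y'⟩
    simp only [k₁, Fintype.sum_prod_type, Fintype.sum_bool]
    generalize μ (e b) = M
    generalize e b = E
    generalize v b = V
    cases M <;> cases E <;> cases V <;> cases x <;> cases x' <;> cases y <;> cases y' <;>
      simp [hr', hrr] <;> norm_num)
  have hk₂ := fun m => sum_conjTranspose_mul_controlledOn (k := k₂ m) (by
    rintro a ⟨x, y⟩ ⟨x', y'⟩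
    simp only [k₂, Fintype.sum_prod_type, Fintype.sum_bool]
    have hφ' : ∀ i a, (starRingEnd ℂ) (φ i a) * φ i a = 1 := hφ
    have hχ' : ∀ i j a, (starRingEnd ℂ) (χ i j a) * χ i j a = 1 := hχ
    have hd : ∀ z : ℂ, (starRingEnd ℂ) z * z = 1 →
        r * (starRingEnd ℂ) z * (r * z) + r * (starRingEnd ℂ) z * (r * z) = 1 := fun z hz => by
      linear_combination (2 * (starRingEnd ℂ) z * z) * hrr + hz
    have hx : ∀ i, i = xor x m.1 → i = xor x m.1 := fun _ h => h
    by_cases hxx' : x = x'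
    · subst hxx'
      have hgen : ∀ i, (∑ m', ∑ z : Bool, star (if z = false then
          (if μ i then (if y = xor (s i a) m' then φ i a else 0)
          else r * signChar m' y * χ i (xor y m.2) a) else 0) * (if z = false then
          (if μ i then (if y' = xor (s i a) m' then φ i a else 0)
          else r * signChar m' y' * χ i (xor y' m.2) a) else 0)) = if y = y' then 1 else 0 := by
        intro i
        simp only [Fintype.sum_bool]
        cases μ i <;> cases y <;> cases y' <;> cases s i a <;> cases m.2 <;>
          simp [signChar, hr', hφ', hd _ (hχ' _ _ _)]
      simp only [Fintype.sum_bool] at hgen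
      cases x
      · simpa using hgen (xor false m.1)
      · simpa using hgen (xor true m.1)
    · cases x <;> cases x' <;> simp at hxx' ⊢)
  have hk₃ := fun m m' => sum_conjTranspose_mul_controlledOn (k := k₃ m m') (by
    rintro b ⟨x, y⟩ ⟨x', y'⟩
    simp only [k₃, Fintype.sum_prod_type, Fintype.sum_bool]
    have hψ' : ∀ i a, (starRingEnd ℂ) (ψ i a) * ψ i a = 1 := hψ
    have hd : ∀ z : ℂ, (starRingEnd ℂ) z * z = 1 →
        r * (starRingEnd ℂ) z * (r * z) + r * (starRingEnd ℂ) z * (r * z) = 1 := fun z hz => by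
      linear_combination (2 * (starRingEnd ℂ) z * z) * hrr + hz
    cases hM : μ (e b) <;> cases x <;> cases x' <;> cases y <;> cases y' <;> cases m' <;>
      cases xor (v b) m.2 <;> simp [signChar, hr', hd _ (hψ' _ _), hrr] <;> norm_num)
  have hk₄ := fun m m' m'' => sum_conjTranspose_mul_controlledOn (k := k₄ m m' m'') (by
    rintro b ⟨x, y⟩ ⟨x', y'⟩
    simp only [k₄, Fintype.sum_prod_type, Fintype.sum_bool]
    obtain ⟨g, hg, hgs⟩ : ∃ g : Bool → ℂ, (∀ i, g i = 1 ∨ g i = -1) ∧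
        ∀ i, (if μ i then signChar m'' (xor (s i b) m') else 1) = g i := by
      refine ⟨_, fun i => ?_, fun i => rfl⟩
      cases μ i <;> cases m'' <;> cases xor (s i b) m' <;> simp [signChar]
    simp only [hgs]
    rcases hg false with h₁ | h₁ <;> rcases hg true with h₂ | h₂ <;> cases m.1 <;> cases x <;>
      cases x' <;> cases y <;> cases y' <;>
      simp [signChar, hr', hrr, h₁, h₂] <;> norm_num)
  have hk₅ := fun m m₄ => sum_conjTranspose_mul_controlledOn (k := k₅ m m₄) (by
    rintro b x y
    by_cases h : x = y
    · simp [k₅, h, star_signChar', signChar_mul_self]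
    · simp [k₅, h, Ne.symm h, apply_ite])
  refine ⟨_, Realizes.hasProtocol (p := bobWith _ hk₁ fun m => aliceWith _ (hk₂ m) fun m' =>
    bobWith _ (hk₃ m m') fun m'' => aliceWith _ (hk₄ m m' m'') fun m₄ =>
    bobWith _ (hk₅ m m₄) fun _ => done) ?_ le_rfl⟩
  -- There are `32` branches of weight `(r ^ 3) ^ 2 = 1 / 8`, with total `4`.
  have hw : (Fintype.card (Bool × Bool) : ℂ) = ∑ _m : Bool × Bool, ∑ _m' : Bool, ∑ _m'' : Bool,
      ∑ _m₄ : Bool, ∑ _u : Unit, (r * r * r) * star (r * r * r) := by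
    simp only [star_mul, hr, Finset.sum_const, Finset.card_univ, Fintype.card_prod,
      Fintype.card_bool, Fintype.card_unit, nsmul_eq_mul]
    have : r * r * r * (r * (r * r)) = (r * r) * (r * r) * (r * r) := by ring
    rw [this, hrr]; norm_num
  have hstart : (unnormalizedStart (Bool × Bool) :
      Matrix ((A × Bool × Bool) × (B × Bool × Bool)) (A × B) ℂ)
      = ancillaState fun _ _ x y => if x = y then 1 else 0 := by
    ext x i
    simp only [unnormalizedStart, ancillaState]
    split_ifs <;> first | rfl | (exfalso; tauto)
  rw [hw, hstart]
  refine realizes_bob_controlledOn hk₁ (fun m a b x y =>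
      if y.1 = false ∧ x.1 = xor (e b) m.1 then
        (if μ (e b) then (if x.2 = y.2 then r else 0)
          else if y.2 = false ∧ x.2 = xor (v b) m.2 then 1 else 0) else 0) ?_ fun m =>
    realizes_alice_controlledOn (hk₂ m) (fun m' a b x y =>
      if y.1 = false ∧ x.1 = xor (e b) m.1 ∧ x.2 = false then
        (if μ (e b) then (if y.2 = xor (s (e b) a) m' then r * φ (e b) a else 0)
          else if y.2 = false then r * signChar m' (xor (v b) m.2) * χ (e b) (v b) a else 0)
      else 0) ?_ fun m' =>
    realizes_bob_controlledOn (hk₃ m m') (fun m'' a b x y =>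
      if y = (false, false) ∧ x.1 = xor (e b) m.1 ∧ x.2 = false then
        r * r * (if μ (e b) then φ (e b) a * ψ (s (e b) a) b * signChar m'' (xor (s (e b) a) m')
          else χ (e b) (v b) a)
      else 0) ?_ fun m'' =>
    realizes_alice_controlledOn (hk₄ m m' m'') (fun m₄ a b x y =>
      if y = (false, false) ∧ x = (false, false) then
        r * r * r * signChar m₄ (xor (e b) m.1) *
          (if μ (e b) then φ (e b) a * ψ (s (e b) a) b else χ (e b) (v b) a)
      else 0) ?_ fun m₄ =>
    realizes_bob_controlledOn (hk₅ m m₄) (fun _ a b x y =>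
      if y = (false, false) ∧ x = (false, false) then
        r * r * r * (if μ (e b) then φ (e b) a * ψ (s (e b) a) b else χ (e b) (v b) a)
      else 0) ?_ fun _ => realizes_done (false, false) (false, false) ?_
  · rintro ⟨m₁, m₂⟩ a b ⟨x₁, x₂⟩ ⟨y₁, y₂⟩
    simp only [k₁, Fintype.sum_prod_type, Prod.mk.injEq, ite_and]
    simp [eq_comm (a := y₂) (b := x₂)]
  · rintro m' a b ⟨x₁, x₂⟩ ⟨y₁, y₂⟩
    simp only [k₂, Fintype.sum_prod_type, Prod.mk.injEq, ite_and]
    by_cases hx : x₁ = xor (e b) m.1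
    · subst hx
      cases hμ : μ (e b) <;> by_cases hx₂ : x₂ = false <;> by_cases hy₁ : y₁ = false <;>
        by_cases hy₂ : y₂ = false <;> simp [hμ, hx₂, hy₁, hy₂, hxx, hem, mul_comm]
    · simp [hx]
  · rintro m'' a b ⟨x₁, x₂⟩ ⟨y₁, y₂⟩
    simp only [k₃, Fintype.sum_prod_type, Prod.mk.injEq, ite_and]
    by_cases hx : x₁ = xor (e b) m.1
    · subst hx
      cases hμ : μ (e b) <;> by_cases hx₂ : x₂ = false <;> by_cases hy₁ : y₁ = false <;>
        by_cases hy₂ : y₂ = false <;> simp [hμ, hx₂, hy₁, hy₂, hxx, hem]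
      · linear_combination
          (r * r * χ (e b) (v b) a) * signChar_mul_self m' (xor (v b) m.2)
      · ring
    · simp [hx]
  · rintro m₄ a b ⟨x₁, x₂⟩ ⟨y₁, y₂⟩
    simp only [k₄, Fintype.sum_prod_type, Prod.mk.injEq, ite_and]
    cases hμ : μ (e b) <;> cases x₁ <;> cases x₂ <;> cases y₁ <;> cases y₂ <;>
      simp [hμ, hxx, hem]
    · ring
    · linear_combination (r * r * r * signChar m₄ (xor (e b) m.1) * φ (e b) a *
        ψ (s (e b) a) b) * signChar_mul_self m'' (xor (s (e b) a) m')
  · rintro ⟨⟩ a b ⟨x₁, x₂⟩ ⟨y₁, y₂⟩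
    simp only [k₅, Fintype.sum_prod_type, Prod.mk.injEq, ite_and]
    cases x₁ <;> cases x₂ <;> cases y₁ <;> cases y₂ <;> simp
    cases μ (e b) <;> simp
    · linear_combination (r * r * r * χ (e b) (v b) a) * signChar_mul_self m₄ (xor (e b) m.1)
    · linear_combination (r * r * r * φ (e b) a * ψ (s (e b) a) b) *
        signChar_mul_self m₄ (xor (e b) m.1)
  · rintro a x b y ⟨a', b'⟩
    rw [hU]
    simp only [ancillaState]
    by_cases ha : a = a' <;> by_cases hb : b = b' <;> simp [ha, hb, and_comm]

end AdaptiveDiagonal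

/-! ### Complex permutation unitaries as permutations with phases. -/

section Monomial

variable {n : Type*} [Fintype n] [DecidableEq n]

/-- The matrix that maps the basis vector `y` to `u y` times the basis vector `π y`. -/
def monomialMatrix (π : Equiv.Perm n) (u : n → ℂ) : Matrix n n ℂ :=
  fun x y => if x = π y then u y else 0

theorem monomialMatrix_mem_unitaryGroup {π : Equiv.Perm n} {u : n → ℂ} (hu : ∀ y, ‖u y‖ = 1) :
    monomialMatrix π u ∈ Matrix.unitaryGroup n ℂ := by
  rw [Matrix.mem_unitaryGroup_iff']
  ext x y
  simp only [Matrix.mul_apply, Matrix.star_apply, monomialMatrix, Matrix.one_apply]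
  have h : star (u y) * u y = 1 := by
    rw [Complex.star_def, ← Complex.normSq_eq_conj_mul_self, Complex.normSq_eq_norm_sq, hu]
    simp
  simp only [mul_ite, mul_zero, Finset.sum_ite_eq', Finset.mem_univ, if_true,
    EmbeddingLike.apply_eq_iff_eq]
  by_cases hxy : x = y
  · subst hxy; simpa using h
  · simp [hxy, Ne.symm hxy]

theorem isPermUnitary_monomialMatrix_one (π : Equiv.Perm n) :
    IsPermUnitary (monomialMatrix π 1) := by
  refine ⟨monomialMatrix_mem_unitaryGroup (by simp), fun i j => ?_⟩
  simp only [monomialMatrix, Pi.one_apply]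
  split_ifs <;> simp

theorem sum_norm_sq_of_mem_unitaryGroup {U : Matrix n n ℂ} (hU : U ∈ Matrix.unitaryGroup n ℂ)
    (y : n) : ∑ x, ‖U x y‖ ^ 2 = 1 := by
  have h := congrFun (congrFun (Matrix.mem_unitaryGroup_iff'.mp hU) y) y
  simp only [Matrix.mul_apply, Matrix.star_apply, Matrix.one_apply_eq, Complex.star_def,
    ← Complex.normSq_eq_conj_mul_self, Complex.normSq_eq_norm_sq] at h
  exact_mod_cast h

theorem sum_norm_sq_of_mem_unitaryGroup' {U : Matrix n n ℂ} (hU : U ∈ Matrix.unitaryGroup n ℂ)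
    (x : n) : ∑ y, ‖U x y‖ ^ 2 = 1 := by
  have h := congrFun (congrFun (Matrix.mem_unitaryGroup_iff.mp hU) x) x
  simp only [Matrix.mul_apply, Matrix.star_apply, Matrix.one_apply_eq, Complex.star_def,
    Complex.mul_conj, Complex.normSq_eq_norm_sq] at h
  exact_mod_cast h

theorem IsComplexPermUnitary.exists_eq_monomialMatrix {U : Matrix n n ℂ}
    (hU : IsComplexPermUnitary U) :
    ∃ (π : Equiv.Perm n) (u : n → ℂ), (∀ y, ‖u y‖ = 1) ∧ U = monomialMatrix π u := by
  obtain ⟨hu, hrow, hcol⟩ := hU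
  choose f hf hf' using hcol
  have hinj : Function.Injective f := fun y y' h =>
    (hrow (f y)).unique (hf y) (by rw [h]; exact hf y')
  let π : Equiv.Perm n := Equiv.ofBijective f (Finite.injective_iff_bijective.mp hinj)
  have hz : ∀ x y, x ≠ f y → U x y = 0 := fun x y h => by
    by_contra h'
    exact h (hf' y x h')
  refine ⟨π, fun y => U (f y) y, fun y => ?_, ?_⟩
  · have h := sum_norm_sq_of_mem_unitaryGroup hu y
    rw [Finset.sum_eq_single (f y) (fun x _ h => by simp [hz x y h]) (by simp)] at h
    exact (pow_eq_one_iff_of_nonneg (norm_nonneg _) two_ne_zero).mp h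
  · ext x y
    simp only [monomialMatrix]
    split_ifs with h
    · rw [h]; rfl
    · exact hz x y h

theorem IsPermUnitary.isComplexPermUnitary {U : Matrix n n ℂ} (hU : IsPermUnitary U) :
    IsComplexPermUnitary U := by
  obtain ⟨hu, h01⟩ := hU
  have key : ∀ f : n → ℂ, (∀ x, f x = 0 ∨ f x = 1) → ∑ x, ‖f x‖ ^ 2 = 1 → ∃! x, f x ≠ 0 := by
    intro f hf hs
    have hex : ∃ x, f x ≠ 0 := by
      by_contra! h
      simp [h] at hs
    obtain ⟨x, hx⟩ := hex
    refine ⟨x, hx, fun x' hx' => ?_⟩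
    by_contra hne
    have h1 : ∀ z, f z ≠ 0 → ‖f z‖ ^ 2 = 1 := fun z hz => by simp [(hf z).resolve_left hz]
    have : ∑ z ∈ {x', x}, ‖f z‖ ^ 2 ≤ ∑ z, ‖f z‖ ^ 2 :=
      Finset.sum_le_sum_of_subset_of_nonneg (Finset.subset_univ _) fun _ _ _ => by positivity
    rw [Finset.sum_pair hne, h1 _ hx, h1 _ hx', hs] at this
    norm_num at this
  exact ⟨hu, fun i => key _ (h01 i) (sum_norm_sq_of_mem_unitaryGroup' hu i),
    fun j => key (fun i => U i j) (fun i => h01 i j) (sum_norm_sq_of_mem_unitaryGroup hu j)⟩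

theorem IsPermUnitary.exists_eq_monomialMatrix {U : Matrix n n ℂ} (hU : IsPermUnitary U) :
    ∃ π : Equiv.Perm n, U = monomialMatrix π 1 := by
  obtain ⟨π, u, hu, rfl⟩ := hU.isComplexPermUnitary.exists_eq_monomialMatrix
  refine ⟨π, ?_⟩
  congr 1
  ext y
  have h := hU.2 (π y) y
  simp only [monomialMatrix, if_true] at h
  refine h.resolve_left fun h0 => ?_
  have := hu y
  simp [h0] at this

end Monomial

/-! ### Dependence of blocks against disjointness of their supports. -/

section Dependence

/-- Any four elements of the set are linearly dependent. -/
def FourDependent {E : Type*} [AddCommGroup E] [Module ℂ E] (S : Set E) : Prop :=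
  ∀ x₁ ∈ S, ∀ x₂ ∈ S, ∀ x₃ ∈ S, ∀ x₄ ∈ S, ∃ a b c d : ℂ,
    ¬ (a = 0 ∧ b = 0 ∧ c = 0 ∧ d = 0) ∧ a • x₁ + b • x₂ + c • x₃ + d • x₄ = 0

theorem fourDependent_span {E : Type*} [AddCommGroup E] [Module ℂ E] (Q : Fin 3 → E) :
    FourDependent (Submodule.span ℂ (Set.range Q) : Set E) := by
  intro x₁ h₁ x₂ h₂ x₃ h₃ x₄ h₄
  have hd : ¬ LinearIndependent ℂ ![x₁, x₂, x₃, x₄] := by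
    intro hl
    have h := finrank_span_eq_card hl
    have hle : Submodule.span ℂ (Set.range ![x₁, x₂, x₃, x₄]) ≤
        Submodule.span ℂ (Set.range Q) := by
      rw [Submodule.span_le]
      rintro _ ⟨k, rfl⟩
      fin_cases k <;> assumption
    have := FiniteDimensional.span_of_finite ℂ (Set.finite_range Q)
    have h2 := Submodule.finrank_mono hle
    have h3 := finrank_range_le_card (R := ℂ) Q
    rw [Set.finrank] at h3
    rw [h] at h2
    simp at h2 h3
    omega
  rw [Fintype.not_linearIndependent_iff] at hd
  obtain ⟨g, hg, k, hk⟩ := hd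
  refine ⟨g 0, g 1, g 2, g 3, ?_, ?_⟩
  · rintro ⟨h0, h1, h2, h3⟩
    fin_cases k <;> simp_all
  · simpa [Fin.sum_univ_four] using hg

/-- A block of a monomial matrix, in terms of the column `(c i b, τ i b)` and the value `w i b` of
the nonzero entry in row `(i, b)`. -/
def rowBlock {ι κ β β' : Type*} [DecidableEq κ] [DecidableEq β'] (c : ι → β → κ) (τ : ι → β → β')
    (w : ι → β → ℂ) (i : ι) (j : κ) : Matrix β β' ℂ :=
  fun b b' => if c i b = j ∧ τ i b = b' then w i b else 0

variable {ι κ β β' : Type*} [DecidableEq κ] [DecidableEq β'] {c : ι → β → κ} {τ : ι → β → β'}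
  {w : ι → β → ℂ} {S : Set (Matrix β β' ℂ)}

/-- Three blocks of one row have disjoint nonempty supports, so they are independent and every other
block lies in their span. Its entries can then only sit where row `i` has entries. -/
theorem pattern_const_of_three_blocks (hw : ∀ i b, w i b ≠ 0) (hS : FourDependent S)
    (hblk : ∀ i j, rowBlock c τ w i j ∈ S) {i : ι} {b₁ b₂ b₃ : β} (h₁₂ : c i b₁ ≠ c i b₂)
    (h₁₃ : c i b₁ ≠ c i b₃) (h₂₃ : c i b₂ ≠ c i b₃) (i' : ι) (b : β) : τ i' b = τ i b := by
  obtain ⟨p, q, r, s, hne, h⟩ := hS _ (hblk i (c i b₁)) _ (hblk i (c i b₂)) _ (hblk i (c i b₃))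
    _ (hblk i' (c i' b))
  by_contra hτ
  have ev : ∀ x y, p * rowBlock c τ w i (c i b₁) x y + q * rowBlock c τ w i (c i b₂) x y +
      r * rowBlock c τ w i (c i b₃) x y + s * rowBlock c τ w i' (c i' b) x y = 0 := fun x y => by
    simpa using congrFun (congrFun h x) y
  have hs : s = 0 := by
    have := ev b (τ i' b)
    simpa [rowBlock, Ne.symm hτ, hw] using this
  subst hs
  have e₁ := ev b₁ (τ i b₁)
  have e₂ := ev b₂ (τ i b₂)
  have e₃ := ev b₃ (τ i b₃)
  simp [rowBlock, h₁₂, h₁₃, h₂₃, h₁₂.symm, h₁₃.symm, h₂₃.symm, hw] at e₁ e₂ e₃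
  exact hne ⟨e₁, e₂, e₃, rfl⟩

/-- When the splittings of two rows cross, the two blocks of each row first force equal patterns in
these rows. Three of the four blocks are then independent, so they span all the blocks and fix the
pattern everywhere. -/
theorem pattern_const_of_two_rows (hw : ∀ i b, w i b ≠ 0) (hS : FourDependent S)
    (hblk : ∀ i j, rowBlock c τ w i j ∈ S) {i i' : ι} {b b' b₂ : β}
    (hX : ∀ x, c i x = c i b ∨ c i x = c i b₂) (hX' : c i b ≠ c i b₂) (hbb : c i b' = c i b)
    (hY : ∀ x, c i' x = c i' b ∨ c i' x = c i' b') (hY' : c i' b ≠ c i' b')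
    (i'' : ι) (b₀ : β) : τ i'' b₀ = τ i b₀ := by
  have hτ : ∀ x, τ i' x = τ i x := by
    intro b₀
    by_contra hτ
    obtain ⟨p, q, r, s, hne, h⟩ := hS _ (hblk i (c i b)) _ (hblk i (c i b₂)) _
      (hblk i' (c i' b)) _ (hblk i' (c i' b'))
    have ev : ∀ x y, p * rowBlock c τ w i (c i b) x y + q * rowBlock c τ w i (c i b₂) x y +
        r * rowBlock c τ w i' (c i' b) x y + s * rowBlock c τ w i' (c i' b') x y = 0 :=
      fun x y => by simpa using congrFun (congrFun h x) y
    -- At each `x` one block of either row has an entry. If these entries coincide in position, the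
    -- two coefficients vanish together; otherwise both vanish. The rows `b`, `b'`, `b₂` connect all
    -- four coefficients, so a single mismatch kills them all.
    have hcoef : ∀ x, ((if c i x = c i b then p else q) = 0 ↔
        (if c i' x = c i' b then r else s) = 0) ∧ (τ i' x ≠ τ i x →
        (if c i x = c i b then p else q) = 0) := by
      intro x
      have e₁ := ev x (τ i x)
      have e₂ := ev x (τ i' x)
      by_cases hx : τ i' x = τ i x
      · rcases hX x with h1 | h1 <;> rcases hY x with h2 | h2 <;>
          simp [rowBlock, hx, h1, h2, hX', hX'.symm, hY', hY'.symm] at e₁ ⊢ <;>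
        · refine ⟨fun h0 => ?_, fun h0 => ?_⟩ <;> simpa [h0, hw] using e₁
      · rcases hX x with h1 | h1 <;> rcases hY x with h2 | h2 <;>
          simp [rowBlock, hx, Ne.symm hx, h1, h2, hX', hX'.symm, hY', hY'.symm, hw] at e₁ e₂ ⊢ <;>
          simp [e₁, e₂]
    have f₀ := (hcoef b₀).2 hτ
    have f₁ := (hcoef b).1
    have f₂ := (hcoef b').1
    have f₃ := (hcoef b₂).1
    simp only [hbb, if_true, if_neg hY'.symm, if_neg hX'.symm] at f₁ f₂ f₃
    apply hne
    split_ifs at f₀ f₃ <;> tauto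
  by_contra hne'
  obtain ⟨p, q, r, s, hne, h⟩ := hS _ (hblk i (c i b)) _ (hblk i (c i b₂)) _
    (hblk i' (c i' b)) _ (hblk i'' (c i'' b₀))
  have ev : ∀ x y, p * rowBlock c τ w i (c i b) x y + q * rowBlock c τ w i (c i b₂) x y +
      r * rowBlock c τ w i' (c i' b) x y + s * rowBlock c τ w i'' (c i'' b₀) x y = 0 :=
    fun x y => by simpa using congrFun (congrFun h x) y
  have hs : s = 0 := by
    have := ev b₀ (τ i'' b₀)
    simpa [rowBlock, hτ, Ne.symm hne', hw] using this
  subst hs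
  have e₁ := ev b' (τ i b')
  simp [rowBlock, hτ, hX', hbb, hY'.symm, hw] at e₁
  have e₂ := ev b (τ i b)
  simp [rowBlock, hτ, hX', e₁, hw] at e₂
  have e₃ := ev b₂ (τ i b₂)
  simp [rowBlock, hτ, hX'.symm, e₁, e₂, hw] at e₃
  exact hne ⟨e₁, e₃, e₂, rfl⟩

/-- With a nonconstant pattern, no row meets three blocks and no two splittings cross. Any one row
that splits therefore provides `R`. -/
theorem pattern_const_or_common_partition (hw : ∀ i b, w i b ≠ 0) (hS : FourDependent S)
    (hblk : ∀ i j, rowBlock c τ w i j ∈ S) : (∀ i i' b, τ i b = τ i' b) ∨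
    ∃ R : Set β, ∀ i, (∀ b b', c i b = c i b') ∨
      ∀ b b', c i b = c i b' ↔ (b ∈ R ↔ b' ∈ R) := by
  by_cases hτ : ∀ i i' b, τ i b = τ i' b
  · exact Or.inl hτ
  right
  have two : ∀ {i b₁ b₂}, c i b₁ ≠ c i b₂ → ∀ x, c i x = c i b₁ ∨ c i x = c i b₂ := by
    intro i b₁ b₂ h x
    by_contra! hx
    have := pattern_const_of_three_blocks hw hS hblk h hx.1.symm hx.2.symm
    exact hτ fun j j' b => (this j b).trans (this j' b).symm
  have noSplit : ∀ {i i' b b'}, (∃ x, c i b ≠ c i x) → c i b' = c i b → c i' b = c i' b' := by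
    rintro i i' b b' ⟨x, hx⟩ hbb
    by_contra h
    have := pattern_const_of_two_rows hw hS hblk (two hx) hx hbb (two h) h
    exact hτ fun j j' b => (this j b).trans (this j' b).symm
  by_cases hall : ∀ i, ∀ b b', c i b = c i b'
  · exact ⟨∅, fun i => Or.inl (hall i)⟩
  push Not at hall
  obtain ⟨i₀, b₁, b₂, h₀⟩ := hall
  have ne : ∀ i, (¬ ∀ b b', c i b = c i b') → ∀ b, ∃ x, c i b ≠ c i x := by
    intro i hi b
    by_contra! h
    exact hi fun x y => (h x).symm.trans (h y)
  refine ⟨{b | c i₀ b = c i₀ b₁}, fun i => ?_⟩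
  by_cases hi : ∀ b b', c i b = c i b'
  · exact Or.inl hi
  right
  intro b b'
  simp only [Set.mem_ofPred_eq]
  constructor
  · intro h
    rw [noSplit (i' := i₀) (ne i hi b) h.symm]
  · intro h
    refine noSplit (ne i₀ (fun h => h₀ (h _ _)) b) ?_
    rcases two h₀ b with h1 | h1 <;> rcases two h₀ b' with h2 | h2
    · rw [h1, h2]
    · exact (h.mp h1).trans h1.symm
    · exact h2.trans (h.mpr h2).symm
    · rw [h1, h2]

end Dependence

/-! ### The normal form: one bit of control from `B`, then control from `A`. -/

section NormalForm

variable {A B : Type*} [Fintype A] [DecidableEq A] [Fintype B] [DecidableEq B]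

/-- The restriction of a matrix to a class of columns. -/
def colPart (C : B → Bool) (ε : Bool) (M : Matrix B B ℂ) : Matrix B B ℂ :=
  fun b b' => if C b' = ε then M b b' else 0

/-- `U` is a unitary on the first party controlled from the second one by a single bit `C`,
followed by a monomial unitary on the second party controlled from the first one. -/
structure IsNormalForm (S : Submodule ℂ (Matrix B B ℂ)) (U : Matrix (A × B) (A × B) ℂ)
    (C : B → Bool) (σ : Bool → Equiv.Perm A) (y : A → Equiv.Perm B) (v : A → B → ℂ) : Prop where
  eq : ∀ i b j b', U (i, b) (j, b') =
    if i = σ (C b') j then monomialMatrix (y i) (v i) b b' else 0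
  mem : ∀ i, monomialMatrix (y i) (v i) ∈ S
  split : ∀ i, (σ true).symm i = (σ false).symm i ∨
    ∀ ε, colPart C ε (monomialMatrix (y i) (v i)) ∈ S
  surj : σ true = σ false ∨ Function.Surjective C

/-- The block of a bipartite operator in position `(i, j)`. -/
def block (U : Matrix (A × B) (A × B) ℂ) (i j : A) : Matrix B B ℂ := fun b b' => U (i, b) (j, b')

variable {π : Equiv.Perm (A × B)} {u : A × B → ℂ}

theorem block_monomialMatrix (i j : A) : block (monomialMatrix π u) i j =
    rowBlock (fun i b => (π.symm (i, b)).1) (fun i b => (π.symm (i, b)).2)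
      (fun i b => u (π.symm (i, b))) i j := by
  ext b b'
  simp only [block, monomialMatrix, rowBlock, ← Equiv.symm_apply_eq, Prod.ext_iff]
  split_ifs with h
  · congr 1
    exact Prod.ext h.1.symm h.2.symm
  · rfl

theorem block_monomialMatrix_transpose (i j : A) : (block (monomialMatrix π u) i j)ᵀ =
    rowBlock (fun j b => (π (j, b)).1) (fun j b => (π (j, b)).2)
      (fun j b => u (j, b)) j i := by
  ext b b'
  simp only [block, monomialMatrix, rowBlock, Matrix.transpose_apply, Prod.ext_iff,
    eq_comm (a := i), eq_comm (a := b')]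

/-- Counting step: in the rows that meet two blocks, the row classes correspond to the column
classes in the same way throughout. -/
theorem types_consistent {P P' : A → Prop} {R T : Set B} {S : Set (Matrix B B ℂ)} (hu : ∀ x, u x ≠ 0)
    (hS : FourDependent S) (hblk : ∀ i j, block (monomialMatrix π u) i j ∈ S)
    (hR : ∀ i, P i ∨
      ∀ b b', (π.symm (i, b)).1 = (π.symm (i, b')).1 ↔ (b ∈ R ↔ b' ∈ R))
    (hT : ∀ j, P' j ∨
      ∀ b b', (π (j, b)).1 = (π (j, b')).1 ↔ (b ∈ T ↔ b' ∈ T))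
    (hconst : ∀ i b, P i ↔ P' (π.symm (i, b)).1) :
    (∀ i b, ¬ P i →
      (b ∈ R ↔ (π.symm (i, b)).2 ∈ T)) ∨
    (∀ i b, ¬ P i →
      (b ∈ R ↔ (π.symm (i, b)).2 ∈ Tᶜ)) := by
  classical
  by_contra! hcon
  obtain ⟨⟨i₁, b₁, hi₁, h₁⟩, i₂, b₂, hi₂, h₂⟩ := hcon
  -- The entries of a block that meets a row class and a column class form a bijection between these
  -- classes.
  have hcard : ∀ i b, ¬ P i →
      (Finset.univ.filter fun x => (x ∈ R ↔ b ∈ R)).card =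
      (Finset.univ.filter fun x => (x ∈ T ↔ (π.symm (i, b)).2 ∈ T)).card := by
    intro i b hi
    have hr := (hR i).resolve_left hi
    have hc := (hT (π.symm (i, b)).1).resolve_left (by rw [← hconst i b]; exact hi)
    have hib : (π ((π.symm (i, b)).1, (π.symm (i, b)).2)) = (i, b) := by simp
    refine Finset.card_bij' (fun x _ => (π.symm (i, x)).2)
      (fun x _ => (π ((π.symm (i, b)).1, x)).2) ?_ ?_ ?_ ?_
    · intro x hx
      simp only [Finset.mem_filter, Finset.mem_univ, true_and] at hx ⊢
      have h := (hr x b).mpr hx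
      rw [← hc, hib, ← h]
      simp
    · intro x hx
      simp only [Finset.mem_filter, Finset.mem_univ, true_and] at hx ⊢
      have h := (hc x _).mpr hx
      rw [hib] at h
      rw [← hr, show (i, (π ((π.symm (i, b)).1, x)).2) = π ((π.symm (i, b)).1, x) from
        Prod.ext h.symm rfl]
      simp
    · intro x hx
      simp only [Finset.mem_filter, Finset.mem_univ, true_and] at hx ⊢
      have h := (hr x b).mpr hx
      rw [← h]
      simp
    · intro x hx
      simp only [Finset.mem_filter, Finset.mem_univ, true_and] at hx ⊢
      have h := (hc x _).mpr hx
      rw [hib] at h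
      rw [show (i, (π ((π.symm (i, b)).1, x)).2) = π ((π.symm (i, b)).1, x) from
        Prod.ext h.symm rfl]
      simp
  have hsplit : ∀ X : Set B, (Finset.univ.filter fun x => x ∈ X).card +
      (Finset.univ.filter fun x => x ∉ X).card = Fintype.card B := fun X => by
    rw [Finset.card_filter_add_card_filter_not, Finset.card_univ]
  have hiff : ∀ (X : Set B) (p : Prop), (Finset.univ.filter fun x => (x ∈ X ↔ p)) =
      if p then Finset.univ.filter fun x => x ∈ X else Finset.univ.filter fun x => x ∉ X := by
    intro X p
    split_ifs with hp <;> simp [hp]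
  have c₁ := hcard i₁ b₁ hi₁
  have c₂ := hcard i₂ b₂ hi₂
  have sR := hsplit R
  have sT := hsplit T
  -- Both kinds of matching between classes occur, so all four class sizes agree. The signs of class
  -- membership therefore sum to zero, over `R` as over `T`.
  have hbal : (Finset.univ.filter fun x => x ∈ R).card = (Finset.univ.filter fun x => x ∉ R).card ∧
      (Finset.univ.filter fun x => x ∈ T).card = (Finset.univ.filter fun x => x ∉ T).card := by
    rw [hiff, hiff] at c₁ c₂
    simp only [Set.mem_compl_iff] at h₂
    by_cases p₁ : b₁ ∈ R <;> by_cases q₁ : (π.symm (i₁, b₁)).2 ∈ T <;>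
      by_cases p₂ : b₂ ∈ R <;> by_cases q₂ : (π.symm (i₂, b₂)).2 ∈ T <;>
      simp only [p₁, q₁, p₂, q₂, if_true, if_false, not_true_eq_false, not_false_eq_true,
        true_and, and_true, and_false, false_and, or_true, or_false, true_or, false_or,
        or_self] at h₁ h₂ c₁ c₂ <;> omega
  have hzero : ∀ X : Set B, (Finset.univ.filter fun x => x ∈ X).card =
      (Finset.univ.filter fun x => x ∉ X).card →
      ∑ b, (if b ∈ X then 1 else -1 : ℤ) = 0 := by
    intro X h
    rw [Finset.sum_ite]
    simp [h]
  have sumR : ∑ x : A × B, (if P x.1 then 0 else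
      if x.2 ∈ R then 1 else -1 : ℤ) = 0 := by
    rw [Fintype.sum_prod_type]
    refine Finset.sum_eq_zero fun i _ => ?_
    by_cases h : P i
    · exact Finset.sum_eq_zero fun _ _ => if_pos h
    · simp only [if_neg h]
      exact hzero R hbal.1
  have sumT : ∑ x : A × B, (if P x.1 then 0 else
      if (π.symm x).2 ∈ T then 1 else -1 : ℤ) = 0 := by
    let F : A × B → ℤ := fun z => if P' z.1 then 0 else if z.2 ∈ T then 1 else -1
    have : ∀ x : A × B, (if P x.1 then 0 else
      if (π.symm x).2 ∈ T then 1 else -1 : ℤ) = F (π.symm x) := by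
      rintro ⟨i, b⟩
      simp only [F, hconst i b]
    refine (Finset.sum_congr rfl fun x _ => this x).trans ((Equiv.sum_comp π.symm F).trans ?_)
    rw [Fintype.sum_prod_type]
    refine Finset.sum_eq_zero fun i _ => ?_
    by_cases h : P' i
    · exact Finset.sum_eq_zero fun _ _ => if_pos h
    · simp only [F, if_neg h]
      exact hzero T hbal.2
  -- every one of the four types occurs, by cancellation in these sums
  have hopp : ∀ s t : ℤ, ∀ i b, ¬ P i →
      0 < s * (if b ∈ R then 1 else -1) + t * (if (π.symm (i, b)).2 ∈ T then 1 else -1) →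
      ∃ i b, ¬ P i ∧
        s * (if b ∈ R then 1 else -1) + t * (if (π.symm (i, b)).2 ∈ T then 1 else -1) < 0 := by
    intro s t i b hi hpos
    by_contra! hno
    have hsum : ∑ x : A × B, (if P x.1 then 0 else
        s * (if x.2 ∈ R then 1 else -1) + t * (if (π.symm x).2 ∈ T then 1 else -1) : ℤ) = 0 := by
      have := congrArg₂ (fun p q => s * p + t * q) sumR sumT
      simp only [mul_zero, add_zero] at this
      rw [Finset.mul_sum, Finset.mul_sum, ← Finset.sum_add_distrib] at this
      refine Eq.trans (Finset.sum_congr rfl fun x _ => ?_) this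
      split_ifs <;> ring
    have := (Finset.sum_eq_zero_iff_of_nonneg (fun x _ => ?_)).mp hsum (i, b) (Finset.mem_univ _)
    · rw [if_neg hi] at this
      simp only at this
      omega
    · split_ifs with h1 <;> first | exact le_rfl | skip
      all_goals
        have := hno x.1 x.2 h1
        simp_all
  have hall : ∀ p q : Prop, ∃ i b, ¬ P i ∧
      (b ∈ R ↔ p) ∧ ((π.symm (i, b)).2 ∈ T ↔ q) := by
    have hmk : ∀ (p q : Prop) (i b), ¬ P i →
        ((b ∈ R ↔ p) ∧ ((π.symm (i, b)).2 ∈ T ↔ q) ∨ (b ∈ R ↔ ¬ p) ∧ ((π.symm (i, b)).2 ∈ T ↔ ¬ q)) →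
        ∃ i b, ¬ P i ∧
          (b ∈ R ↔ p) ∧ ((π.symm (i, b)).2 ∈ T ↔ q) := by
      rintro p q i b hi (h | h)
      · exact ⟨i, b, hi, h⟩
      -- With these signs the combination is positive on the type opposite to `(p, q)`, zero on the
      -- mixed types, and negative exactly on the type `(p, q)`.
      · obtain ⟨i', b', hi', h'⟩ := hopp (if p then -1 else 1) (if q then -1 else 1) i b hi (by
          simp only [h.1, h.2]
          by_cases p <;> by_cases q <;> simp [*])
        refine ⟨i', b', hi', ?_⟩
        by_cases hp : p <;> by_cases hq : q <;> by_cases h1 : b' ∈ R <;>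
          by_cases h2 : (π.symm (i', b')).2 ∈ T <;> simp [hp, hq, h1, h2] at h' ⊢
    intro p q
    simp only [Set.mem_compl_iff] at h₂
    by_cases hpq : p ↔ q
    · exact hmk p q i₂ b₂ hi₂ (by
        clear * - h₂ hpq
        tauto)
    · exact hmk p q i₁ b₁ hi₁ (by
        clear * - h₁ hpq
        tauto)
  choose i b hi hbR hbT using hall
  have hval : ∀ p q x x', block (monomialMatrix π u) (i p q) (π.symm (i p q, b p q)).1 x x' ≠ 0 →
      (x ∈ R ↔ p) ∧ (x' ∈ T ↔ q) := by
    intro p q x x' hx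
    rw [block_monomialMatrix] at hx
    simp only [rowBlock, ne_eq, ite_eq_right_iff, Classical.not_imp] at hx
    obtain ⟨⟨hx₁, hx₂⟩, -⟩ := hx
    have hr := ((hR _).resolve_left (hi p q) x (b p q)).mp hx₁
    have hc := (hT (π.symm (i p q, b p q)).1).resolve_left
      (by rw [← hconst]; exact hi p q)
    have h := (hc x' (π.symm (i p q, b p q)).2).mp (by
      rw [← hx₂]
      conv_lhs => rw [← hx₁]
      simp)
    exact ⟨hr.trans (hbR p q), h.trans (hbT p q)⟩
  -- The four blocks live in the four disjoint rectangles of row class times column class, so they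
  -- cannot be dependent.
  obtain ⟨c₁, c₂, c₃, c₄, hne, h⟩ := hS _ (hblk (i True True) (π.symm (i True True, b True True)).1)
    _ (hblk (i True False) (π.symm (i True False, b True False)).1)
    _ (hblk (i False True) (π.symm (i False True, b False True)).1)
    _ (hblk (i False False) (π.symm (i False False, b False False)).1)
  have ev := fun x x' => congrFun (congrFun h x) x'
  simp only [Matrix.add_apply, Matrix.smul_apply, Matrix.zero_apply, smul_eq_mul] at ev
  have hz : ∀ p q p' q', ¬ ((p' ↔ p) ∧ (q' ↔ q)) → block (monomialMatrix π u) (i p q)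
      (π.symm (i p q, b p q)).1 (b p' q') (π.symm (i p' q', b p' q')).2 = 0 := by
    intro p q p' q' hpq
    by_contra hx
    have := hval p q _ _ hx
    rw [hbR, hbT] at this
    exact hpq this
  have hnz : ∀ p q, block (monomialMatrix π u) (i p q)
      (π.symm (i p q, b p q)).1 (b p q) (π.symm (i p q, b p q)).2 ≠ 0 := by
    intro p q
    simp [block_monomialMatrix, rowBlock, hu]
  apply hne
  have e₁ := ev (b True True) (π.symm (i True True, b True True)).2
  have e₂ := ev (b True False) (π.symm (i True False, b True False)).2
  have e₃ := ev (b False True) (π.symm (i False True, b False True)).2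
  have e₄ := ev (b False False) (π.symm (i False False, b False False)).2
  simp [hz, hnz] at e₁ e₂ e₃ e₄
  exact ⟨e₁, e₂, e₃, e₄⟩

theorem exists_isNormalForm_of_partitions [Nonempty B] {R T : Set B}
    (S : Submodule ℂ (Matrix B B ℂ)) (hblk : ∀ i j, block (monomialMatrix π u) i j ∈ S)
    (hR : ∀ i, (∀ b b', (π.symm (i, b)).1 = (π.symm (i, b')).1) ∨
      ∀ b b', (π.symm (i, b)).1 = (π.symm (i, b')).1 ↔ (b ∈ R ↔ b' ∈ R))
    (hT : ∀ j, (∀ b b', (π (j, b)).1 = (π (j, b')).1) ∨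
      ∀ b b', (π (j, b)).1 = (π (j, b')).1 ↔ (b ∈ T ↔ b' ∈ T))
    (hconst : ∀ i b, (∀ b b', (π.symm (i, b)).1 = (π.symm (i, b')).1) ↔
      ∀ x x', (π ((π.symm (i, b)).1, x)).1 = (π ((π.symm (i, b)).1, x')).1)
    (hRT : ∀ i b, (¬ ∀ b b', (π.symm (i, b)).1 = (π.symm (i, b')).1) →
      (b ∈ R ↔ (π.symm (i, b)).2 ∈ T)) :
    ∃ (C : B → Bool) (σ : Bool → Equiv.Perm A) (y : A → Equiv.Perm B),
      (∀ b, C b = true ↔ b ∈ T) ∧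
      IsNormalForm S (monomialMatrix π u) C σ y fun i b' => u ((σ (C b')).symm i, b') := by
  classical
  let C : B → Bool := fun b => decide (b ∈ T)
  have hd : ∀ j b b', C b = C b' → (π (j, b)).1 = (π (j, b')).1 := by
    intro j b b' h
    rcases hT j with h1 | h1
    · exact h1 b b'
    · exact (h1 b b').mpr (by simpa [C] using h)
  -- two entries of a row with the same class of columns lie in the same column
  have hrow : ∀ i b b', C (π.symm (i, b)).2 = C (π.symm (i, b')).2 →
      (π.symm (i, b)).1 = (π.symm (i, b')).1 := by
    intro i b b' h
    by_cases hi : ∀ b b', (π.symm (i, b)).1 = (π.symm (i, b')).1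
    · exact hi b b'
    · have h' : (π.symm (i, b)).2 ∈ T ↔ (π.symm (i, b')).2 ∈ T := by simpa [C] using h
      exact ((hR i).resolve_left hi b b').mpr ((hRT i b hi).trans (h'.trans (hRT i b' hi).symm))
  -- `p` picks a representative of each column class. If a class is empty its value is arbitrary,
  -- which later gives `σ true = σ false`.
  obtain ⟨p, hp⟩ : ∃ p : Bool → B, ∀ b, C (p (C b)) = C b := by
    refine ⟨fun ε => if h : ∃ b, C b = ε then h.choose else Classical.arbitrary B, fun b => ?_⟩
    have h : ∃ b', C b' = C b := ⟨b, rfl⟩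
    simp only [dif_pos h]
    exact h.choose_spec
  have hσinj : ∀ ε, Function.Injective fun j => (π (j, p ε)).1 := by
    intro ε j j' h
    have e : ∀ j, π.symm ((π (j, p ε)).1, (π (j, p ε)).2) = (j, p ε) := fun j => by simp
    have := hrow (π (j, p ε)).1 (π (j, p ε)).2 (π (j', p ε)).2 (by
      rw [e j]
      simp only at h
      rw [h, e j'])
    rw [e j] at this
    simp only at h
    rw [h, e j'] at this
    exact this
  let σ : Bool → Equiv.Perm A := fun ε =>
    Equiv.ofBijective _ (Finite.injective_iff_bijective.mp (hσinj ε))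
  have hσ : ∀ j b, (π (j, b)).1 = σ (C b) j := fun j b => hd j b _ (hp b).symm
  have hτinj : ∀ i, Function.Injective fun b => (π.symm (i, b)).2 := by
    intro i b b' h
    have h1 := hrow i b b' (congrArg C h)
    have := π.symm.injective (Prod.ext h1 h)
    exact (Prod.ext_iff.mp this).2
  let y : A → Equiv.Perm B := fun i =>
    (Equiv.ofBijective _ (Finite.injective_iff_bijective.mp (hτinj i))).symm
  have hy : ∀ i b b', b = y i b' ↔ (π.symm (i, b)).2 = b' := fun i b b' => by
    rw [Equiv.eq_symm_apply]; rfl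
  have heq : ∀ i b j b', monomialMatrix π u (i, b) (j, b') = if i = σ (C b') j then
      monomialMatrix (y i) (fun b' => u ((σ (C b')).symm i, b')) b b' else 0 := by
    intro i b j b'
    simp only [monomialMatrix, ← Equiv.symm_apply_eq (e := σ _), hy]
    by_cases h : (i, b) = π (j, b')
    · have h1 : i = σ (C b') j := by rw [← hσ, ← h]
      have h2 : (π.symm (i, b)).2 = b' := by rw [h]; simp
      rw [if_pos h, if_pos (by rw [h1]; simp), if_pos h2]
      congr 2
      rw [h1]; simp
    · rw [if_neg h]
      split_ifs with h1 h2
      · exfalso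
        rw [Equiv.symm_apply_eq, ← hσ] at h1
        have e : π.symm (i, (π (j, b')).2) = (j, b') := by
          rw [show (i, (π (j, b')).2) = π (j, b') from Prod.ext h1 rfl]; simp
        have : b = (π (j, b')).2 := hτinj i (by simp only [h2, e])
        exact h (Prod.ext h1 this)
      · rfl
      · rfl
  refine ⟨C, σ, y, fun b => by simp [C], heq, fun i => ?_, fun i => ?_, ?_⟩
  -- The matrix controlled by `i` is the sum of all blocks in its row; if the row splits, its column
  -- parts are the individual blocks.
  · have : monomialMatrix (y i) (fun b' => u ((σ (C b')).symm i, b')) =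
        ∑ j, block (monomialMatrix π u) i j := by
      ext b b'
      simp only [Matrix.sum_apply, block, heq, ← Equiv.symm_apply_eq (e := σ _)]
      simp
    rw [this]
    exact Submodule.sum_mem _ fun j _ => hblk i j
  · by_cases hi : ∀ b b', (π.symm (i, b)).1 = (π.symm (i, b')).1
    · left
      have : ∀ ε, (σ ε).symm i = (π.symm (i, p ε)).1 := by
        intro ε
        rw [Equiv.symm_apply_eq]
        have h1 := (hconst i (p ε)).mp hi (p ε) (π.symm (i, p ε)).2
        refine Eq.trans ?_ h1.symm
        simp
      rw [this, this]
      exact hi _ _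
    · right
      intro ε
      have : colPart C ε (monomialMatrix (y i) (fun b' => u ((σ (C b')).symm i, b'))) =
          block (monomialMatrix π u) i ((σ ε).symm i) := by
        ext b b'
        simp only [colPart, block, heq]
        by_cases hb : C b' = ε
        · rw [if_pos hb, if_pos (by rw [hb]; simp)]
        · rw [if_neg hb, if_neg]
          intro h
          apply hi
          have hall : ∀ ε', i = σ ε' ((σ ε).symm i) := by
            intro ε'
            by_cases hε : ε' = ε
            · rw [hε]; simp
            · have : ε' = C b' := by
                revert hb hε
                generalize C b' = q
                cases ε <;> cases ε' <;> cases q <;> simp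
              rw [this]; exact h
          have h2 : (π.symm (i, (π ((σ ε).symm i, b')).2)).1 = (σ ε).symm i := by
            rw [show (i, (π ((σ ε).symm i, b')).2) = π ((σ ε).symm i, b') from
              Prod.ext ((hall (C b')).trans (hσ _ _).symm) rfl]
            simp
          rw [hconst i (π ((σ ε).symm i, b')).2, h2]
          intro x x'
          rw [hσ, hσ, ← hall, ← hall]
      rw [this]
      exact hblk _ _
  · by_cases hs : Function.Surjective C
    · exact Or.inr hs
    · left
      rw [Function.Surjective] at hs
      push Not at hs
      obtain ⟨ε, hε⟩ := hs
      have : C (p true) = C (p false) := by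
        have h1 := hε (p true)
        have h2 := hε (p false)
        revert h1 h2
        cases ε <;> cases C (p true) <;> cases C (p false) <;> simp
      ext j
      exact hd j _ _ this

/-- Normal form of monomial bipartite unitaries whose blocks span an at most three-dimensional
space. -/
theorem pattern_const_or_exists_isNormalForm [Nonempty B] {Q : Fin 3 → Matrix B B ℂ}
    (hu : ∀ x, u x ≠ 0)
    (hblk : ∀ i j, block (monomialMatrix π u) i j ∈ Submodule.span ℂ (Set.range Q)) :
    (∀ i i' b, (π.symm (i, b)).2 = (π.symm (i', b)).2) ∨
    ∃ (C : B → Bool) (σ : Bool → Equiv.Perm A) (y : A → Equiv.Perm B),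
      IsNormalForm (Submodule.span ℂ (Set.range Q)) (monomialMatrix π u) C σ y
        fun i b' => u ((σ (C b')).symm i, b') := by
  by_cases hτ : ∀ i i' b, (π.symm (i, b)).2 = (π.symm (i', b)).2
  · exact Or.inl hτ
  right
  have hS := fourDependent_span Q
  obtain ⟨R, hR⟩ := (pattern_const_or_common_partition (fun i b => hu _) hS
    (fun i j => by rw [← block_monomialMatrix]; exact hblk i j)).resolve_left hτ
  have hS' := fourDependent_span fun k => (Q k)ᵀ
  have hblk' : ∀ i j, (block (monomialMatrix π u) i j)ᵀ ∈
      Submodule.span ℂ (Set.range fun k => (Q k)ᵀ) := by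
    intro i j
    have := Submodule.mem_map_of_mem (f := (Matrix.transposeLinearEquiv B B ℂ ℂ).toLinearMap)
      (hblk i j)
    rw [Submodule.map_span, ← Set.range_comp] at this
    exact this
  have hTpat := pattern_const_or_common_partition (c := fun j b => (π (j, b)).1)
    (τ := fun j b => (π (j, b)).2) (w := fun j b => u (j, b)) (fun i b => hu _) hS'
    (fun j i => by rw [← block_monomialMatrix_transpose]; exact hblk' i j)
  -- If the inner row index of every column were independent of the block column, inverting that
  -- single permutation of `B` would make the row pattern constant too.
  obtain ⟨T, hT⟩ := hTpat.resolve_left (fun h => by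
    apply hτ
    intro i i' b
    by_contra hne
    have key : ∀ x x', (π (x, x')).2 = (π (i, x')).2 := fun x x' => h x i x'
    have hsurj : Function.Surjective fun x' => (π (i, x')).2 := fun b₀ => by
      refine ⟨(π.symm (i, b₀)).2, ?_⟩
      simp only
      rw [← key (π.symm (i, b₀)).1]
      simp
    have hinj := Finite.injective_iff_surjective.mpr hsurj
    apply hne
    apply hinj
    simp only
    rw [← key (π.symm (i, b)).1, ← key (π.symm (i', b)).1]
    simp)
  -- If a row of blocks consists of one block, that block is a full monomial matrix and fills its
  -- block column as well; the converse is the same for the inverse permutation.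
  have hconst : ∀ i b, (∀ b b', (π.symm (i, b)).1 = (π.symm (i, b')).1) ↔
      ∀ x x', (π ((π.symm (i, b)).1, x)).1 = (π ((π.symm (i, b)).1, x')).1 := by
    have aux : ∀ (ρ : Equiv.Perm (A × B)) (i : A) (b : B),
        (∀ b b', (ρ (i, b)).1 = (ρ (i, b')).1) → ∀ x, (ρ.symm ((ρ (i, b)).1, x)).1 = i := by
      intro ρ i b h x
      have hinj : Function.Injective fun b' => (ρ (i, b')).2 := fun b₁ b₂ hb =>
        (Prod.ext_iff.mp (ρ.injective (Prod.ext (h b₁ b₂) hb))).2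
      obtain ⟨b', hb'⟩ := (Finite.injective_iff_surjective.mp hinj) x
      have : ((ρ (i, b)).1, x) = ρ (i, b') := Prod.ext (h b b') hb'.symm
      rw [this]; simp
    intro i b
    constructor
    · intro h x x'
      have := aux π.symm i b h
      simp only [Equiv.symm_symm] at this
      rw [this, this]
    · intro h x x'
      have h1 := aux π (π.symm (i, b)).1 (π.symm (i, b)).2 h
      simp only [Prod.mk.eta, Equiv.apply_symm_apply] at h1
      exact (h1 x).trans (h1 x').symm
  rcases types_consistent hu hS hblk hR hT hconst with h | h
  · obtain ⟨C, σ, y, -, hn⟩ := exists_isNormalForm_of_partitions _ hblk hR hT hconst h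
    exact ⟨C, σ, y, hn⟩
  -- A column partition is unchanged by complementation, so the reversed matching reduces to the
  -- direct one.
  · obtain ⟨C, σ, y, -, hn⟩ := exists_isNormalForm_of_partitions _ hblk hR (T := Tᶜ) (fun j =>
      (hT j).imp_right fun h' b b' => by
        rw [h', Set.mem_compl_iff, Set.mem_compl_iff, not_iff_not]) hconst h
    exact ⟨C, σ, y, hn⟩

end NormalForm

/-! ### Three points determine a circle. -/

section Circle

theorem norm_sub_eq_iff_sq {z c : ℂ} {ρ : ℝ} (h : ‖z - c‖ = ρ) :
    (z.re - c.re) ^ 2 + (z.im - c.im) ^ 2 = ρ ^ 2 := by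
  rw [← h, Complex.sq_norm, Complex.normSq_apply]
  simp; ring

theorem eq_zero_of_sq_add_sq {x y : ℝ} (h : x ^ 2 + y ^ 2 = 0) : x = 0 ∧ y = 0 := by
  constructor <;> nlinarith [sq_nonneg x, sq_nonneg y]

/-- The points `(a, b)` and `(p, q)` lie on the circle through the origin with centre `(h, k)`, and
on the line through the origin orthogonal to `(w, v)`. Such a line meets the circle in at most one
further point. -/
theorem eq_of_two_chords {a b p q h k w v : ℝ} (e₁ : a ^ 2 + b ^ 2 = 2 * (h * a + k * b))
    (e₂ : p ^ 2 + q ^ 2 = 2 * (h * p + k * q)) (e₃ : a * w + b * v = 0) (e₄ : p * w + q * v = 0)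
    (hwv : w ≠ 0 ∨ v ≠ 0) (hab : a ^ 2 + b ^ 2 ≠ 0) (hpq : p ^ 2 + q ^ 2 ≠ 0) :
    a = p ∧ b = q := by
  have hx : a * q - b * p = 0 := by
    rcases hwv with h0 | h0
    · have : (a * q - b * p) * w = 0 := by linear_combination q * e₃ - b * e₄
      exact (mul_eq_zero.mp this).resolve_right h0
    · have : (a * q - b * p) * v = 0 := by linear_combination a * e₄ - p * e₃
      exact (mul_eq_zero.mp this).resolve_right h0
  have f₁ : p ^ 2 + q ^ 2 - (a * p + b * q) = 0 := by
    have : (a ^ 2 + b ^ 2) * (p ^ 2 + q ^ 2 - (a * p + b * q)) = 0 := by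
      linear_combination (a ^ 2 + b ^ 2) * e₂ - (a * p + b * q) * e₁ +
        2 * (k * a - h * b) * hx
    exact (mul_eq_zero.mp this).resolve_left hab
  have f₂ : a ^ 2 + b ^ 2 - (a * p + b * q) = 0 := by
    have : (p ^ 2 + q ^ 2) * (a ^ 2 + b ^ 2 - (a * p + b * q)) = 0 := by
      linear_combination (p ^ 2 + q ^ 2) * e₁ - (a * p + b * q) * e₂ +
        2 * (h * q - k * p) * hx
    exact (mul_eq_zero.mp this).resolve_left hpq
  have g : (a - p) ^ 2 + (b - q) ^ 2 = 0 := by linear_combination f₁ + f₂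
  obtain ⟨g₁, g₂⟩ := eq_zero_of_sq_add_sq g
  exact ⟨sub_eq_zero.mp g₁, sub_eq_zero.mp g₂⟩

/-- A circle is determined by three of its points. -/
theorem center_unique {z₁ z₂ z₃ c c' : ℂ} {ρ ρ' : ℝ} (h₁₂ : z₁ ≠ z₂) (h₁₃ : z₁ ≠ z₃)
    (h₂₃ : z₂ ≠ z₃) (h₁ : ‖z₁ - c‖ = ρ) (h₂ : ‖z₂ - c‖ = ρ) (h₃ : ‖z₃ - c‖ = ρ)
    (h₁' : ‖z₁ - c'‖ = ρ') (h₂' : ‖z₂ - c'‖ = ρ') (h₃' : ‖z₃ - c'‖ = ρ') : c = c' := by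
  replace h₁ := norm_sub_eq_iff_sq h₁
  replace h₂ := norm_sub_eq_iff_sq h₂
  replace h₃ := norm_sub_eq_iff_sq h₃
  replace h₁' := norm_sub_eq_iff_sq h₁'
  replace h₂' := norm_sub_eq_iff_sq h₂'
  replace h₃' := norm_sub_eq_iff_sq h₃'
  have hsep : ∀ {z z' : ℂ}, z ≠ z' → (z.re - z'.re) ^ 2 + (z.im - z'.im) ^ 2 ≠ 0 := by
    intro z z' h h0
    obtain ⟨h1, h2⟩ := eq_zero_of_sq_add_sq h0
    exact h (Complex.ext (sub_eq_zero.mp h1) (sub_eq_zero.mp h2))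
  by_contra hne
  -- With `z₁` as origin, subtracting the equations of the two circles shows that both chords are
  -- orthogonal to `c - c'`.
  have key := eq_of_two_chords (a := z₁.re - z₂.re) (b := z₁.im - z₂.im) (p := z₁.re - z₃.re)
    (q := z₁.im - z₃.im) (h := z₁.re - c.re) (k := z₁.im - c.im) (w := c.re - c'.re)
    (v := c.im - c'.im) (by linear_combination h₂ - h₁) (by linear_combination h₃ - h₁)
    (by linear_combination (h₂ - h₁ - h₂' + h₁') / 2)
    (by linear_combination (h₃ - h₁ - h₃' + h₁') / 2)
    (by
      by_contra! hc
      exact hne (Complex.ext (sub_eq_zero.mp hc.1) (sub_eq_zero.mp hc.2)))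
    (hsep h₁₂) (hsep h₁₃)
  exact h₂₃ (Complex.ext (sub_right_injective key.1) (sub_right_injective key.2))

end Circle

/-! ### Unimodular monomial matrices in a plane. -/

section Unimodular

variable {B : Type*} [Fintype B] [DecidableEq B]

/-- A monomial matrix with entries of modulus one. -/
def IsUnimodularMonomial (M : Matrix B B ℂ) : Prop :=
  ∃ (π : Equiv.Perm B) (u : B → ℂ), (∀ b, ‖u b‖ = 1) ∧ M = monomialMatrix π u

theorem IsUnimodularMonomial.smul {M : Matrix B B ℂ} (h : IsUnimodularMonomial M) {a : ℂ}
    (ha : ‖a‖ = 1) : IsUnimodularMonomial (a • M) := by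
  obtain ⟨π, u, hu, rfl⟩ := h
  refine ⟨π, fun b => a * u b, fun b => by rw [norm_mul, ha, hu, one_mul], ?_⟩
  ext b b'
  simp [monomialMatrix]

theorem IsUnimodularMonomial.norm_eq_one {M : Matrix B B ℂ} (h : IsUnimodularMonomial M)
    {b b' : B} (hb : M b b' ≠ 0) : ‖M b b'‖ = 1 := by
  obtain ⟨π, u, hu, rfl⟩ := h
  simp only [monomialMatrix, ne_eq, ite_eq_right_iff, Classical.not_imp] at hb ⊢
  rw [if_pos hb.1, hu]

theorem IsUnimodularMonomial.exists_ne_zero {M : Matrix B B ℂ} (h : IsUnimodularMonomial M)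
    (b : B) : ∃ b', M b b' ≠ 0 := by
  obtain ⟨π, u, hu, rfl⟩ := h
  refine ⟨π.symm b, ?_⟩
  have : u (π.symm b) ≠ 0 := fun h0 => by simpa [h0] using hu (π.symm b)
  simpa [monomialMatrix] using this

theorem IsUnimodularMonomial.eq_zero_of_row {M : Matrix B B ℂ} (h : IsUnimodularMonomial M)
    {b b' b'' : B} (hb : M b b' ≠ 0) (hne : b'' ≠ b') : M b b'' = 0 := by
  obtain ⟨π, u, hu, rfl⟩ := h
  simp only [monomialMatrix, ne_eq, ite_eq_right_iff, Classical.not_imp] at hb ⊢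
  intro h'
  exact absurd (π.injective (h'.symm.trans hb.1)) hne

theorem IsUnimodularMonomial.mem_unitaryGroup {M : Matrix B B ℂ} (h : IsUnimodularMonomial M) :
    M ∈ Matrix.unitaryGroup B ℂ := by
  obtain ⟨π, u, hu, rfl⟩ := h
  exact monomialMatrix_mem_unitaryGroup hu

open Classical in
/-- The unimodular monomial matrices in a plane spanned by one of them and a matrix `K` with a zero
row fall into two classes, up to phases on and off the columns of `K`. -/
theorem exists_two_classes {Y K : Matrix B B ℂ} (hY : IsUnimodularMonomial Y) {r : B}
    (hK : ∀ x, K r x = 0) : ∃ V : Bool → Matrix B B ℂ, (∀ t, IsUnimodularMonomial (V t)) ∧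
      ∀ α γ : ℂ, IsUnimodularMonomial (α • Y + γ • K) → ∃ (t : Bool) (x : Bool → ℂ),
        (∀ e, ‖x e‖ = 1) ∧
        ∀ b b', (α • Y + γ • K) b b' = V t b b' * x (decide (∃ z, K z b' ≠ 0)) := by
  -- In the zero row of `K` only `α • Y` is seen. Dividing by `α` leaves a single parameter `δ` in
  -- `Y + δ • K`.
  have hα : ∀ α γ : ℂ, IsUnimodularMonomial (α • Y + γ • K) → ‖α‖ = 1 := by
    intro α γ h
    obtain ⟨x, hx⟩ := h.exists_ne_zero r
    have h1 := h.norm_eq_one hx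
    simp only [Matrix.add_apply, Matrix.smul_apply, hK, smul_eq_mul, mul_zero, add_zero] at hx h1
    rwa [norm_mul, hY.norm_eq_one (right_ne_zero_of_mul hx), mul_one] at h1
  have hred : ∀ α γ : ℂ, IsUnimodularMonomial (α • Y + γ • K) →
      IsUnimodularMonomial (Y + (γ / α) • K) ∧ α • Y + γ • K = α • (Y + (γ / α) • K) := by
    intro α γ h
    have h1 := hα α γ h
    have h0 : α ≠ 0 := fun h0 => by simp [h0] at h1
    have h2 : α • Y + γ • K = α • (Y + (γ / α) • K) := by
      rw [smul_add, smul_smul, mul_div_cancel₀ _ h0]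
    refine ⟨?_, h2⟩
    have := h.smul (a := α⁻¹) (by rw [norm_inv, h1, inv_one])
    rwa [h2, smul_smul, inv_mul_cancel₀ h0, one_smul] at this
  -- With at most one nonzero admissible `δ`, the two classes are `Y` and `Y + δ • K`. With two of
  -- them, `K` is `Y` with rescaled columns, and one class suffices once phases on the columns of
  -- `K` are allowed.
  by_cases huniq : ∀ δ δ' : ℂ, δ ≠ 0 → δ' ≠ 0 → IsUnimodularMonomial (Y + δ • K) →
      IsUnimodularMonomial (Y + δ' • K) → δ = δ'
  · obtain ⟨V, hV, hV'⟩ : ∃ V, IsUnimodularMonomial V ∧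
        ∀ δ : ℂ, δ ≠ 0 → IsUnimodularMonomial (Y + δ • K) → Y + δ • K = V := by
      by_cases hex : ∃ δ : ℂ, δ ≠ 0 ∧ IsUnimodularMonomial (Y + δ • K)
      · obtain ⟨δ, h0, hδ⟩ := hex
        exact ⟨_, hδ, fun δ' h0' hδ' => by rw [huniq δ' δ h0' h0 hδ' hδ]⟩
      · push Not at hex
        exact ⟨Y, hY, fun δ h0 hδ => absurd hδ (hex δ h0)⟩
    refine ⟨fun t => if t then V else Y, fun t => by cases t <;> simp [hV, hY], ?_⟩
    intro α γ h
    obtain ⟨h1, h2⟩ := hred α γ h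
    by_cases h0 : γ / α = 0
    · refine ⟨false, fun _ => α, fun _ => hα α γ h, fun b b' => ?_⟩
      rw [h2, h0]
      simp [mul_comm]
    · refine ⟨true, fun _ => α, fun _ => hα α γ h, fun b b' => ?_⟩
      rw [h2, hV' _ h0 h1]
      simp [mul_comm]
  · push Not at huniq
    obtain ⟨δ, δ', hδ0, hδ0', hδ, hδ', hne⟩ := huniq
    have hsupp : ∀ b b', Y b b' = 0 → K b b' = 0 := by
      intro b b' h0
      by_contra hKb
      obtain ⟨x, hx⟩ := hY.exists_ne_zero b
      have hxb : x ≠ b' := fun h => hx (h ▸ h0)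
      have key : ∀ ε : ℂ, ε ≠ 0 → IsUnimodularMonomial (Y + ε • K) → Y b x + ε * K b x = 0 := by
        intro ε hε h
        have h1 : (Y + ε • K) b b' ≠ 0 := by simp [h0, hε, hKb]
        simpa using h.eq_zero_of_row h1 hxb
      have k₁ := key δ hδ0 hδ
      have k₂ := key δ' hδ0' hδ'
      have hKx : K b x ≠ 0 := fun h => hx (by simpa [h] using k₁)
      exact hne (mul_right_cancel₀ hKx (by linear_combination k₁ - k₂))
    obtain ⟨π, u, hu, rfl⟩ := id hY
    have hu0 : ∀ b, u b ≠ 0 := fun b h0 => by simpa [h0] using hu b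
    obtain ⟨g, hg⟩ : ∃ g : B → ℂ, ∀ b b', K b b' = monomialMatrix π u b b' * g b' := by
      refine ⟨fun b' => K (π b') b' / u b', fun b b' => ?_⟩
      by_cases h : b = π b'
      · subst h
        simp [monomialMatrix, mul_div_cancel₀ _ (hu0 b')]
      · rw [hsupp b b' (by simp [monomialMatrix, h])]
        simp [monomialMatrix, h]
    have hE : ∀ b', (∃ z, K z b' ≠ 0) ↔ g b' ≠ 0 := by
      intro b'
      constructor
      · rintro ⟨z, hz⟩ h0
        exact hz (by rw [hg, h0, mul_zero])
      · intro h0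
        refine ⟨π b', ?_⟩
        rw [hg]
        simp [monomialMatrix, hu0, h0]
    have hmod : ∀ ε : ℂ, IsUnimodularMonomial (monomialMatrix π u + ε • K) →
        ∀ b', ‖1 + ε * g b'‖ = 1 := by
      rintro ε ⟨π', u', hu', h⟩ b'
      have hcol : ∀ b, monomialMatrix π' u' b b' = monomialMatrix π u b b' * (1 + ε * g b') := by
        intro b
        rw [← h, Matrix.add_apply, Matrix.smul_apply, hg, smul_eq_mul]; ring
      have h1 := hcol (π' b')
      simp only [monomialMatrix, if_true] at h1
      have h2 := congrArg norm h1
      rw [hu', norm_mul] at h2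
      split_ifs at h2
      · rw [hu, one_mul] at h2; exact h2.symm
      · simp at h2
    -- The condition `‖1 + ε * g‖ = 1` puts `g` on the circle through `0` with centre `-ε⁻¹`. Two
    -- distinct nonzero values would give three points common to the circles for `δ` and `δ'`.
    have hgc : ∀ b b', g b ≠ 0 → g b' ≠ 0 → g b = g b' := by
      intro b b' hb hb'
      by_contra hbb
      have hc : ∀ ε : ℂ, ε ≠ 0 → (∀ b', ‖1 + ε * g b'‖ = 1) → ∀ z, (z = 0 ∨ z = g b ∨ z = g b') →
          ‖z - (-ε⁻¹)‖ = ‖ε‖⁻¹ := by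
        intro ε hε hm z hz
        have : z - (-ε⁻¹) = ε⁻¹ * (1 + ε * z) := by field_simp; ring
        rw [this, norm_mul, norm_inv]
        rcases hz with rfl | rfl | rfl
        · simp
        · rw [hm, mul_one]
        · rw [hm, mul_one]
      have c₁ := hc δ hδ0 (hmod δ hδ)
      have c₂ := hc δ' hδ0' (hmod δ' hδ')
      have := center_unique (Ne.symm hb) (Ne.symm hb') hbb (c₁ 0 (by simp)) (c₁ _ (by simp))
        (c₁ _ (by simp)) (c₂ 0 (by simp)) (c₂ _ (by simp)) (c₂ _ (by simp))
      exact hne (inv_injective (neg_injective this))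
    refine ⟨fun _ => monomialMatrix π u, fun _ => hY, fun α γ h => ?_⟩
    obtain ⟨h1, h2⟩ := hred α γ h
    by_cases hz : ∃ b, g b ≠ 0
    · obtain ⟨b₀, hb₀⟩ := hz
      refine ⟨true, fun e => if e then α * (1 + γ / α * g b₀) else α, fun e => ?_, fun b b' => ?_⟩
      · cases e
        · simpa using hα α γ h
        · simp only [if_true]
          rw [norm_mul, hα α γ h, hmod _ h1, one_mul]
      · rw [h2]
        simp only [Matrix.smul_apply, Matrix.add_apply, smul_eq_mul, hE, decide_eq_true_eq]
        rw [hg]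
        split_ifs with hgb
        · rw [hgc b' b₀ hgb hb₀]; ring
        · push Not at hgb
          rw [hgb]; ring
    · push Not at hz
      refine ⟨true, fun _ => α, fun _ => hα α γ h, fun b b' => ?_⟩
      simp only [Matrix.smul_apply, Matrix.add_apply, smul_eq_mul, hg b b', hz]
      ring

end Unimodular

/-! ### At most four classes in a space in which any four elements are dependent. -/

section Classification

variable {B ι : Type*} [Fintype B] [DecidableEq B] {S : Submodule ℂ (Matrix B B ℂ)}
  {Y : ι → Matrix B B ℂ}

theorem isUnimodularMonomial_monomialMatrix {π : Equiv.Perm B} {u : B → ℂ} (hu : ∀ b, ‖u b‖ = 1) :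
    IsUnimodularMonomial (monomialMatrix π u) := ⟨π, u, hu, rfl⟩

theorem isUnimodularMonomial_one : IsUnimodularMonomial (1 : Matrix B B ℂ) :=
  ⟨1, fun _ => 1, by simp, by ext; simp only [Matrix.one_apply]; rfl⟩

open Classical in
/-- If the space of matrices contains a nonzero matrix `K` with a zero row, and the given unimodular
monomial matrices have different patterns in this row, then they fall into four classes, up to
phases on and off the columns of `K`. -/
theorem exists_four_classes_of_zero_row (hS : FourDependent (S : Set (Matrix B B ℂ)))
    (hY : ∀ i, IsUnimodularMonomial (Y i)) (hmem : ∀ i, Y i ∈ S) {r x₁ x₂ : B} {i₁ i₂ : ι}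
    (h₁ : Y i₁ r x₁ ≠ 0) (h₂ : Y i₂ r x₂ ≠ 0) (hx : x₁ ≠ x₂) {K : Matrix B B ℂ} (hKS : K ∈ S)
    (hK0 : K ≠ 0) (hK : ∀ x, K r x = 0) :
    ∃ V : Bool × Bool → Matrix B B ℂ, (∀ t, IsUnimodularMonomial (V t)) ∧
      ∀ i, ∃ (t : Bool × Bool) (x : Bool → ℂ), (∀ e, ‖x e‖ = 1) ∧
        ∀ b b', Y i b b' = V t b b' * x (decide (∃ z, K z b' ≠ 0)) := by
  obtain ⟨V₁, hV₁, hc₁⟩ := exists_two_classes (hY i₁) hK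
  obtain ⟨V₂, hV₂, hc₂⟩ := exists_two_classes (hY i₂) hK
  refine ⟨fun t => if t.1 then V₁ t.2 else V₂ t.2, fun t => ?_, fun i => ?_⟩
  · beta_reduce; split_ifs
    · exact hV₁ _
    · exact hV₂ _
  have h₁' := (hY i₁).eq_zero_of_row h₁ hx.symm
  have h₂' := (hY i₂).eq_zero_of_row h₂ hx
  obtain ⟨a, b, c, d, hne, h⟩ := hS _ (hmem i₁) _ (hmem i₂) _ hKS _ (hmem i)
  have ev : ∀ z x, a * Y i₁ z x + b * Y i₂ z x + c * K z x + d * Y i z x = 0 := fun z x => by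
    simpa using congrFun (congrFun h z) x
  have hd : d ≠ 0 := by
    rintro rfl
    have e₁ := ev r x₁
    have e₂ := ev r x₂
    simp only [hK, h₂', h₁', mul_zero, zero_mul, add_zero, zero_add, mul_eq_zero, h₁, h₂,
      or_false] at e₁ e₂
    subst e₁ e₂
    simp only [zero_smul, zero_add, add_zero, smul_eq_zero, hK0, or_false] at h
    exact hne ⟨rfl, rfl, h, rfl⟩
  have heq : ∀ z x, Y i z x = (-a / d) * Y i₁ z x + (-b / d) * Y i₂ z x + (-c / d) * K z x := by
    intro z x
    field_simp
    linear_combination ev z x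
  have e₁ := heq r x₁
  have e₂ := heq r x₂
  simp only [hK, h₂', h₁', mul_zero, zero_mul, add_zero, zero_add] at e₁ e₂
  -- `Y i` is a combination of `Y i₁`, `Y i₂` and `K`, but has only one nonzero entry in row `r`. So
  -- it lies in one of two planes through `K`, each with two classes.
  have hcase : a = 0 ∨ b = 0 := by
    by_contra! hab
    have n₁ : Y i r x₁ ≠ 0 := by
      rw [e₁]; exact mul_ne_zero (div_ne_zero (neg_ne_zero.mpr hab.1) hd) h₁
    have n₂ : Y i r x₂ ≠ 0 := by
      rw [e₂]; exact mul_ne_zero (div_ne_zero (neg_ne_zero.mpr hab.2) hd) h₂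
    exact n₂ ((hY i).eq_zero_of_row n₁ hx.symm)
  rcases hcase with rfl | rfl
  · have : Y i = (-b / d) • Y i₂ + (-c / d) • K := by
      ext z x; rw [heq]; simp
    obtain ⟨t, x, hx, h⟩ := hc₂ _ _ (this ▸ hY i)
    exact ⟨(false, t), x, hx, fun z z' => by rw [this, h]; rfl⟩
  · have : Y i = (-a / d) • Y i₁ + (-c / d) • K := by
      ext z x; rw [heq]; simp
    obtain ⟨t, x, hx, h⟩ := hc₁ _ _ (this ▸ hY i)
    exact ⟨(true, t), x, hx, fun z z' => by rw [this, h]; rfl⟩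

/-- Here an element of the space is determined by its row `r`. Two of the matrices with their
nonzero entry in the same place are proportional, and four different places would give four
independent matrices. -/
theorem exists_four_classes_of_injective_row (hS : FourDependent (S : Set (Matrix B B ℂ)))
    (hY : ∀ i, IsUnimodularMonomial (Y i)) (hmem : ∀ i, Y i ∈ S) {r : B}
    (hinj : ∀ K ∈ S, (∀ x, K r x = 0) → K = 0) :
    ∃ V : Bool × Bool → Matrix B B ℂ, (∀ t, IsUnimodularMonomial (V t)) ∧
      ∀ i, ∃ (t : Bool × Bool) (x : ℂ), ‖x‖ = 1 ∧ Y i = x • V t := by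
  classical
  choose f hf using fun i => (hY i).exists_ne_zero r
  have hprop : ∀ i j, f i = f j → ∃ x : ℂ, ‖x‖ = 1 ∧ Y i = x • Y j := by
    intro i j h
    have hj : Y j r (f i) ≠ 0 := h ▸ hf j
    refine ⟨Y i r (f i) / Y j r (f i), ?_, ?_⟩
    · rw [norm_div, (hY i).norm_eq_one (hf i), (hY j).norm_eq_one hj, div_one]
    · refine sub_eq_zero.mp (hinj _ (S.sub_mem (hmem i) (S.smul_mem _ (hmem j))) fun x => ?_)
      by_cases hx : x = f i
      · subst hx
        simp [hj]
      · simp [(hY i).eq_zero_of_row (hf i) hx, (hY j).eq_zero_of_row hj hx]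
  let X : Finset B := Finset.univ.filter fun x => ∃ i, f i = x
  have hX : X.card ≤ 3 := by
    by_contra! hc
    obtain ⟨Z, hZ, hZc⟩ := Finset.exists_subset_card_eq (Nat.succ_le_of_lt hc)
    let g := (Finset.equivFinOfCardEq hZc).symm
    have hg : ∀ k, ∃ i, f i = (g k : B) := fun k => by
      simpa [X] using hZ (g k).2
    choose i hi using hg
    have hz : ∀ k l, k ≠ l → Y (i k) r (f (i l)) = 0 := fun k l hkl =>
      (hY _).eq_zero_of_row (hf _) (by
        rw [hi, hi]
        exact fun h => hkl (g.injective (Subtype.ext h)).symm)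
    obtain ⟨a, b, c, d, hne, h⟩ := hS _ (hmem (i 0)) _ (hmem (i 1)) _ (hmem (i 2)) _ (hmem (i 3))
    have ev : ∀ x, a * Y (i 0) r x + b * Y (i 1) r x + c * Y (i 2) r x + d * Y (i 3) r x = 0 :=
      fun x => by simpa using congrFun (congrFun h r) x
    have e₀ := ev (f (i 0))
    have e₁ := ev (f (i 1))
    have e₂ := ev (f (i 2))
    have e₃ := ev (f (i 3))
    rw [hz 1 0 (by decide), hz 2 0 (by decide), hz 3 0 (by decide)] at e₀
    rw [hz 0 1 (by decide), hz 2 1 (by decide), hz 3 1 (by decide)] at e₁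
    rw [hz 0 2 (by decide), hz 1 2 (by decide), hz 3 2 (by decide)] at e₂
    rw [hz 0 3 (by decide), hz 1 3 (by decide), hz 2 3 (by decide)] at e₃
    simp only [mul_zero, add_zero, zero_add, mul_eq_zero, hf, or_false] at e₀ e₁ e₂ e₃
    exact hne ⟨e₀, e₁, e₂, e₃⟩
  obtain ⟨k⟩ : Nonempty (X ↪ Bool × Bool) :=
    Function.Embedding.nonempty_of_card_le (by simpa using hX.trans (by norm_num))
  have hfX : ∀ i, f i ∈ X := fun i => by simp [X]
  -- At most three labels are in use; the others receive the identity.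
  refine ⟨fun t => if h : ∃ i, k ⟨f i, hfX i⟩ = t then Y h.choose else 1, fun t => ?_,
    fun i => ⟨k ⟨f i, hfX i⟩, ?_⟩⟩
  · beta_reduce
    split_ifs with h
    · exact hY _
    · exact isUnimodularMonomial_one
  · have h : ∃ j, k ⟨f j, hfX j⟩ = k ⟨f i, hfX i⟩ := ⟨i, rfl⟩
    beta_reduce
    rw [dif_pos h]
    have := k.injective h.choose_spec
    exact hprop i _ (Subtype.ext_iff.mp this).symm

end Classification

/-! ### Three ebits for complex permutations that are not equivalent to diagonal ones. -/

section Implementation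

variable {A B : Type*} [Fintype A] [DecidableEq A] [Fintype B] [DecidableEq B]

theorem exists_hasProtocol_of_two_controls {U : Matrix (A × B) (A × B) ℂ} (t : A → Bool × Bool)
    (e : B → Bool) (V : Bool × Bool → Matrix B B ℂ) (W : Bool → Matrix A A ℂ)
    (hV : ∀ k, V k ∈ Matrix.unitaryGroup B ℂ) (hW : ∀ k, W k ∈ Matrix.unitaryGroup A ℂ)
    (hU : ∀ a b a' b', U (a, b) (a', b') = V (t a) b b' * W (e b') a a') :
    ∃ c, HasProtocol (ZMod 4 × ZMod 2) U c := by
  let f : Bool × Bool ≃ ZMod 4 := Fintype.equivOfCardEq (by simp)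
  let g : Bool ≃ ZMod 2 := Fintype.equivOfCardEq (by simp)
  exact ⟨_, hasProtocol_controlled_mul_controlled 4 2 (fun a => f (t a)) (fun b => g (e b))
    (fun k => V (f.symm k)) (fun k => W (g.symm k)) (fun k => hV _) (fun k => hW _)
    fun a b a' b' => by simp [hU]⟩

/-- Two different permutations `y i₁`, `y i₂` supply the row `r` in which the patterns differ. The
class of `Y i` becomes a four-valued control from `A`, and the remaining phases are absorbed into
the operator on `A` controlled by `E`. -/
theorem IsNormalForm.exists_hasProtocol {S : Submodule ℂ (Matrix B B ℂ)}
    (hS : FourDependent (S : Set (Matrix B B ℂ))) {U : Matrix (A × B) (A × B) ℂ} {C : B → Bool}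
    {σ : Bool → Equiv.Perm A} {y : A → Equiv.Perm B} {v : A → B → ℂ} (hn : IsNormalForm S U C σ y v)
    (hv : ∀ i b, ‖v i b‖ = 1) {i₁ i₂ : A} (hy : y i₁ ≠ y i₂) :
    ∃ c, HasProtocol (ZMod 4 × ZMod 2) U c := by
  classical
  obtain ⟨x₁, hx₁⟩ : ∃ x, y i₁ x ≠ y i₂ x := by
    by_contra! h
    exact hy (Equiv.ext h)
  set Y : A → Matrix B B ℂ := fun i => monomialMatrix (y i) (v i) with hYdef
  have hY : ∀ i, IsUnimodularMonomial (Y i) := fun i => isUnimodularMonomial_monomialMatrix (hv i)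
  have hv0 : ∀ i b, v i b ≠ 0 := fun i b h => by simpa [h] using hv i b
  have hYne : ∀ i b, Y i (y i b) b ≠ 0 := fun i b => by simp [hYdef, monomialMatrix, hv0]
  obtain ⟨r, hr⟩ : ∃ r, r = y i₁ x₁ := ⟨_, rfl⟩
  have h₁ : Y i₁ r x₁ ≠ 0 := hr ▸ hYne i₁ x₁
  have h₂ : Y i₂ r ((y i₂).symm r) ≠ 0 := by simpa using hYne i₂ ((y i₂).symm r)
  have hx : x₁ ≠ (y i₂).symm r := fun h => hx₁ (by rw [← hr, h]; simp)
  -- it is enough to find four classes, with phases depending on a bit that determines `C`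
  suffices H : ∃ (E : B → Bool) (V : Bool × Bool → Matrix B B ℂ) (s : Bool → Equiv.Perm A),
      (∀ b, s (E b) = σ (C b)) ∧ (∀ t, IsUnimodularMonomial (V t)) ∧
      ∀ i, ∃ (t : Bool × Bool) (x : Bool → ℂ), (∀ e, ‖x e‖ = 1) ∧
        ∀ b b', Y i b b' = V t b b' * x (E b') by
    obtain ⟨E, V, s, hs, hV, h⟩ := H
    choose t x hx h using h
    refine exists_hasProtocol_of_two_controls t E V
      (fun e => monomialMatrix (s e) fun j => x (s e j) e) (fun k => (hV k).mem_unitaryGroup)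
      (fun e => monomialMatrix_mem_unitaryGroup fun j => hx _ _) fun i b j b' => ?_
    rw [hn.eq, ← hs]
    simp only [monomialMatrix]
    split_ifs with hi h'
    · subst hi
      rw [← h]; simp [hYdef, monomialMatrix, h']
    · subst hi
      rw [← h]; simp [hYdef, monomialMatrix, h']
    · rw [mul_zero]
  by_cases hσ : σ true = σ false
  · have hσ' : ∀ e, σ e = σ false := fun e => by cases e <;> simp [hσ]
    by_cases hK : ∃ K ∈ S, K ≠ 0 ∧ ∀ x, K r x = 0
    · obtain ⟨K, hKS, hK0, hK⟩ := hK
      obtain ⟨V, hV, h⟩ := exists_four_classes_of_zero_row hS hY hn.mem h₁ h₂ hx hKS hK0 hK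
      exact ⟨_, V, fun _ => σ false, fun b => (hσ' _).symm, hV, h⟩
    · obtain ⟨V, hV, h⟩ := exists_four_classes_of_injective_row hS hY hn.mem (r := r) fun K h h' => by
        by_contra h0
        exact hK ⟨K, h, h0, h'⟩
      refine ⟨fun _ => false, V, fun _ => σ false, fun b => (hσ' _).symm, hV, fun i => ?_⟩
      obtain ⟨t, x, hx, h⟩ := h i
      exact ⟨t, fun _ => x, fun _ => hx, fun b b' => by rw [h]; simp [mul_comm]⟩
  · obtain ⟨i₀, hi₀⟩ : ∃ i, (σ true).symm i ≠ (σ false).symm i := by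
      by_contra! h
      exact hσ (Equiv.symm_bijective.injective (Equiv.ext h))
    have hsplit := (hn.split i₀).resolve_left hi₀
    have hC := hn.surj.resolve_left hσ
    -- The column class that misses the entry of `Y i₀` in row `r`: this column part has a zero row
    -- `r`, and its nonzero columns are exactly that class. Hence the bit carrying the phases also
    -- determines `C`.
    obtain ⟨ε, hε⟩ : ∃ ε, ε = !C ((y i₀).symm r) := ⟨_, rfl⟩
    have hcol : ∀ b', (∃ z, colPart C ε (Y i₀) z b' ≠ 0) ↔ C b' = ε := by
      intro b'
      constructor
      · rintro ⟨z, hz⟩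
        by_contra h
        exact hz (if_neg h)
      · intro h
        exact ⟨y i₀ b', by rw [colPart, if_pos h]; exact hYne i₀ b'⟩
    have hK0 : colPart C ε (Y i₀) ≠ 0 := by
      obtain ⟨b, hb⟩ := hC ε
      obtain ⟨z, hz⟩ := (hcol b).mpr hb
      exact fun h => hz (by rw [h]; rfl)
    have hK : ∀ x, colPart C ε (Y i₀) r x = 0 := by
      intro x
      simp only [colPart, hYdef, monomialMatrix, ← Equiv.symm_apply_eq]
      split_ifs with h h'
      · rw [hε, h'] at h
        simp at h
      · rfl
      · rfl
    obtain ⟨V, hV, h⟩ := exists_four_classes_of_zero_row hS hY hn.mem h₁ h₂ hx (hsplit ε) hK0 hK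
    refine ⟨_, V, fun e => σ (if e then ε else !ε), fun b => ?_, hV, h⟩
    beta_reduce
    by_cases h : C b = ε
    · rw [decide_eq_true ((hcol b).mpr h), if_pos rfl, h]
    · rw [decide_eq_false (mt (hcol b).mp h), if_neg Bool.false_ne_true, Bool.eq_not.mpr h]

theorem localPermEquiv_submatrix (U : Matrix (A × B) (A × B) ℂ) (p p' : Equiv.Perm A)
    (q q' : Equiv.Perm B) : LocalPermEquiv U (U.submatrix (Prod.map p q) (Prod.map p' q')) := by
  refine ⟨monomialMatrix p⁻¹ 1, monomialMatrix p' 1, monomialMatrix q⁻¹ 1, monomialMatrix q' 1,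
    isPermUnitary_monomialMatrix_one _, isPermUnitary_monomialMatrix_one _,
    isPermUnitary_monomialMatrix_one _, isPermUnitary_monomialMatrix_one _, ?_⟩
  ext ⟨a, b⟩ ⟨a', b'⟩
  have h₁ : ∀ x : A × B, (monomialMatrix p⁻¹ 1 ⊗ₖ monomialMatrix q⁻¹ 1) (a, b) x =
      if x = (p a, q b) then (1 : ℂ) else 0 := by
    rintro ⟨x, z⟩
    simp only [Matrix.kroneckerMap_apply, monomialMatrix, Equiv.Perm.inv_def, Equiv.eq_symm_apply,
      Pi.one_apply, Prod.mk.injEq, eq_comm (a := x), eq_comm (a := z), ite_mul_ite, mul_one,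
      ite_and]
    split_ifs <;> simp_all
  have h₂ : ∀ x : A × B, (monomialMatrix p' 1 ⊗ₖ monomialMatrix q' 1) x (a', b') =
      if x = (p' a', q' b') then (1 : ℂ) else 0 := by
    rintro ⟨x, z⟩
    simp only [Matrix.kroneckerMap_apply, monomialMatrix, Pi.one_apply, Prod.mk.injEq, ite_and]
    split_ifs <;> simp_all
  simp only [Matrix.mul_apply (M := _ * _), Matrix.mul_apply (M := _ ⊗ₖ _), h₁, h₂]
  simp

/-- The permutation of the exchanged systems. -/
def swapPerm (π : Equiv.Perm (A × B)) : Equiv.Perm (B × A) :=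
  (Equiv.prodComm B A).trans (π.trans (Equiv.prodComm A B))

theorem swapParties_monomialMatrix (π : Equiv.Perm (A × B)) (u : A × B → ℂ) :
    swapParties (monomialMatrix π u) = monomialMatrix (swapPerm π) (fun x => u x.swap) := by
  ext ⟨b, a⟩ ⟨b', a'⟩
  simp [swapParties, monomialMatrix, swapPerm, Prod.ext_iff, and_comm]

theorem swapParties_swapParties (U : Matrix (A × B) (A × B) ℂ) :
    swapParties (swapParties U) = U := by
  ext ⟨a, b⟩ ⟨a', b'⟩; rfl

theorem HasSchmidtRank.swapParties {U : Matrix (A × B) (A × B) ℂ} {r : ℕ}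
    (h : HasSchmidtRank U r) : HasSchmidtRank (swapParties U) r := by
  obtain ⟨P, Q, hP, hQ, rfl⟩ := h
  refine ⟨Q, P, hQ, hP, ?_⟩
  ext ⟨b, a⟩ ⟨b', a'⟩
  simp [_root_.swapParties, Matrix.sum_apply, mul_comm]

theorem block_sum_kronecker_mem {r : ℕ} (P : Fin r → Matrix A A ℂ) (Q : Fin r → Matrix B B ℂ)
    (i j : A) : block (∑ k, P k ⊗ₖ Q k) i j ∈ Submodule.span ℂ (Set.range Q) := by
  have : block (∑ k, P k ⊗ₖ Q k) i j = ∑ k, P k i j • Q k := by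
    ext b b'
    simp [block, Matrix.sum_apply]
  rw [this]
  exact Submodule.sum_mem _ fun k _ => Submodule.smul_mem _ _ (Submodule.subset_span ⟨k, rfl⟩)

theorem nonempty_of_linearIndependent {P : Fin 3 → Matrix A A ℂ} (hP : LinearIndependent ℂ P) :
    Nonempty A := by
  by_contra h
  rw [not_nonempty_iff] at h
  exact hP.ne_zero 0 (Subsingleton.elim _ _)

/-- If the second component of the row permutation does not depend on the first component, then,
after exchanging the parties, the operator is a controlled operator up to a local permutation. -/
theorem exists_isNormalForm_swapParties [Nonempty A] {π : Equiv.Perm (A × B)} {u : A × B → ℂ}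
    (S : Submodule ℂ (Matrix A A ℂ)) (hblk : ∀ i j, block (swapParties (monomialMatrix π u)) i j ∈ S)
    (hpat : ∀ i i' b, (π.symm (i, b)).2 = (π.symm (i', b)).2) :
    ∃ (C : A → Bool) (σ : Bool → Equiv.Perm B) (y : B → Equiv.Perm A), σ true = σ false ∧
      IsNormalForm S (swapParties (monomialMatrix π u)) C σ y
        fun i b' => u (b', (σ (C b')).symm i) := by
  have hpat' : ∀ j i i', (π (i, j)).2 = (π (i', j)).2 := by
    have hsurj : Function.Surjective fun b => (π.symm (Classical.arbitrary A, b)).2 := fun j => by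
      refine ⟨(π (Classical.arbitrary A, j)).2, ?_⟩
      beta_reduce
      rw [hpat _ (π (Classical.arbitrary A, j)).1]
      simp
    have hinj := Finite.injective_iff_surjective.mpr hsurj
    intro j i i'
    apply hinj
    beta_reduce
    rw [hpat _ (π (i, j)).1, hpat _ (π (i', j)).1 (π (i', j)).2]
    simp
  rw [swapParties_monomialMatrix] at hblk ⊢
  -- No row or column splits, so any partition will do. The empty one makes `C` constant and forces
  -- `σ true = σ false`.
  obtain ⟨C, σ, y, hC, hn⟩ := exists_isNormalForm_of_partitions (R := ∅) (T := ∅) S hblk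
    (fun i => Or.inl fun b b' => hpat b b' i) (fun j => Or.inl fun b b' => hpat' j b b')
    (fun i b => ⟨fun _ x x' => hpat' _ x x', fun _ x x' => hpat x x' i⟩)
    (fun i b h => absurd (fun b b' => hpat b b' i) h)
  refine ⟨C, σ, y, hn.surj.resolve_right fun hs => ?_, hn⟩
  obtain ⟨b, hb⟩ := hs true
  exact (hC b).mp hb

/-- If all `y i` agree in the constant-pattern case, local permutations make `U` diagonal; in the
other case equal `y i` would make the pattern constant. So two different ones exist. -/
theorem exists_hasProtocol_of_not_diagonal {U : Matrix (A × B) (A × B) ℂ}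
    (hrank : HasSchmidtRank U 3) (hU : IsComplexPermUnitary U)
    (hdiag : ¬ ∃ D : Matrix (A × B) (A × B) ℂ, D.IsDiag ∧ LocalPermEquiv U D) :
    ∃ c, HasProtocol (ZMod 4 × ZMod 2) U c := by
  obtain ⟨π, u, hu, rfl⟩ := hU.exists_eq_monomialMatrix
  obtain ⟨P, Q, hP, hQ, hPQ⟩ := id hrank
  have := nonempty_of_linearIndependent hP
  have := nonempty_of_linearIndependent hQ
  have hu0 : ∀ x, u x ≠ 0 := fun x h => by simpa [h] using hu x
  by_cases hpat : ∀ i i' b, (π.symm (i, b)).2 = (π.symm (i', b)).2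
  · obtain ⟨P', Q', hP', hQ', hPQ'⟩ := hrank.swapParties
    obtain ⟨C, σ, y, hσ, hn⟩ := exists_isNormalForm_swapParties
      (Submodule.span ℂ (Set.range Q')) (π := π) (u := u)
      (fun i j => by rw [hPQ']; exact block_sum_kronecker_mem P' Q' i j) hpat
    by_cases hy : ∃ i₁ i₂, y i₁ ≠ y i₂
    · obtain ⟨i₁, i₂, hy⟩ := hy
      obtain ⟨c, hc⟩ := hn.exists_hasProtocol (fourDependent_span Q') (fun i b => hu _) hy
      exact ⟨c, by simpa only [swapParties_swapParties] using hc.swapParties⟩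
    · push Not at hy
      exfalso
      refine hdiag ⟨_, ?_, localPermEquiv_submatrix _ (y (Classical.arbitrary B)) 1 (σ false) 1⟩
      rintro ⟨a, b⟩ ⟨a', b'⟩ hne
      have h := hn.eq (σ false b) (y (Classical.arbitrary B) a) b' a'
      have hσ' : ∀ e, σ e = σ false := fun e => by cases e <;> simp [hσ]
      simp only [swapParties, Matrix.submatrix_apply, Prod.swap_prod_mk, hσ',
        EmbeddingLike.apply_eq_iff_eq] at h
      simp only [Matrix.submatrix_apply, Prod.map_apply, Equiv.Perm.coe_one, id_eq]
      rw [h]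
      split_ifs with hb
      · rw [monomialMatrix, hy (σ false b) (Classical.arbitrary B)]
        apply if_neg
        intro ha
        exact hne (Prod.ext ((y _).injective ha) hb)
      · rfl
  · obtain ⟨C, σ, y, hn⟩ := (pattern_const_or_exists_isNormalForm (Q := Q) hu0
      (fun i j => by rw [hPQ]; exact block_sum_kronecker_mem P Q i j)).resolve_left hpat
    suffices hy : ∃ i₁ i₂, y i₁ ≠ y i₂ by
      obtain ⟨i₁, i₂, hy⟩ := hy
      exact hn.exists_hasProtocol (fourDependent_span Q) (fun i b => hu _) hy
    by_contra! hy
    apply hpat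
    have key : ∀ i b, b = y i (π.symm (i, b)).2 := by
      intro i b
      have h := hn.eq i b (π.symm (i, b)).1 (π.symm (i, b)).2
      by_contra hne
      simp [monomialMatrix, hne, hu0] at h
    intro i i' b
    apply (y i).injective
    rw [← key, hy i i', ← key]

end Implementation

/-! ### Two ebits for diagonal unitaries with an identity and a two-valued block. -/

section Diagonal

variable {A B : Type*} [Fintype A] [DecidableEq A] [Fintype B] [DecidableEq B]

theorem star_mul_self_of_norm_eq_one {z : ℂ} (h : ‖z‖ = 1) : star z * z = 1 := by
  rw [Complex.star_def, ← Complex.normSq_eq_conj_mul_self, Complex.normSq_eq_norm_sq, h]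
  simp

/-- Phases that are affine in one function of the second party either depend on a bit of the second
party only, or factor into a local phase and one out of two phases of the second party. -/
theorem exists_form_of_affine {u : A → B → ℂ} (hu : ∀ a b, ‖u a b‖ = 1) {p : B → Prop} {w z : A → ℂ}
    {f : B → ℂ} (h : ∀ a b, p b → u a b = w a + z a * f b) :
    ∃ (μ : Bool) (φ : A → ℂ) (s : A → Bool) (ψ : Bool → B → ℂ) (χ : Bool → A → ℂ) (v : B → Bool),
      (∀ a, ‖φ a‖ = 1) ∧ (∀ k b, ‖ψ k b‖ = 1) ∧ (∀ k a, ‖χ k a‖ = 1) ∧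
      ∀ a b, p b → u a b = if μ then φ a * ψ (s a) b else χ (v b) a := by
  classical
  by_cases hp : ∃ b, p b
  swap
  · exact ⟨true, fun _ => 1, fun _ => true, fun _ _ => 1, fun _ _ => 1, fun _ => true,
      by simp, by simp, by simp, fun a b hb => absurd ⟨b, hb⟩ hp⟩
  obtain ⟨b₀, hb₀⟩ := hp
  have hu0 : ∀ a b, u a b ≠ 0 := fun a b h0 => by simpa [h0] using hu a b
  have hff : ∀ a b b', p b → p b' → f b = f b' → u a b = u a b' := fun a b b' hb hb' hf => by
    rw [h a b hb, h a b' hb', hf]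
  by_cases hthree : ∃ b₁ b₂, p b₁ ∧ p b₂ ∧ f b₀ ≠ f b₁ ∧ f b₀ ≠ f b₂ ∧ f b₁ ≠ f b₂
  · obtain ⟨b₁, b₂, hb₁, hb₂, h01, h02, h12⟩ := hthree
    -- Unimodularity puts the values of `f` on the circle with centre `-(w a / z a)`. Three values
    -- determine it, so `w a / z a` is the same for all `a` with `z a ≠ 0`, and these rows are
    -- proportional on the class.
    have hcirc : ∀ a, z a ≠ 0 → ∀ b, p b → ‖f b - (-(w a / z a))‖ = ‖z a‖⁻¹ := by
      intro a ha b hb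
      have : f b - (-(w a / z a)) = (z a)⁻¹ * u a b := by
        rw [h a b hb]; field_simp; ring
      rw [this, norm_mul, hu, norm_inv, mul_one]
    have hc : ∀ a a', z a ≠ 0 → z a' ≠ 0 → w a / z a = w a' / z a' := fun a a' ha ha' =>
      neg_injective (center_unique h01 h02 h12 (hcirc a ha b₀ hb₀) (hcirc a ha b₁ hb₁)
        (hcirc a ha b₂ hb₂) (hcirc a' ha' b₀ hb₀) (hcirc a' ha' b₁ hb₁) (hcirc a' ha' b₂ hb₂))
    obtain ⟨ψ, hψ, hψ'⟩ : ∃ ψ : B → ℂ, (∀ b, ‖ψ b‖ = 1) ∧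
        ∀ a, z a ≠ 0 → ∀ b, p b → u a b = u a b₀ * ψ b := by
      by_cases hz : ∃ a, z a ≠ 0
      · obtain ⟨a₁, ha₁⟩ := hz
        refine ⟨fun b => u a₁ b / u a₁ b₀, fun b => by rw [norm_div, hu, hu, div_one], ?_⟩
        intro a ha b hb
        have e : ∀ a, z a ≠ 0 → ∀ b, p b → u a b = z a * (w a₁ / z a₁ + f b) := by
          intro a ha b hb
          rw [← hc a a₁ ha ha₁, h a b hb]; field_simp
        have hne := hu0 a₁ b₀
        rw [mul_div_assoc', eq_div_iff hne, e a ha b hb, e a ha b₀ hb₀, e a₁ ha₁ b hb,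
          e a₁ ha₁ b₀ hb₀]
        ring
      · exact ⟨fun _ => 1, by simp, fun a ha => absurd ⟨a, ha⟩ hz⟩
    refine ⟨true, fun a => u a b₀, fun a => decide (z a = 0), fun k b => if k then 1 else ψ b,
      fun _ _ => 1, fun _ => true, fun a => hu _ _, fun k b => by cases k <;> simp [hψ], by simp,
      fun a b hb => ?_⟩
    by_cases ha : z a = 0
    · simp only [ha, decide_true, if_true, mul_one]
      rw [h a b hb, h a b₀ hb₀, ha, zero_mul, zero_mul]
    · simpa [ha] using hψ' a ha b hb
  · push Not at hthree
    -- With at most two values of `f` on the class, the phase depends on `b` only through the bit `f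
    -- b₀ = f b`.
    refine ⟨false, fun _ => 1, fun _ => true, fun _ _ => 1,
      fun k a => if k then u a b₀ else
        if hb : ∃ b, p b ∧ f b₀ ≠ f b then u a hb.choose else 1,
      fun b => decide (f b₀ = f b), by simp, by simp, fun k a => ?_, fun a b hb => ?_⟩
    · dsimp only
      split_ifs <;> simp [hu]
    · by_cases hf : f b₀ = f b
      · simpa [hf] using hff a b b₀ hb hb₀ hf.symm
      · have hex : ∃ b, p b ∧ f b₀ ≠ f b := ⟨b, hb, hf⟩
        have hs := hex.choose_spec
        simp only [hf, decide_false, Bool.false_eq_true, if_false]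
        rw [dif_pos hex]
        exact hff a _ _ hb hs.1 (hthree _ _ hb hs.1 hf hs.2)

/-- In a set of functions, any four of which are dependent, that contains the indicator functions of
a set and of its complement, all functions are affine in one of them on both parts. -/
theorem exists_affine_of_fourDependent {S : Submodule ℂ (B → ℂ)} (hS : FourDependent (S : Set (B → ℂ)))
    {u : A → B → ℂ} (hu : ∀ a, u a ∈ S) {e : B → Bool} (he : Function.Surjective e)
    (hind : ∀ ε, (fun b => if e b = ε then (1 : ℂ) else 0) ∈ S) :
    ∃ (w : Bool → A → ℂ) (z : A → ℂ) (f : B → ℂ), ∀ a b, u a b = w (e b) a + z a * f b := by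
  -- A row that is not constant on both classes is independent of the two indicators, and with them
  -- spans every row. If there is no such row, `z = 0` works.
  by_cases hf : ∃ a, ∀ w : Bool → ℂ, ∃ b, u a b ≠ w (e b)
  · obtain ⟨a₂, ha₂⟩ := hf
    have key : ∀ a, ∃ (w : Bool → ℂ) (z : ℂ), ∀ b, u a b = w (e b) + z * u a₂ b := by
      intro a
      obtain ⟨p, q, r, s, hne, h⟩ := hS _ (hind true) _ (hind false) _ (hu a₂) _ (hu a)
      have ev : ∀ b, (if e b then p else q) + r * u a₂ b + s * u a b = 0 := fun b => by
        have := congrFun h b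
        simp only [Pi.add_apply, Pi.smul_apply, smul_eq_mul, Pi.zero_apply, mul_ite, mul_one,
          mul_zero] at this
        rw [← this]
        cases e b <;> simp
      have hs : s ≠ 0 := by
        rintro rfl
        have hr : r = 0 := by
          by_contra hr
          obtain ⟨b, hb⟩ := ha₂ fun ε => -(if ε then p else q) / r
          apply hb
          rw [eq_div_iff hr]
          linear_combination ev b
        obtain ⟨b₁, hb₁⟩ := he true
        obtain ⟨b₂, hb₂⟩ := he false
        have e₁ := ev b₁
        have e₂ := ev b₂
        simp [hb₁, hr] at e₁
        simp [hb₂, hr] at e₂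
        exact hne ⟨e₁, e₂, hr, rfl⟩
      refine ⟨fun ε => -(if ε then p else q) / s, -r / s, fun b => ?_⟩
      field_simp
      linear_combination ev b
    choose w z h using key
    exact ⟨fun ε a => w a ε, z, u a₂, h⟩
  · push Not at hf
    choose w hw using hf
    exact ⟨fun ε a => w a ε, 0, 0, fun a b => by simp [hw]⟩

theorem exists_hasProtocol_of_diagonal {U : Matrix (A × B) (A × B) ℂ}
    (hrank : HasSchmidtRank U 3) (hU : IsComplexPermUnitary U) (hdiag : U.IsDiag)
    (hone : ∃ a, diagBlock U a = 1)
    (htwo : ∃ a, (Set.range fun b => diagBlock U a b b).ncard = 2) :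
    ∃ c, HasProtocol (Bool × Bool) U c := by
  classical
  obtain ⟨P, Q, hP, hQ, hPQ⟩ := hrank
  have hnorm : ∀ x, ‖U x x‖ = 1 := by
    intro x
    have h := sum_norm_sq_of_mem_unitaryGroup hU.1 x
    rw [Finset.sum_eq_single x (fun y _ hy => by simp [hdiag hy]) (by simp)] at h
    exact (pow_eq_one_iff_of_nonneg (norm_nonneg _) two_ne_zero).mp h
  set u : A → B → ℂ := fun a b => U (a, b) (a, b) with hudef
  have hu : ∀ a b, ‖u a b‖ = 1 := fun a b => hnorm _
  set S := Submodule.span ℂ (Set.range fun k b => Q k b b) with hSdef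
  have hS : FourDependent (S : Set (B → ℂ)) := fourDependent_span _
  have hmem : ∀ a, u a ∈ S := by
    intro a
    have : u a = ∑ k, P k a a • fun b => Q k b b := by
      ext b
      simp [hudef, hPQ, Matrix.sum_apply, Finset.sum_apply]
    rw [this]
    exact Submodule.sum_mem _ fun k _ => Submodule.smul_mem _ _ (Submodule.subset_span ⟨k, rfl⟩)
  obtain ⟨a₀, ha₀⟩ := hone
  obtain ⟨a₁, ha₁⟩ := htwo
  obtain ⟨p, q, hpq, hrange⟩ := Set.ncard_eq_two.mp ha₁
  change (Set.range (u a₁)) = _ at hrange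
  have hu₀ : ∀ b, u a₀ b = 1 := fun b => by
    have := congrFun (congrFun ha₀ b) b
    simpa [diagBlock] using this
  have hval : ∀ b, u a₁ b = p ∨ u a₁ b = q := fun b => by
    have : u a₁ b ∈ Set.range (u a₁) := ⟨b, rfl⟩
    rwa [hrange] at this
  obtain ⟨bp, hbp⟩ : p ∈ Set.range (u a₁) := by rw [hrange]; simp
  obtain ⟨bq, hbq⟩ : q ∈ Set.range (u a₁) := by rw [hrange]; simp
  let e : B → Bool := fun b => decide (u a₁ b = p)
  have he : Function.Surjective e := by
    rintro (_ | _)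
    · exact ⟨bq, by simp [e, hbq, hpq.symm]⟩
    · exact ⟨bp, by simp [e, hbp]⟩
  have hsub : p - q ≠ 0 := sub_ne_zero.mpr hpq
  -- The constant function `1` and a function with values `p ≠ q` span the indicators of the two
  -- level sets.
  have hind : ∀ ε, (fun b => if e b = ε then (1 : ℂ) else 0) ∈ S := by
    rintro (_ | _)
    · have : (fun b => if e b = false then (1 : ℂ) else 0) =
          (p / (p - q)) • u a₀ - (1 / (p - q)) • u a₁ := by
        ext b
        rcases hval b with h | h <;> simp [e, h, hu₀, hpq.symm] <;> field_simp <;> ring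
      rw [this]
      exact S.sub_mem (S.smul_mem _ (hmem _)) (S.smul_mem _ (hmem _))
    · have : (fun b => if e b = true then (1 : ℂ) else 0) =
          (1 / (p - q)) • u a₁ - (q / (p - q)) • u a₀ := by
        ext b
        rcases hval b with h | h <;> simp [e, h, hu₀, hpq.symm] <;> field_simp <;> ring
      rw [this]
      exact S.sub_mem (S.smul_mem _ (hmem _)) (S.smul_mem _ (hmem _))
  obtain ⟨w, z, f, hf⟩ := exists_affine_of_fourDependent hS hmem he hind
  choose μ φ s ψ χ v hφ hψ hχ h using fun ε => exists_form_of_affine hu (p := fun b => e b = ε)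
    (w := w ε) (z := z) (f := f) fun a b hb => by rw [hf, hb]
  refine hasProtocol_adaptive_diagonal e μ φ s (fun k b => ψ (e b) k b) χ (fun b => v (e b) b)
    (fun _ _ => star_mul_self_of_norm_eq_one (hφ _ _))
    (fun _ _ => star_mul_self_of_norm_eq_one (hψ _ _ _))
    (fun _ _ _ => star_mul_self_of_norm_eq_one (hχ _ _ _)) fun a b a' b' => ?_
  split_ifs with h1 h2
  · obtain ⟨rfl, rfl⟩ := h1
    have := h (e b) a b rfl
    rwa [if_pos h2] at this
  · obtain ⟨rfl, rfl⟩ := h1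
    have := h (e b) a b rfl
    rwa [if_neg h2] at this
  · exact hdiag fun h0 => h1 (Prod.mk.inj h0)

end Diagonal

/-! ### Counting the permutation matrices in the space. -/

section Permutations

variable {A B : Type*} [Fintype A] [DecidableEq A] [Fintype B] [DecidableEq B]

theorem isControlledPermFromFirst_of {κ : Type*} [Fintype κ] {k : ℕ}
    (hk : Fintype.card κ = k) {t : A → κ} (ht : Function.Surjective t) (V : κ → Equiv.Perm B)
    {U : Matrix (A × B) (A × B) ℂ} (hU : ∀ a b a' b', U (a, b) (a', b') =
      if a = a' then monomialMatrix (V (t a)) 1 b b' else 0) :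
    IsControlledPermFromFirst k U := by
  classical
  let f : κ ≃ Fin k := Fintype.equivFinOfCardEq hk
  have hdiag : ∀ j, (Matrix.diagonal fun a => if f (t a) = j then (1 : ℂ) else 0).IsDiag :=
    fun j => Matrix.isDiag_diagonal _
  refine ⟨fun j => Matrix.diagonal fun a => if f (t a) = j then (1 : ℂ) else 0,
    fun j => monomialMatrix (V (f.symm j)) 1, fun j h => ?_, hdiag, fun i j => ?_, ?_,
    fun j => isPermUnitary_monomialMatrix_one _, ?_⟩
  · obtain ⟨a, ha⟩ := ht (f.symm j)
    have := congrFun (congrFun h a) a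
    simp [ha] at this
  · rw [Matrix.diagonal_mul_diagonal]
    split_ifs with h
    · subst h
      congr 1
      ext a
      simp
    · rw [← Matrix.diagonal_zero]
      congr 1
      ext a
      by_cases h1 : f (t a) = i <;> simp [h1, h]
  · ext a a'
    rw [Matrix.sum_apply]
    by_cases h : a = a'
    · subst h; simp
    · simp [h]
  · ext ⟨a, b⟩ ⟨a', b'⟩
    rw [hU, Matrix.sum_apply]
    by_cases h : a = a'
    · subst h
      simp
    · simp [h]

theorem swapParties_kronecker (P : Matrix A A ℂ) (Q : Matrix B B ℂ) :
    swapParties (P ⊗ₖ Q) = Q ⊗ₖ P := by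
  ext ⟨b, a⟩ ⟨b', a'⟩
  simp [swapParties, mul_comm]

theorem swapParties_mul (U V : Matrix (A × B) (A × B) ℂ) :
    swapParties (U * V) = swapParties U * swapParties V :=
  (Matrix.submatrix_mul_equiv U V Prod.swap (Equiv.prodComm B A) Prod.swap).symm

theorem LocalPermEquiv.swapParties {U V : Matrix (A × B) (A × B) ℂ} (h : LocalPermEquiv U V) :
    LocalPermEquiv (swapParties U) (swapParties V) := by
  obtain ⟨P, P', Q, Q', hP, hP', hQ, hQ', rfl⟩ := h
  exact ⟨Q, Q', P, P', hQ, hQ', hP, hP', by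
    simp only [swapParties_mul, swapParties_kronecker]⟩

/-- The blocks of an operator span the space of the second factors of its Schmidt decomposition. -/
theorem mem_of_blocks_mem {r : ℕ} {P : Fin r → Matrix A A ℂ} {Q : Fin r → Matrix B B ℂ}
    (hP : LinearIndependent ℂ P) {T : Submodule ℂ (Matrix B B ℂ)}
    (h : ∀ i j, block (∑ k, P k ⊗ₖ Q k) i j ∈ T) (k : Fin r) : Q k ∈ T := by
  by_contra hk
  obtain ⟨f, hf, hT⟩ := Submodule.exists_le_ker_of_notMem hk
  refine hf ((Fintype.linearIndependent_iff.mp hP) (fun k => f (Q k)) ?_ k)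
  ext i j
  have := hT (h i j)
  have e : block (∑ k, P k ⊗ₖ Q k) i j = ∑ k, P k i j • Q k := by
    ext b b'
    simp [block, Matrix.sum_apply]
  rw [LinearMap.mem_ker, e, map_sum] at this
  simpa [Matrix.sum_apply, mul_comm] using this

/-- This is where Schmidt rank exactly three is needed: it excludes fewer than three controlled
terms. -/
theorem not_blocks_mem_span_pair {P : Fin 3 → Matrix A A ℂ} {Q : Fin 3 → Matrix B B ℂ}
    (hP : LinearIndependent ℂ P) (hQ : LinearIndependent ℂ Q) (M N : Matrix B B ℂ) :
    ¬ ∀ i j, block (∑ k, P k ⊗ₖ Q k) i j ∈ Submodule.span ℂ {M, N} := by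
  classical
  intro h
  have hsub : Submodule.span ℂ (Set.range Q) ≤ Submodule.span ℂ ({M, N} : Finset (Matrix B B ℂ)) := by
    rw [Submodule.span_le]
    rintro _ ⟨k, rfl⟩
    simpa using mem_of_blocks_mem hP h k
  have h1 := Submodule.finrank_mono hsub
  rw [finrank_span_eq_card hQ] at h1
  have h2 := finrank_span_finset_le_card (R := ℂ) ({M, N} : Finset (Matrix B B ℂ))
  have h3 := Finset.card_le_two (a := M) (b := N)
  rw [Set.finrank] at h2
  simp only [Fintype.card_fin] at h1
  omega

theorem monomialMatrix_one_injective :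
    Function.Injective fun π : Equiv.Perm B => monomialMatrix π 1 := by
  intro π π' h
  ext b
  have := congrFun (congrFun h (π b)) b
  simp only [monomialMatrix, if_true, Pi.one_apply] at this
  by_contra hne
  rw [if_neg hne] at this
  exact one_ne_zero this

theorem sum_row_monomialMatrix_one (π : Equiv.Perm B) (b : B) :
    ∑ b', monomialMatrix π 1 b b' = 1 := by
  simp [monomialMatrix, ← Equiv.symm_apply_eq]

/-- Permutation matrices in an at most three-dimensional space are distinguished by two of their
entries. -/
theorem exists_two_bits {S : Submodule ℂ (Matrix B B ℂ)} (hS : FourDependent (S : Set (Matrix B B ℂ)))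
    [Nonempty B] {ι : Type*} {y : ι → Equiv.Perm B} (hy : ∀ i, monomialMatrix (y i) 1 ∈ S) :
    ∃ g : Equiv.Perm B → Bool × Bool, ∀ i j, g (y i) = g (y j) → y i = y j := by
  have hbit : ∀ (π π' : Equiv.Perm B), π ≠ π' → ∃ b, π b ≠ π' b := fun π π' h => by
    by_contra! h'
    exact h (Equiv.ext h')
  by_cases h1 : ∀ i j, y i = y j
  · exact ⟨fun _ => default, fun i j _ => h1 i j⟩
  push Not at h1
  obtain ⟨i₁, i₂, h12⟩ := h1
  obtain ⟨p, hp⟩ := hbit _ _ h12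
  by_cases h2 : ∀ i j, (y i p = y i₁ p ↔ y j p = y i₁ p) → y i = y j
  · exact ⟨fun π => (decide (π p = y i₁ p), true), fun i j h => h2 i j (by simpa using h)⟩
  push Not at h2
  obtain ⟨i₃, i₄, h34, h34'⟩ := h2
  obtain ⟨q, hq⟩ := hbit _ _ h34'
  refine ⟨fun π => (decide (π p = y i₁ p), decide (π q = y i₃ q)), fun i j h => ?_⟩
  simp only [Prod.mk.injEq, decide_eq_decide] at h
  -- Row sums separate `y i₁` from the three differences. The entries at `p` and `q` then separate
  -- the first two differences from each other and from the third, on which both vanish. The third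
  -- difference must be zero.
  obtain ⟨a, b, c, d, hne, h0⟩ := hS _ (S.sub_mem (hy i₁) (hy i₂)) _ (S.sub_mem (hy i₃) (hy i₄)) _
    (S.sub_mem (hy i) (hy j)) _ (hy i₁)
  have ev : ∀ x z, a * (monomialMatrix (y i₁) 1 x z - monomialMatrix (y i₂) 1 x z) +
      b * (monomialMatrix (y i₃) 1 x z - monomialMatrix (y i₄) 1 x z) +
      c * (monomialMatrix (y i) 1 x z - monomialMatrix (y j) 1 x z) +
      d * monomialMatrix (y i₁) 1 x z = 0 := fun x z => by
    simpa using congrFun (congrFun h0 x) z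
  have hd : d = 0 := by
    have := Finset.sum_congr rfl fun z (_ : z ∈ Finset.univ) => ev (Classical.arbitrary B) z
    simpa [Finset.sum_add_distrib, ← Finset.mul_sum, Finset.sum_sub_distrib,
      sum_row_monomialMatrix_one] using this
  subst hd
  have ha : a = 0 := by
    have := ev (y i₁ p) p
    simpa [monomialMatrix, hp, eq_comm (a := y i₁ p), h34, h.1, Ne.symm hp] using this
  subst ha
  have hb : b = 0 := by
    have := ev (y i₃ q) q
    simpa [monomialMatrix, hq, eq_comm (a := y i₃ q), h.2, Ne.symm hq] using this
  subst hb
  have hc : c ≠ 0 := fun hc => hne ⟨rfl, rfl, hc, rfl⟩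
  apply monomialMatrix_one_injective
  ext x z
  have := ev x z
  simp only [zero_mul, zero_add, add_zero, mul_eq_zero, hc, false_or] at this
  exact sub_eq_zero.mp this

theorem IsControlledPerm.swapParties {k : ℕ} {U : Matrix (A × B) (A × B) ℂ}
    (h : IsControlledPerm k U) : IsControlledPerm k (swapParties U) := by
  rwa [IsControlledPerm, swapParties_swapParties, or_comm]

theorem logb_two_four : Real.logb 2 4 = 2 := by
  rw [show (4 : ℝ) = 2 ^ (2 : ℝ) by norm_num]
  exact Real.logb_rpow (by norm_num) (by norm_num)

theorem four_controls_implementation {U : Matrix (A × B) (A × B) ℂ} (t : A → Bool × Bool)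
    (V : Bool × Bool → Matrix B B ℂ) (W : Matrix A A ℂ)
    (hV : ∀ k, V k ∈ Matrix.unitaryGroup B ℂ) (hW : W ∈ Matrix.unitaryGroup A ℂ)
    (hU : ∀ a b a' b', U (a, b) (a', b') = V (t a) b b' * W a a') :
    HasProtocol (ZMod 4 × ZMod 1) U 4 := by
  let f : Bool × Bool ≃ ZMod 4 := Fintype.equivOfCardEq (by simp)
  have := hasProtocol_controlled_mul_controlled 4 1 (fun a => f (t a)) (fun _ => 0)
    (fun k => V (f.symm k)) (fun _ => W) (fun k => hV _) (fun _ => hW)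
    fun a b a' b' => (by simp [hU] : U (a, b) (a', b') = _)
  simp only [Nat.cast_ofNat, logb_two_four, Nat.cast_one, Real.logb_one] at this
  convert this using 1
  norm_num

theorem two_bits_implementation {U : Matrix (A × B) (A × B) ℂ} (t : A → Bool) (e : B → Bool)
    (V : Bool → Matrix B B ℂ) (W : Bool → Matrix A A ℂ)
    (hV : ∀ k, V k ∈ Matrix.unitaryGroup B ℂ) (hW : ∀ k, W k ∈ Matrix.unitaryGroup A ℂ)
    (hU : ∀ a b a' b', U (a, b) (a', b') = V (t a) b b' * W (e b') a a') :
    HasProtocol (ZMod 2 × ZMod 2) U 4 := by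
  let g : Bool ≃ ZMod 2 := Fintype.equivOfCardEq (by simp)
  have := hasProtocol_controlled_mul_controlled 2 2 (fun a => g (t a)) (fun b => g (e b))
    (fun k => V (g.symm k)) (fun k => W (g.symm k)) (fun k => hV _) (fun k => hW _)
    fun a b a' b' => (by simp [hU] : U (a, b) (a', b') = _)
  simp only [Nat.cast_ofNat, Real.logb_self_eq_one (b := 2) (by norm_num)] at this
  convert this using 1
  norm_num

/-- With a single permutation of `A`, removing it locally leaves a control from `A` with one term
for each distinct `y i`. -/
theorem IsNormalForm.controlled_form {P : Fin 3 → Matrix A A ℂ} {Q : Fin 3 → Matrix B B ℂ}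
    (hP : LinearIndependent ℂ P) (hQ : LinearIndependent ℂ Q) {U : Matrix (A × B) (A × B) ℂ}
    (hU : U = ∑ k, P k ⊗ₖ Q k) {C : B → Bool} {σ : Bool → Equiv.Perm A} {y : A → Equiv.Perm B}
    (hn : IsNormalForm (Submodule.span ℂ (Set.range Q)) U C σ y 1) (hσ : σ true = σ false) :
    (∃ U' : Matrix (A × B) (A × B) ℂ, LocalPermEquiv U U' ∧
      (IsControlledPerm 3 U' ∨ IsControlledPerm 4 U')) ∧
    HasProtocol (ZMod 4 × ZMod 1) U 4 := by
  classical
  have := nonempty_of_linearIndependent hQ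
  have hσ' : ∀ e, σ e = σ false := fun e => by cases e <;> simp [hσ]
  have hUeq : ∀ i b j b', U (i, b) (j, b') =
      if i = σ false j then monomialMatrix (y i) 1 b b' else 0 := fun i b j b' => by
    rw [hn.eq, hσ']; rfl
  obtain ⟨g, hg⟩ := exists_two_bits (fourDependent_span Q) (y := y) hn.mem
  let X : Finset (Equiv.Perm B) := Finset.univ.image y
  have hX : ∀ i, y i ∈ X := fun i => Finset.mem_image_of_mem _ (Finset.mem_univ i)
  have hXy : ∀ π ∈ X, ∃ i, y i = π := fun π h => by simpa [X] using h
  have hle : X.card ≤ 4 := by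
    have := Finset.card_le_card_of_injOn (s := X) (t := Finset.univ) g (by simp) (by
      intro π hπ π' hπ' h
      obtain ⟨i, rfl⟩ := hXy π hπ
      obtain ⟨j, rfl⟩ := hXy π' hπ'
      exact hg i j h)
    simpa using this
  have hge : 3 ≤ X.card := by
    by_contra! hlt
    obtain ⟨π₁, π₂, h⟩ : ∃ π₁ π₂, X ⊆ {π₁, π₂} := by
      rcases Nat.lt_succ_iff_lt_or_eq.mp hlt with h | h
      · rcases Nat.lt_succ_iff_lt_or_eq.mp h with h | h
        · exact ⟨1, 1, by rw [Finset.card_eq_zero.mp (Nat.lt_one_iff.mp h)]; simp⟩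
        · obtain ⟨π, h⟩ := Finset.card_eq_one.mp h
          exact ⟨π, π, by simp [h]⟩
      · obtain ⟨π, π', -, h⟩ := Finset.card_eq_two.mp h
        exact ⟨π, π', h.subset⟩
    refine not_blocks_mem_span_pair hP hQ (monomialMatrix π₁ 1) (monomialMatrix π₂ 1) fun i j => ?_
    have : block (∑ k, P k ⊗ₖ Q k) i j =
        if i = σ false j then monomialMatrix (y i) 1 else 0 := by
      ext b b'
      rw [← hU, block, hUeq]
      split_ifs <;> rfl
    rw [this]
    split_ifs
    · apply Submodule.subset_span
      have := h (hX i)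
      simp only [Finset.mem_insert, Finset.mem_singleton] at this
      rcases this with h | h <;> simp [h]
    · exact Submodule.zero_mem _
  refine ⟨⟨_, localPermEquiv_submatrix U 1 (σ false)⁻¹ 1 1, ?_⟩, ?_⟩
  · have hform := isControlledPermFromFirst_of (κ := X) (k := X.card) (by simp)
      (t := fun i => ⟨y i, hX i⟩) (by
        rintro ⟨π, hπ⟩
        obtain ⟨i, hi⟩ := hXy π hπ
        exact ⟨i, Subtype.ext hi⟩) (fun π => π)
      (U := U.submatrix (Prod.map (1 : Equiv.Perm A) (1 : Equiv.Perm B))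
        (Prod.map ((σ false)⁻¹ : Equiv.Perm A) (1 : Equiv.Perm B))) fun a b a' b' => by
          simp [hUeq]
    have : X.card = 3 ∨ X.card = 4 := by omega
    rcases this with h | h <;> rw [h] at hform
    · exact Or.inl (Or.inl hform)
    · exact Or.inr (Or.inl hform)
  · refine four_controls_implementation (fun i => g (y i))
      (fun k => if h : ∃ i, g (y i) = k then monomialMatrix (y h.choose) 1 else 1)
      (monomialMatrix (σ false) 1) (fun k => ?_)
      (monomialMatrix_mem_unitaryGroup (by simp)) fun i b j b' => ?_
    · split_ifs
      · exact monomialMatrix_mem_unitaryGroup (by simp)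
      · exact one_mem _
    · have h : ∃ i', g (y i') = g (y i) := ⟨i, rfl⟩
      rw [hUeq, dif_pos h, hg _ _ h.choose_spec]
      simp [monomialMatrix]

/-- In a normal form with two different permutations of the first party, at most two permutations of
the second party occur. -/
theorem IsNormalForm.eq_of_ne {S : Submodule ℂ (Matrix B B ℂ)}
    (hS : FourDependent (S : Set (Matrix B B ℂ))) {C : B → Bool} (hC : Function.Surjective C)
    {y : A → Equiv.Perm B} (hmem : ∀ i, monomialMatrix (y i) 1 ∈ S) {X : Equiv.Perm B}
    (hX : ∀ ε, colPart C ε (monomialMatrix X 1) ∈ S) {i j : A} (hi : y i ≠ X) (hj : y j ≠ X) :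
    y i = y j := by
  -- Row sums over both column classes force `a = b`, so the relation only involves `X`, `y i` and
  -- `y j`. Three distinct permutation matrices are independent, so two of these coincide.
  obtain ⟨a, b, c, d, hne, h⟩ := hS _ (hX true) _ (hX false) _ (hmem i) _ (hmem j)
  have ev : ∀ x z, a * colPart C true (monomialMatrix X 1) x z +
      b * colPart C false (monomialMatrix X 1) x z + c * monomialMatrix (y i) 1 x z +
      d * monomialMatrix (y j) 1 x z = 0 := fun x z => by
    simpa using congrFun (congrFun h x) z
  have hrow : ∀ z, (if C z then a else b) + c + d = 0 := by
    intro z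
    have := Finset.sum_congr rfl fun z' (_ : z' ∈ Finset.univ) => ev (X z) z'
    simp only [Finset.sum_add_distrib, ← Finset.mul_sum, sum_row_monomialMatrix_one, mul_one,
      Finset.sum_const_zero] at this
    have hs : ∀ ε, ∑ z', colPart C ε (monomialMatrix X 1) (X z) z' = if C z = ε then 1 else 0 := by
      intro ε
      rw [Finset.sum_eq_single z (fun z' _ h => by simp [colPart, monomialMatrix, h.symm])
        (by simp)]
      simp [colPart, monomialMatrix]
    rw [hs, hs] at this
    rw [← this]
    cases C z <;> simp
  obtain ⟨z₁, hz₁⟩ := hC true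
  obtain ⟨z₂, hz₂⟩ := hC false
  have e₁ := hrow z₁
  have e₂ := hrow z₂
  simp only [hz₁, hz₂, if_true, Bool.false_eq_true, if_false] at e₁ e₂
  have hba : b = a := by linear_combination e₂ - e₁
  subst hba
  have ev' : ∀ x z, b * monomialMatrix X 1 x z + c * monomialMatrix (y i) 1 x z +
      d * monomialMatrix (y j) 1 x z = 0 := by
    intro x z
    rw [← ev x z]
    simp only [colPart]
    cases C z <;> simp
  obtain ⟨x, hx⟩ : ∃ x, y i x ≠ X x := by
    by_contra! h'
    exact hi (Equiv.ext h')
  have hd : d ≠ 0 := by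
    rintro rfl
    have h1 := ev' (y i x) x
    simp [monomialMatrix, hx] at h1
    subst h1
    simp at e₁
    exact hne ⟨e₁, e₁, rfl, rfl⟩
  by_cases hxj : y j x = X x
  · have h1 := ev' (y i x) x
    rw [← hxj] at hx
    simp [monomialMatrix, hxj ▸ hx, hx] at h1
    subst h1
    exfalso
    apply hj
    apply monomialMatrix_one_injective
    ext p q
    apply mul_left_cancel₀ hd
    linear_combination ev' p q - monomialMatrix X 1 p q * e₁
  · have h1 := ev' (X x) x
    simp [monomialMatrix, Ne.symm hx, Ne.symm hxj] at h1
    subst h1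
    apply monomialMatrix_one_injective
    ext p q
    apply mul_left_cancel₀ hd
    linear_combination monomialMatrix (y i) 1 p q * e₁ - ev' p q

end Permutations

/-! ### Direct sums for two different permutations of `A`. -/

section DirectSums

variable {A B : Type*} [Fintype A] [DecidableEq A] [Fintype B] [DecidableEq B]

theorem monomialMatrix_subtypePerm {p : B → Prop} [DecidablePred p] (π : Equiv.Perm B)
    (h : ∀ x, p (π x) ↔ p x) (x x' : {x // p x}) :
    monomialMatrix (π.subtypePerm h) 1 x x' = monomialMatrix π 1 (x : B) (x' : B) := by
  simp [monomialMatrix, Subtype.ext_iff]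

/-- A permutation in two steps, such that both permutations of the first party agree wherever the
permutation of the second party differs from a fixed one, is a direct sum from the first side. -/
theorem directSum_of_full_rows {U : Matrix (A × B) (A × B) ℂ} {C : B → Bool}
    {σ : Bool → Equiv.Perm A} {y : A → Equiv.Perm B} {X F : Equiv.Perm B}
    (hU : ∀ i b j b', U (i, b) (j, b') =
      if i = σ (C b') j then monomialMatrix (y i) 1 b b' else 0)
    (hC : Function.Surjective C) (hF : ∀ i, y i ≠ X → y i = F)
    (hfull : ∀ i, y i ≠ X → (σ true).symm i = (σ false).symm i) :
    ∃ U', LocalPermEquiv U U' ∧ IsProductPlusControlled U' := by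
  -- After this normalization the rows with `y i ≠ X` carry the identity on `A`, giving a product,
  -- and the rows with `y i = X` carry the identity on `B`, leaving a control by the bit `C`.
  refine ⟨_, localPermEquiv_submatrix U 1 (σ true).symm X 1, Or.inl
    ⟨Finset.univ.filter fun i => y i ≠ X, ?_⟩⟩
  have hfix : ∀ e i, y i ≠ X → (σ e) ((σ true).symm i) = i := by
    intro e i hi
    cases e
    · rw [hfull i hi]; simp
    · simp
  have hmem : ∀ e i, (((σ true).symm.trans (σ e)) i ∉ Finset.univ.filter fun i => y i ≠ X) ↔
      i ∉ Finset.univ.filter fun i => y i ≠ X := by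
    intro e i
    simp only [Finset.mem_filter, Finset.mem_univ, true_and, not_not, Equiv.trans_apply]
    constructor <;> intro h <;> by_contra hi
    · exact hi (by rwa [hfix e i hi] at h)
    · have h1 := hfix e _ hi
      simp only [EmbeddingLike.apply_eq_iff_eq] at h1
      rw [h1] at hi
      exact hi h
  refine ⟨(1 : Matrix _ _ ℂ) ⊗ₖ monomialMatrix (F.trans X.symm) 1,
    fun x x' => if x.2 = x'.2 then
      monomialMatrix (Equiv.Perm.subtypePerm ((σ true).symm.trans (σ (C x.2))) (hmem _)) 1 x.1 x'.1 else 0,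
    ⟨1, _, ⟨one_mem _, fun i j => ?_⟩, isPermUnitary_monomialMatrix_one _, rfl⟩, Or.inr ?_, ?_⟩
  · simp only [Matrix.one_apply]
    split_ifs <;> simp
  · refine isControlledPermFromFirst_of (κ := Bool) (by simp) hC
      (fun e => Equiv.Perm.subtypePerm ((σ true).symm.trans (σ e)) (hmem e)) fun b a b' a' => ?_
    rfl
  · ext ⟨i, b⟩ ⟨j, b'⟩
    by_cases hi : y i = X
    · by_cases hj : y j = X
      · simp only [Matrix.submatrix_apply, Prod.map_apply, hU, Equiv.Perm.coe_one, id_eq,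
          directSumFirst, monomialMatrix_subtypePerm, hi, hj, Finset.mem_filter, ne_eq,
          not_true_eq_false, and_false, dite_false]
        simp only [monomialMatrix, EmbeddingLike.apply_eq_iff_eq, Pi.one_apply, Equiv.trans_apply]
        by_cases hb : b = b'
        · subst hb
          simp only [if_true]
          congr
        · simp [hb]
      · have hne : i ≠ j := fun h => hj (h ▸ hi)
        simp [directSumFirst, hU, hi, hj, hfix _ j hj, hne]
    · by_cases hj : y j = X
      · have hne : i ≠ σ (C b') ((σ true).symm j) := by
          intro h
          rw [← hfix (C b') i hi] at h
          simp only [EmbeddingLike.apply_eq_iff_eq] at h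
          exact hi (h ▸ hj)
        simp [directSumFirst, hU, hi, hj, hne]
      · have hFX : F ≠ X := hF i hi ▸ hi
        by_cases hij : i = j
        · subst hij
          simp [directSumFirst, hU, hFX, hfix _ i hi, Matrix.one_apply, hF i hi,
            monomialMatrix, Equiv.eq_symm_apply]
        · simp [directSumFirst, hU, hi, hj, hfix _ j hj, Matrix.one_apply, hij]

/-- If the permutations of the second party agree on a class of basis states that controls the first
party, the permutation is a direct sum from the second side. -/
theorem directSum_of_common_columns {U : Matrix (A × B) (A × B) ℂ} {C : B → Bool}
    {σ : Bool → Equiv.Perm A} {y : A → Equiv.Perm B} {X F : Equiv.Perm B}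
    (hU : ∀ i b j b', U (i, b) (j, b') =
      if i = σ (C b') j then monomialMatrix (y i) 1 b b' else 0)
    (hF : ∀ i, y i = X ∨ y i = F) (hsurj : (∃ i, y i = X) ∧ ∃ i, y i ≠ X) {ε : Bool}
    (hε : ∀ b, C b = ε → F b = X b) :
    ∃ U', LocalPermEquiv U U' ∧ IsProductPlusControlled U' := by
  -- On the class `ε` all `y i` equal `X`, so `B` carries the identity and the part is a product. On
  -- the other class `A` carries the identity, and the bit `y i = X` controls `B`.
  refine ⟨_, localPermEquiv_submatrix U 1 (σ !ε).symm X 1, Or.inr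
    ⟨Finset.univ.filter fun b => C b = ε, ?_⟩⟩
  have hmem : ∀ b, ((F.trans X.symm) b ∉ Finset.univ.filter fun b => C b = ε) ↔
      b ∉ Finset.univ.filter fun b => C b = ε := by
    intro b
    simp only [Finset.mem_filter, Finset.mem_univ, true_and, Equiv.trans_apply, not_iff_not]
    constructor <;> intro h
    · have h1 := hε _ h
      simp only [Equiv.apply_symm_apply, EmbeddingLike.apply_eq_iff_eq] at h1
      rwa [h1] at h
    · rw [hε _ h]; simpa using h
  let V : Bool → Equiv.Perm {b // b ∉ Finset.univ.filter fun b => C b = ε} := fun e =>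
    if e then 1 else Equiv.Perm.subtypePerm (F.trans X.symm) hmem
  refine ⟨(1 : Matrix _ _ ℂ) ⊗ₖ monomialMatrix ((σ !ε).symm.trans (σ ε)) 1,
    fun x x' => if x.2 = x'.2 then
      monomialMatrix (V (decide (y x.2 = X))) 1 x.1 x'.1 else 0,
    ⟨1, _, ⟨one_mem _, fun i j => ?_⟩, isPermUnitary_monomialMatrix_one _, rfl⟩, Or.inr ?_, ?_⟩
  · simp only [Matrix.one_apply]
    split_ifs <;> simp
  · refine isControlledPermFromFirst_of (κ := Bool) (t := fun i => decide (y i = X)) (by simp) ?_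
      V fun b a b' a' => ?_
    · obtain ⟨⟨i, hi⟩, j, hj⟩ := hsurj
      rintro (_ | _)
      · exact ⟨j, by simp [hj]⟩
      · exact ⟨i, by simp [hi]⟩
    · rfl
  · ext ⟨b, i⟩ ⟨b', j⟩
    have hUX : ∀ ε', C b' = ε' → swapParties (U.submatrix (Prod.map (1 : Equiv.Perm A) X)
        (Prod.map (σ !ε).symm (1 : Equiv.Perm B))) (b, i) (b', j) =
        if i = σ ε' ((σ !ε).symm j) then if b = X.symm (y i b') then 1 else 0 else 0 := by
      rintro _ rfl
      simp [swapParties, hU, monomialMatrix, Equiv.eq_symm_apply]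
    by_cases hb' : C b' = ε
    · have hy : X.symm (y i b') = b' := by
        rcases hF i with h | h <;> simp [h, hε b' hb']
      rw [hUX ε hb', hy]
      by_cases hb : C b = ε
      · by_cases hbb : b = b'
        · subst hbb
          simp only [directSumFirst, Finset.mem_filter, Finset.mem_univ, true_and, hb, dite_true,
            Matrix.kroneckerMap_apply, Matrix.one_apply_eq, monomialMatrix, Equiv.trans_apply,
            if_true, one_mul, Pi.one_apply]
          congr
        · simp [directSumFirst, hb, hb', monomialMatrix, Matrix.one_apply, hbb]
      · have hne : b ≠ b' := fun h => hb (h ▸ hb')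
        simp [directSumFirst, hb, hb', hne]
    · rw [hUX (!ε) (Bool.eq_not.mpr hb'), Equiv.apply_symm_apply]
      by_cases hb : C b = ε
      · have hne : b ≠ X.symm (y i b') := by
          rw [ne_eq, Equiv.eq_symm_apply]
          intro h
          apply hb'
          rcases hF i with h' | h' <;> rw [h'] at h
          · rwa [← X.injective h]
          · rw [← hε b hb] at h
            rwa [← F.injective h]
        simp [directSumFirst, hb, hb', hne]
      · by_cases hij : i = j
        · subst hij
          by_cases h : y i = X
          · simp [directSumFirst, hb, hb', V, h, monomialMatrix]
          · have hFX : F ≠ X := (hF i).resolve_left h ▸ h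
            simp [directSumFirst, hb, hb', V, hFX, monomialMatrix, (hF i).resolve_left h,
              Subtype.ext_iff]
        · simp [directSumFirst, hb, hb', hij]

/-- Only `X` and one further permutation `F` occur on `B`. If every row with `F` is unsplit, the sum
is from the side of `A`. Otherwise both column parts of `X` and of `F` lie in the space; their
dependence makes `X` and `F` agree on a class, and the sum is from the side of `B`. -/
theorem IsNormalForm.sum_form {S : Submodule ℂ (Matrix B B ℂ)}
    (hS : FourDependent (S : Set (Matrix B B ℂ))) {U : Matrix (A × B) (A × B) ℂ} {C : B → Bool}
    {σ : Bool → Equiv.Perm A} {y : A → Equiv.Perm B} (hn : IsNormalForm S U C σ y 1)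
    (hσ : σ true ≠ σ false) :
    (∃ U', LocalPermEquiv U U' ∧ IsProductPlusControlled U') ∧
    HasProtocol (ZMod 2 × ZMod 2) U 4 := by
  classical
  have hU : ∀ i b j b', U (i, b) (j, b') =
    if i = σ (C b') j then monomialMatrix (y i) 1 b b' else 0 := hn.eq
  obtain ⟨i₀, hi₀⟩ : ∃ i, (σ true).symm i ≠ (σ false).symm i := by
    by_contra! h
    exact hσ (Equiv.symm_bijective.injective (Equiv.ext h))
  have hX : ∀ ε, colPart C ε (monomialMatrix (y i₀) 1) ∈ S := (hn.split i₀).resolve_left hi₀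
  have hC := hn.surj.resolve_left hσ
  obtain ⟨X, hXy⟩ : ∃ X, X = y i₀ := ⟨_, rfl⟩
  rw [← hXy] at hX
  obtain ⟨F, hF⟩ : ∃ F, ∀ i, y i ≠ X → y i = F := by
    by_cases h : ∃ i, y i ≠ X
    · exact ⟨y h.choose, fun i hi => IsNormalForm.eq_of_ne hS hC hn.mem hX hi h.choose_spec⟩
    · push Not at h
      exact ⟨X, fun i hi => absurd (h i) hi⟩
  constructor
  · by_cases hfull : ∀ i, y i ≠ X → (σ true).symm i = (σ false).symm i
    · exact directSum_of_full_rows hU hC hF hfull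
    · push Not at hfull
      obtain ⟨i₁, hi₁, hi₁'⟩ := hfull
      have hFy := hF i₁ hi₁
      have hFS : ∀ ε, colPart C ε (monomialMatrix F 1) ∈ S := by
        rw [← hFy]
        exact (hn.split i₁).resolve_left hi₁'
      obtain ⟨ε, hε⟩ : ∃ ε, ∀ b, C b = ε → F b = X b := by
        by_contra! h
        obtain ⟨b₁, hb₁, h₁⟩ := h true
        obtain ⟨b₂, hb₂, h₂⟩ := h false
        obtain ⟨a, b, c, d, hne, h⟩ := hS _ (hX true) _ (hX false) _ (hFS true) _ (hFS false)
        have ev : ∀ x z, a * colPart C true (monomialMatrix X 1) x z +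
            b * colPart C false (monomialMatrix X 1) x z +
            c * colPart C true (monomialMatrix F 1) x z +
            d * colPart C false (monomialMatrix F 1) x z = 0 := fun x z => by
          simpa using congrFun (congrFun h x) z
        have e₁ := ev (X b₁) b₁
        have e₂ := ev (F b₁) b₁
        have e₃ := ev (X b₂) b₂
        have e₄ := ev (F b₂) b₂
        simp [colPart, monomialMatrix, hb₁, hb₂, h₁, h₂, h₁.symm, h₂.symm] at e₁ e₂ e₃ e₄
        exact hne ⟨e₁, e₃, e₂, e₄⟩
      exact directSum_of_common_columns hU (fun i => or_iff_not_imp_left.mpr (hF i))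
        ⟨⟨i₀, hXy.symm⟩, i₁, hi₁⟩ hε
  · refine two_bits_implementation (fun i => decide (y i = X)) C
      (fun e => monomialMatrix (if e then X else F) 1) (fun e => monomialMatrix (σ e) 1)
      (fun _ => monomialMatrix_mem_unitaryGroup (by simp))
      (fun _ => monomialMatrix_mem_unitaryGroup (by simp)) fun i b j b' => ?_
    have : (if decide (y i = X) = true then X else F) = y i := by
      by_cases h : y i = X
      · simp [h]
      · rw [decide_eq_false h, hF i h]; rfl
    rw [hU, this]
    simp [monomialMatrix]

theorem permutation_form_and_implementation {U : Matrix (A × B) (A × B) ℂ} (hrank : HasSchmidtRank U 3)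
    (hU : IsPermUnitary U) :
    (∃ U' : Matrix (A × B) (A × B) ℂ, LocalPermEquiv U U' ∧
      (IsControlledPerm 3 U' ∨ IsControlledPerm 4 U' ∨ IsProductPlusControlled U')) ∧
    ImplementableWith U 2 4 := by
  obtain ⟨π, rfl⟩ := hU.exists_eq_monomialMatrix
  obtain ⟨P, Q, hP, hQ, hPQ⟩ := id hrank
  have := nonempty_of_linearIndependent hP
  have := nonempty_of_linearIndependent hQ
  by_cases hpat : ∀ i i' b, (π.symm (i, b)).2 = (π.symm (i', b)).2
  · obtain ⟨P', Q', hP', hQ', hPQ'⟩ := hrank.swapParties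
    obtain ⟨C, σ, y, hσ, hn⟩ := exists_isNormalForm_swapParties
      (Submodule.span ℂ (Set.range Q')) (π := π) (u := 1)
      (fun i j => by rw [hPQ']; exact block_sum_kronecker_mem P' Q' i j) hpat
    obtain ⟨⟨U', hU', hform⟩, hprot⟩ := IsNormalForm.controlled_form hP' hQ' hPQ' hn hσ
    refine ⟨⟨swapParties U', ?_, ?_⟩, ?_⟩
    · simpa only [swapParties_swapParties] using hU'.swapParties
    · exact hform.imp IsControlledPerm.swapParties fun h => Or.inl h.swapParties
    · have := hprot.swapParties.implementableWith
      rw [swapParties_swapParties] at this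
      simpa [logb_two_four] using this
  · obtain ⟨C, σ, y, hn⟩ := (pattern_const_or_exists_isNormalForm (Q := Q) (u := 1) (by simp)
      (fun i j => by rw [hPQ]; exact block_sum_kronecker_mem P Q i j)).resolve_left hpat
    by_cases hσ : σ true = σ false
    · obtain ⟨⟨U', hU', hform⟩, hprot⟩ := IsNormalForm.controlled_form hP hQ hPQ hn hσ
      refine ⟨⟨U', hU', hform.imp_right Or.inl⟩, ?_⟩
      simpa [logb_two_four] using hprot.implementableWith
    · obtain ⟨⟨U', hU', hform⟩, hprot⟩ := IsNormalForm.sum_form (fourDependent_span Q) hn hσ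
      refine ⟨⟨U', hU', Or.inr (Or.inr hform)⟩, ?_⟩
      have := hprot.implementableWith
      norm_num [logb_two_four] at this
      exact this

end DirectSums

theorem lemma7 {A B : Type*} [Fintype A] [DecidableEq A] [Fintype B] [DecidableEq B]
    (U : Matrix (A × B) (A × B) ℂ) (hrank : HasSchmidtRank U 3) :
    (IsPermUnitary U →
      (∃ U' : Matrix (A × B) (A × B) ℂ, LocalPermEquiv U U' ∧
        (IsControlledPerm 3 U' ∨ IsControlledPerm 4 U' ∨ IsProductPlusControlled U')) ∧
      ImplementableWith U 2 4) ∧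
    (IsComplexPermUnitary U →
      (¬ ∃ D : Matrix (A × B) (A × B) ℂ, D.IsDiag ∧ LocalPermEquiv U D) →
      ImplementableWithLOCC U 3) ∧
    (IsComplexPermUnitary U → U.IsDiag →
      (∃ a, diagBlock U a = 1) →
      (∃ a, (Set.range fun b => diagBlock U a b b).ncard = 2) →
      ImplementableWithLOCC U 2) := by
  refine ⟨permutation_form_and_implementation hrank, fun hU hdiag => ?_, fun hU hdiag hone htwo => ?_⟩
  · obtain ⟨c, hc⟩ := exists_hasProtocol_of_not_diagonal hrank hU hdiag
    refine ⟨c, ?_⟩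
    have h : Real.logb 2 8 = 3 := by
      rw [show (8 : ℝ) = 2 ^ (3 : ℝ) by norm_num]
      exact Real.logb_rpow (by norm_num) (by norm_num)
    have := hc.implementableWith
    norm_num [h] at this
    exact this
  · obtain ⟨c, hc⟩ := exists_hasProtocol_of_diagonal hrank hU hdiag hone htwo
    refine ⟨c, ?_⟩
    have := hc.implementableWith
    norm_num [logb_two_four] at this
    exact this
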